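/- **Problem.** Let $d\ge 2$, $T>0$, let $\Omega\subset\mathbb R^d$ be a bounded Lipschitz domain and let $A,B$ be non-empty compact metric spaces. Let $(\alpha,\beta)\mapsto(a^{\alpha\beta},b^{\alpha\beta},c^{\alpha\beta},f^{\alpha\beta})$ be continuous from $A\times B$ to $C(\overline\Omega)\times C(\overline\Omega,\mathbb R^d)\times C(\overline\Omega)\times C(\overline\Omega)$, with $a^{\alpha\beta}\ge 0$ on $\Omega$; let $g\in W^{1,\infty}(\mathbb R^d)$ with $\Delta g\in L^\infty(\Omega)$, and $v_T\in C(\overline\Omega)$ with $v_T=g$ on $\partial\Omega$. Consider the isotropic Isaacs problem $$-\partial_t v+\inf_{\beta}\sup_{\alpha}\bigl(-a^{\alpha\beta}\Delta v-b^{\alpha\beta}\cdot\nabla v+c^{\alpha\beta}v-f^{\alpha\beta}\bigr)=0\ \text{in }(0,T)\times\Omega,\quad v=g\ \text{on }(0,T)\times\partial\Omega,\quad v=v_T\ \text{on }\{T\}\times\overline\Omega. \tag{1}$$ For $t\in[0,T]$, $x\in\overline\Omega$ put $F(t,x,q,p,r,s)=-r+\inf_\beta\sup_\alpha(-a^{\alpha\beta}(x)q-b^{\alpha\beta}(x)\cdot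 p+c^{\alpha\beta}(x)s-f^{\alpha\beta}(x))$ if $t<T$, $x\in\Omega$; $F=s-g(x)$ if $t<T$, $x\in\partial\Omega$; $F=s-v_T(x)$ if $t=T$. Upper stars and lower stars denote upper and lower semicontinuous envelopes, for functions on $[0,T]\times\overline\Omega$ and for $F$ on $[0,T]\times\overline\Omega\times\mathbb R\times\mathbb R^d\times\mathbb R\times\mathbb R$. Let $\omega\subseteq\partial\Omega$. A function $z$ satisfies the strong conditions if $z^*(t,x)=z_*(t,x)=g(x)$ for all $t\in[0,T]$, $x\in\omega$, and $z^*(T,x)=z_*(T,x)=v_T(x)$ for all $x\in\overline\Omega$. A bounded $v:[0,T]\times\overline\Omega\to\mathbb R$ is a (viscosity) subsolution of (1), strongly on $\omega$, if $v^*$ satisfies the strong conditions and $F_*(t,x,\Delta\psi,\nabla\psi,\partial_t\psi,v^*(t,x))\le 0$ (derivatives at $(t,x)$) whenever $\psi\in C^2(\mathbb R\times\mathbb R^d)$ and $v^*-\psi$ has at $(t,x)\in[0,T)\times\overline\Omega$ a local maximum relative to $[0,T)\times\overline\Omega$; a supersolution if $v_*$ satisfies the strong conditions and $F^*(t,x,\Delta\psi,\nabla\psi,\partial_t\psi,v_*(t,x))\ge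 0$ whenever $v_*-\psi$ has such a local minimum; a viscosity solution if it is both. **Scheme.** For $i\in\mathbb N$ let $\mathcal T_i$ be shape-regular finite conforming simplicial meshes of $\overline\Omega$ with mesh sizes tending to $0$, $V_i$ the space of continuous functions that are affine on each simplex of $\mathcal T_i$, $\phi_y$ the hat function of the node $y$, and $\hat\phi_y=\phi_y/\|\phi_y\|_{L^1(\Omega)}$. Internal nodes are the nodes in $\Omega$. Let $h_i=T/N_i$ with positive integers $N_i\to\infty$ and $s_i^k=kh_i$. With linear maps $P_i$ into $V_i$, discrete coefficients $\bar a_i,\bar b_i,\bar c_i$ (explicit), $\bar{\bar a}_i,\bar{\bar b}_i,\bar{\bar c}_i$ (implicit) and data $f_i$, all depending on $(\alpha,\beta)$, set at internal nodes $y$ $$(\mathsf E_iw)_y=\bar a_i(y)\langle\nabla w,\nabla\hat\phi_y\rangle+\langle-\bar b_i\cdot\nabla w+\bar c_iw,\hat\phi_y\rangle,\qquad (\mathsf F_i)_y=\langle f_i,\hat\phi_y\rangle,$$ and define $\mathsf I_i$ in the same way with $\bar{\bar a}_i,\bar{\bar b}_i,\bar{\bar c}_i$. A numerical solution consists of $v_i(s_i^k,\cdot)\in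 V_i$, $0\le k\le N_i$, with $v_i(T,\cdot)=P_iv_T$ and, for $k<N_i$, $v_i(s_i^k,\cdot)=P_ig$ on $\partial\Omega$ and, at all internal nodes $y$, $$-\frac{v_i(s_i^{k+1},y)-v_i(s_i^k,y)}{h_i}+\inf_\beta\sup_\alpha\bigl(\mathsf E_i^{\alpha\beta}v_i(s_i^{k+1},\cdot)+\mathsf I_i^{\alpha\beta}v_i(s_i^k,\cdot)-\mathsf F_i^{\alpha\beta}\bigr)_y=0 .$$ **Assumptions.** 1. (Elliptic projection) $\langle\nabla P_iw,\nabla\hat\phi_y\rangle=\langle\nabla w,\nabla\hat\phi_y\rangle$ for all $w\in H^1(\Omega)$ and internal nodes $y$. There is $C$ with $\|P_iw\|_{W^{1,\infty}(\Omega)}\le C\|w\|_{W^{1,\infty}(\Omega)}$ for all $i$, and $\|P_iw-w\|_{W^{1,\infty}(\Omega)}\to0$ as $i\to\infty$, for every $w\in C^\infty(\mathbb R^d)$. For the data, $\sup_i\|P_ig\|_{W^{1,\infty}(\Omega)}<\infty$, and $P_ig\to g$, $P_iv_T\to v_T$ uniformly on $\overline\Omega$. 2. (Consistency) $\bar b_i,\bar{\bar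 b}_i,\bar c_i,\bar{\bar c}_i,f_i$ are in $L^\infty(\Omega)$ and depend for each $i$ continuously (in $L^\infty$) on $(\alpha,\beta)$, as do the values of $\bar a_i,\bar{\bar a}_i$ at internal nodes; $\bar c_i,\bar{\bar c}_i\ge0$; $\|\bar c_i\|_{L^\infty}+\|\bar{\bar c}_i\|_{L^\infty}\le\gamma$ with $\gamma$ independent of $i,\alpha,\beta$; and, as $i\to\infty$, uniformly in $(\alpha,\beta)$, $$\sup_{y}\|a-(\bar a_i(y)+\bar{\bar a}_i(y))\|_{L^\infty(\operatorname{supp}\hat\phi_y)}+\|b-(\bar b_i+\bar{\bar b}_i)\|_{L^\infty(\Omega)}+\|c-(\bar c_i+\bar{\bar c}_i)\|_{L^\infty(\Omega)}+\|f-f_i\|_{L^\infty(\Omega)}\to0,$$ the supremum being over the internal nodes $y$. 3. (Monotonicity) For all $i,\alpha,\beta$ and internal nodes $y$: $(\mathsf E_i\phi_z)_y\le0$ for every node $z\ne y$; $h_i(\mathsf E_i\phi_y)_y\le1$; and $(\mathsf I_iu)_y\le0$ whenever $u\in V_i$ has a non-positive local minimum at $y$. 4. (Barriers) For all $y\in\omega$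 and $\varepsilon>0$ there are Lipschitz functions $\zeta_{y,\varepsilon},\xi_{y,\varepsilon}$ on $[0,T]\times\overline\Omega$ with $P_i\zeta_{y,\varepsilon}\to\zeta_{y,\varepsilon}$ and $P_i\xi_{y,\varepsilon}\to\xi_{y,\varepsilon}$ uniformly on $[0,T]\times\overline\Omega$ ($P_i$ acting in $x$) such that: (a) for all sufficiently large $i$ and all $k$, $v_i(s_i^k,\cdot)-P_i\zeta_{y,\varepsilon}(s_i^k,\cdot)$ has a minimiser over $\overline\Omega$ lying on $\partial\Omega$, and $v_i(s_i^k,\cdot)-P_i\xi_{y,\varepsilon}(s_i^k,\cdot)$ has a maximiser over $\overline\Omega$ lying on $\partial\Omega$; (b) for each $t\in[0,T]$ there are minimisers $q_\varepsilon$ of $g-\zeta_{y,\varepsilon}(t,\cdot)$ over $\partial\Omega$ and maximisers $r_\varepsilon$ of $g-\xi_{y,\varepsilon}(t,\cdot)$ over $\partial\Omega$ with $q_\varepsilon\to y$, $r_\varepsilon\to y$, $\liminf_{\varepsilon\to0}(\zeta_{y,\varepsilon}(t,y)-\zeta_{y,\varepsilon}(t,q_\varepsilon))\ge0$ and $\limsup_{\varepsilon\to0}(\xi_{y,\varepsilon}(t,y)-\xi_{y,\varepsilon}(t,r_\varepsilon))\le0$.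 5. (Comparison) If $u$ is a subsolution and $w$ a supersolution of (1), strongly on $\omega$, then $u\le w$ on $[0,T]\times\overline\Omega$. **Theorem.** Let $(v_i)$ be numerical solutions and let $$\overline v(t,x)=\limsup_{i\to\infty,\ (s_i^k,y)\to(t,x)}v_i(s_i^k,y),\qquad \underline v(t,x)=\liminf_{i\to\infty,\ (s_i^k,y)\to(t,x)}v_i(s_i^k,y)$$ ($y$ ranging over the nodes of $\mathcal T_i$). Under assumptions 1–5, problem (1) has a unique viscosity solution $v$ (strongly on $\omega$), and $\underline v=\overline v=v$ on $[0,T]\times\overline\Omega$. Moreover $v_i\to v$ uniformly on $(0,T)\times\Omega$, in particular $$\lim_{i\to\infty}\|v_i-v\|_{L^\infty((0,T)\times\Omega)}=0,$$ for every extension of the $v_i$ from the time steps to $[0,T]$ whose value at $(t,x)$ with $t\in[s_i^k,s_i^{k+1}]$ lies between $v_i(s_i^k,x)$ and $v_i(s_i^{k+1},x)$ (e.g. the piecewise linear or piecewise constant one). -/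

import Mathlib

open Set Filter Topology MeasureTheory
open scoped ENNReal NNReal Gradient

noncomputable section

namespace Isaacs

/-- Euclidean space `ℝ^d`. -/
abbrev E (d : ℕ) : Type := EuclideanSpace ℝ (Fin d)

/-! ### Semicontinuous envelopes -/

/-- Upper semicontinuous envelope relative to `D`: `u^*(z) = limsup_{D ∋ z' → z} u(z')`
(the point `z' = z` is admitted). -/
def uscEnv {X : Type*} [TopologicalSpace X] (D : Set X) (u : X → ℝ) (z : X) : ℝ :=
  limsup u (𝓝[D] z)

/-- Lower semicontinuous envelope relative to `D`: `u_*(z) = liminf_{D ∋ z' → z} u(z')`. -/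
def lscEnv {X : Type*} [TopologicalSpace X] (D : Set X) (u : X → ℝ) (z : X) : ℝ :=
  liminf u (𝓝[D] z)

/-! ### Weak derivatives, Lipschitz domains, norms -/

/-- `G` is the weak gradient of `w` on the open set `Ω`. -/
def HasWeakGradient {d : ℕ} (Ω : Set (E d)) (w : E d → ℝ) (G : E d → E d) : Prop :=
  ∀ φ : E d → ℝ, ContDiff ℝ (⊤ : ℕ∞) φ → HasCompactSupport φ → tsupport φ ⊆ Ω →
    ∀ e : E d, ∫ x in Ω, w x * fderiv ℝ φ x e = - ∫ x in Ω, inner ℝ (G x) e * φ x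

/-- `G` is the weak (distributional) Laplacian of `w` on the open set `Ω`. -/
def HasWeakLaplacian {d : ℕ} (Ω : Set (E d)) (w G : E d → ℝ) : Prop :=
  ∀ φ : E d → ℝ, ContDiff ℝ (⊤ : ℕ∞) φ → HasCompactSupport φ → tsupport φ ⊆ Ω →
    ∫ x in Ω, w x * Laplacian.laplacian φ x = ∫ x in Ω, G x * φ x

/-- Near each boundary point, after a rotation, `Ω` is the set of points lying strictly above the
graph of a Lipschitz function of the remaining `d - 1` coordinates (`e` is the vertical
direction). -/
def HasLipschitzBoundary {d : ℕ} (Ω : Set (E d)) : Prop :=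
  ∀ x₀ ∈ frontier Ω, ∃ (e : E d) (r : ℝ) (K : ℝ≥0) (γ : E d → ℝ),
    ‖e‖ = 1 ∧ 0 < r ∧ LipschitzWith K γ ∧
      ∀ x ∈ Metric.ball x₀ r, x ∈ Ω ↔ γ (x - inner ℝ x e • e) < inner ℝ x e

/-- The `W^{1,∞}(Ω)` norm of an almost everywhere differentiable representative (used for functions
that are smooth, globally Lipschitz or continuous piecewise linear, for which the pointwise gradient
is the weak gradient). -/
def W1infNorm {d : ℕ} (Ω : Set (E d)) (w : E d → ℝ) : ℝ≥0∞ :=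
  eLpNorm w ∞ (volume.restrict Ω) + eLpNorm (fun x => ∇ w x) ∞ (volume.restrict Ω)

/-! ### P1 finite elements on a simplicial mesh -/

/-- The space of continuous piecewise linear functions on a finite simplicial mesh: functions which
on every simplex agree with an affine function (values outside the mesh are irrelevant). -/
def P1Space {d : ℕ} (M : Geometry.SimplicialComplex ℝ (E d)) : Submodule ℝ (E d → ℝ) where
  carrier := {u | ∀ s ∈ M.faces, ∃ L : E d →ᵃ[ℝ] ℝ, EqOn u L (convexHull ℝ (s : Set (E d)))}
  zero_mem' := fun s _ => ⟨0, fun x _ => rfl⟩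
  add_mem' := by
    intro u w hu hw s hs
    obtain ⟨L, hL⟩ := hu s hs
    obtain ⟨L', hL'⟩ := hw s hs
    exact ⟨L + L', fun x hx => by simp [hL hx, hL' hx]⟩
  smul_mem' := by
    intro c u hu s hs
    obtain ⟨L, hL⟩ := hu s hs
    exact ⟨c • L, fun x hx => by simp [hL hx]⟩

/-- The hat function of the vertex `y`: its value at a point `x` of the mesh is the barycentric
coordinate of `x` with respect to `y` (zero if `y` is not a vertex of the simplex containing `x`);
it is extended by zero. The set below is a singleton for `x` in the mesh and empty otherwise. -/
def hat {d : ℕ} (M : Geometry.SimplicialComplex ℝ (E d)) (y x : E d) : ℝ :=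
  sSup {c : ℝ | ∃ s ∈ M.faces, ∃ w : E d → ℝ, (∀ z ∈ s, 0 ≤ w z) ∧ (∀ z ∉ s, w z = 0) ∧
    ∑ z ∈ s, w z = 1 ∧ ∑ z ∈ s, w z • z = x ∧ c = w y}

/-- The hat function normalised in `L^1(Ω)`. -/
def hatN {d : ℕ} (Ω : Set (E d)) (M : Geometry.SimplicialComplex ℝ (E d)) (y x : E d) : ℝ :=
  hat M y x / ∫ z in Ω, |hat M y z|

/-- The mesh size: the largest diameter of an element. -/
def meshSize {d : ℕ} (M : Geometry.SimplicialComplex ℝ (E d)) : ℝ :=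
  ⨆ s : M.faces, Metric.diam (convexHull ℝ ((s : Finset (E d)) : Set (E d)))

/-! ### The final-boundary value problem -/

/-- Data of the isotropic Isaacs final-boundary value problem together with the standing assumptions
on them. The coefficients are functions of `(α, β) ∈ A × B` and of `x`. Since `A`, `B` and
`closure Ω` are compact, joint continuity on `(A × B) × closure Ω` is equivalent to continuity of
`(α, β) ↦ (a, b, c, f)` into the continuous functions on `closure Ω` with the sup norm, and it
implies the equicontinuity of the four families. -/
structure Problem (d : ℕ) (A B : Type*) [MetricSpace A] [MetricSpace B] where
  T : ℝ
  Ω : Set (E d)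
  a : A × B → E d → ℝ
  b : A × B → E d → E d
  c : A × B → E d → ℝ
  f : A × B → E d → ℝ
  g : E d → ℝ
  vT : E d → ℝ
  T_pos : 0 < T
  isOpen_Ω : IsOpen Ω
  isConnected_Ω : IsConnected Ω
  isBounded_Ω : Bornology.IsBounded Ω
  lipschitz_Ω : HasLipschitzBoundary Ω
  cont_a : ContinuousOn (fun q : (A × B) × E d => a q.1 q.2) (univ ×ˢ closure Ω)
  cont_b : ContinuousOn (fun q : (A × B) × E d => b q.1 q.2) (univ ×ˢ closure Ω)
  cont_c : ContinuousOn (fun q : (A × B) × E d => c q.1 q.2) (univ ×ˢ closure Ω)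
  cont_f : ContinuousOn (fun q : (A × B) × E d => f q.1 q.2) (univ ×ˢ closure Ω)
  a_nonneg : ∀ p, ∀ x ∈ Ω, 0 ≤ a p x
  /-- `g ∈ W^{1,∞}(ℝ^d)`, i.e. `g` is bounded and Lipschitz continuous -/
  g_bounded : ∃ C : ℝ, ∀ x, |g x| ≤ C
  g_lipschitz : ∃ K : ℝ≥0, LipschitzWith K g
  /-- `Δ g ∈ L^∞(Ω)` -/
  g_laplacian : ∃ G : E d → ℝ, MemLp G ∞ (volume.restrict Ω) ∧ HasWeakLaplacian Ω g G
  cont_vT : ContinuousOn vT (closure Ω)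
  vT_eq_g : EqOn vT g (frontier Ω)

namespace Problem

variable {d : ℕ} {A B : Type*} [MetricSpace A] [MetricSpace B] (Q : Problem d A B)

/-- The closed space-time cylinder `[0,T] × closure Ω`. -/
def cyl : Set (ℝ × E d) := Icc 0 Q.T ×ˢ closure Q.Ω

open Classical in
/-- The operator `F(t,x,q,p,r,s)`; it is considered for `t ∈ [0,T]` and `x ∈ closure Ω` only. -/
def F : ℝ × E d × ℝ × E d × ℝ × ℝ → ℝ := fun (t, x, q, p, r, s) =>
  if t < Q.T then
    if x ∈ Q.Ω then
      - r + ⨅ β : B, ⨆ α : A,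
        (- Q.a (α, β) x * q - inner ℝ (Q.b (α, β) x) p + Q.c (α, β) x * s - Q.f (α, β) x)
    else s - Q.g x
  else s - Q.vT x

/-- The domain `[0,T] × closure Ω × ℝ × ℝ^d × ℝ × ℝ` of `F`. -/
def domF : Set (ℝ × E d × ℝ × E d × ℝ × ℝ) := {z | z.1 ∈ Icc 0 Q.T ∧ z.2.1 ∈ closure Q.Ω}

/-- The point `(t, x, Δψ(t,x), ∇ψ(t,x), ∂ₜψ(t,x), s)`. -/
def jet (ψ : ℝ × E d → ℝ) (z : ℝ × E d) (s : ℝ) : ℝ × E d × ℝ × E d × ℝ × ℝ :=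
  (z.1, z.2, Laplacian.laplacian (fun y => ψ (z.1, y)) z.2, ∇ (fun y => ψ (z.1, y)) z.2,
    deriv (fun t => ψ (t, z.2)) z.1, s)

/-- `v` satisfies the final time conditions strongly on `closure Ω` and the Dirichlet boundary
conditions strongly on `ω`. -/
def StrongConditions (ω : Set (E d)) (v : ℝ × E d → ℝ) : Prop :=
  (∀ x ∈ ω, ∀ t ∈ Icc 0 Q.T,
    uscEnv Q.cyl v (t, x) = Q.g x ∧ lscEnv Q.cyl v (t, x) = Q.g x) ∧
  ∀ x ∈ closure Q.Ω,
    uscEnv Q.cyl v (Q.T, x) = Q.vT x ∧ lscEnv Q.cyl v (Q.T, x) = Q.vT x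

/-- Viscosity subsolution, strongly on `ω`. -/
def IsSubsolution (ω : Set (E d)) (v : ℝ × E d → ℝ) : Prop :=
  (∃ C : ℝ, ∀ z ∈ Q.cyl, |v z| ≤ C) ∧
  (∀ ψ : ℝ × E d → ℝ, ContDiff ℝ 2 ψ → ∀ z ∈ Ico 0 Q.T ×ˢ closure Q.Ω,
    IsLocalMaxOn (fun z' => uscEnv Q.cyl v z' - ψ z') (Ico 0 Q.T ×ˢ closure Q.Ω) z →
      lscEnv Q.domF Q.F (jet ψ z (uscEnv Q.cyl v z)) ≤ 0) ∧
  Q.StrongConditions ω (uscEnv Q.cyl v)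

/-- Viscosity supersolution, strongly on `ω`. -/
def IsSupersolution (ω : Set (E d)) (v : ℝ × E d → ℝ) : Prop :=
  (∃ C : ℝ, ∀ z ∈ Q.cyl, |v z| ≤ C) ∧
  (∀ ψ : ℝ × E d → ℝ, ContDiff ℝ 2 ψ → ∀ z ∈ Ico 0 Q.T ×ˢ closure Q.Ω,
    IsLocalMinOn (fun z' => lscEnv Q.cyl v z' - ψ z') (Ico 0 Q.T ×ˢ closure Q.Ω) z →
      0 ≤ uscEnv Q.domF Q.F (jet ψ z (lscEnv Q.cyl v z))) ∧
  Q.StrongConditions ω (lscEnv Q.cyl v)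

/-- Viscosity solution, strongly on `ω`. -/
def IsViscositySolution (ω : Set (E d)) (v : ℝ × E d → ℝ) : Prop :=
  Q.IsSubsolution ω v ∧ Q.IsSupersolution ω v

/-- Comparison principle: subsolutions lie below supersolutions on `[0,T] × closure Ω`. -/
def ComparisonPrinciple (ω : Set (E d)) : Prop :=
  ∀ u w : ℝ × E d → ℝ, Q.IsSubsolution ω u → Q.IsSupersolution ω w → ∀ z ∈ Q.cyl, u z ≤ w z

end Problem

/-! ### The numerical scheme -/

/-- A sequence of P1 discretisations: shape-regular simplicial meshes `mesh i` of `closure Ω`,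
numbers `N i` of time steps, linear maps `P i` into the finite element spaces, and the coefficients
of the explicit part (`aE, bE, cE`), of the implicit part (`aI, bI, cI`) and the discrete data `fD`.
The maps `P i` are only ever used, and subject to conditions, on special classes of functions; it is
no restriction to let them be defined on all functions, as linear maps extend from subspaces. -/
structure Discretisation {d : ℕ} {A B : Type*} [MetricSpace A] [MetricSpace B]
    (Q : Problem d A B) where
  mesh : ℕ → Geometry.SimplicialComplex ℝ (E d)
  N : ℕ → ℕ
  P : (i : ℕ) → (E d → ℝ) →ₗ[ℝ] P1Space (mesh i)
  aE : ℕ → A × B → E d → ℝ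
  bE : ℕ → A × B → E d → E d
  cE : ℕ → A × B → E d → ℝ
  aI : ℕ → A × B → E d → ℝ
  bI : ℕ → A × B → E d → E d
  cI : ℕ → A × B → E d → ℝ
  fD : ℕ → A × B → E d → ℝ
  finite_mesh : ∀ i, (mesh i).faces.Finite
  space_mesh : ∀ i, (mesh i).space = closure Q.Ω
  shape_regular : ∃ σ : ℝ, 0 < σ ∧ ∀ i, ∀ s ∈ (mesh i).faces, s.card = d + 1 →
    ∃ x, Metric.closedBall x (σ * Metric.diam (convexHull ℝ (s : Set (E d)))) ⊆
      convexHull ℝ (s : Set (E d))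
  meshSize_tendsto : Tendsto (fun i => meshSize (mesh i)) atTop (𝓝 0)
  N_pos : ∀ i, 0 < N i
  /-- the time step sizes `T / N i` tend to zero -/
  N_tendsto : Tendsto N atTop atTop

namespace Discretisation

variable {d : ℕ} {A B : Type*} [MetricSpace A] [MetricSpace B] {Q : Problem d A B}
  (S : Discretisation Q)

/-- The time step size `h_i`. -/
def h (i : ℕ) : ℝ := Q.T / S.N i

/-- The time `s_i^k`. -/
def time (i k : ℕ) : ℝ := k * S.h i

/-- The internal nodes. -/
def internalNodes (i : ℕ) : Set (E d) := (S.mesh i).vertices ∩ Q.Ω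

/-- The discrete operator with coefficients `a, b, c`, applied to `w` and evaluated at the internal
node `y`: `a(y) ⟨∇w, ∇φ̂_y⟩ + ⟨-b·∇w + c w, φ̂_y⟩`. -/
def discOp (i : ℕ) (a : E d → ℝ) (b : E d → E d) (c : E d → ℝ) (w : E d → ℝ) (y : E d) : ℝ :=
  a y * (∫ x in Q.Ω, inner ℝ (∇ w x) (∇ (hatN Q.Ω (S.mesh i) y) x)) +
    ∫ x in Q.Ω, (- inner ℝ (b x) (∇ w x) + c x * w x) * hatN Q.Ω (S.mesh i) y x

/-- The explicit operator at internal nodes. -/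
def opE (i : ℕ) (p : A × B) (w : E d → ℝ) (y : E d) : ℝ :=
  S.discOp i (S.aE i p) (S.bE i p) (S.cE i p) w y

/-- The implicit operator at internal nodes. -/
def opI (i : ℕ) (p : A × B) (w : E d → ℝ) (y : E d) : ℝ :=
  S.discOp i (S.aI i p) (S.bI i p) (S.cI i p) w y

/-- The discrete right-hand side at internal nodes. -/
def opF (i : ℕ) (p : A × B) (y : E d) : ℝ :=
  ∫ x in Q.Ω, S.fD i p x * hatN Q.Ω (S.mesh i) y x

/-- Elliptic projections: the Galerkin orthogonality on `H^1(Ω)`, stability and convergence in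
`W^{1,∞}(Ω)` for smooth functions, and, for the data `g` and `v_T` (which need not be smooth),
boundedness of `P i g` in `W^{1,∞}(Ω)` and uniform convergence of `P i g` and `P i v_T`. -/
structure EllipticProjection : Prop where
  orthogonality : ∀ i, ∀ (w : E d → ℝ) (G : E d → E d), MemLp w 2 (volume.restrict Q.Ω) →
    MemLp G 2 (volume.restrict Q.Ω) → HasWeakGradient Q.Ω w G → ∀ y ∈ S.internalNodes i,
      ∫ x in Q.Ω, inner ℝ (∇ (S.P i w : E d → ℝ) x) (∇ (hatN Q.Ω (S.mesh i) y) x) =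
        ∫ x in Q.Ω, inner ℝ (G x) (∇ (hatN Q.Ω (S.mesh i) y) x)
  stability : ∃ C : ℝ≥0, ∀ w : E d → ℝ, ContDiff ℝ (⊤ : ℕ∞) w → ∀ i,
    W1infNorm Q.Ω (S.P i w : E d → ℝ) ≤ C * W1infNorm Q.Ω w
  convergence : ∀ w : E d → ℝ, ContDiff ℝ (⊤ : ℕ∞) w →
    Tendsto (fun i => W1infNorm Q.Ω ((S.P i w : E d → ℝ) - w)) atTop (𝓝 0)
  bounded_g : ∃ C : ℝ≥0, ∀ i, W1infNorm Q.Ω (S.P i Q.g : E d → ℝ) ≤ C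
  convergence_g : TendstoUniformlyOn (fun i => (S.P i Q.g : E d → ℝ)) Q.g atTop (closure Q.Ω)
  convergence_vT : TendstoUniformlyOn (fun i => (S.P i Q.vT : E d → ℝ)) Q.vT atTop (closure Q.Ω)

/-- Consistency of the splitting, non-negativity and boundedness of the discrete reaction
coefficients, and continuous dependence of the discrete coefficients on the controls. The discrete
diffusion coefficients enter only through their values at internal nodes. -/
structure Consistent : Prop where
  memLp_bE : ∀ i p, MemLp (S.bE i p) ∞ (volume.restrict Q.Ω)
  memLp_bI : ∀ i p, MemLp (S.bI i p) ∞ (volume.restrict Q.Ω)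
  memLp_cE : ∀ i p, MemLp (S.cE i p) ∞ (volume.restrict Q.Ω)
  memLp_cI : ∀ i p, MemLp (S.cI i p) ∞ (volume.restrict Q.Ω)
  memLp_fD : ∀ i p, MemLp (S.fD i p) ∞ (volume.restrict Q.Ω)
  limit : Tendsto (fun i => ⨆ p : A × B,
    ((⨆ y ∈ S.internalNodes i, eLpNorm (fun x => Q.a p x - (S.aE i p y + S.aI i p y)) ∞
        (volume.restrict (Q.Ω ∩ tsupport (hat (S.mesh i) y)))) +
      eLpNorm (fun x => Q.b p x - (S.bE i p x + S.bI i p x)) ∞ (volume.restrict Q.Ω) +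
      eLpNorm (fun x => Q.c p x - (S.cE i p x + S.cI i p x)) ∞ (volume.restrict Q.Ω) +
      eLpNorm (fun x => Q.f p x - S.fD i p x) ∞ (volume.restrict Q.Ω))) atTop (𝓝 0)
  cE_nonneg : ∀ i p, ∀ᵐ x ∂(volume.restrict Q.Ω), 0 ≤ S.cE i p x
  cI_nonneg : ∀ i p, ∀ᵐ x ∂(volume.restrict Q.Ω), 0 ≤ S.cI i p x
  bound_c : ∃ γ : ℝ, ∀ i p, eLpNorm (S.cE i p) ∞ (volume.restrict Q.Ω) +
    eLpNorm (S.cI i p) ∞ (volume.restrict Q.Ω) ≤ ENNReal.ofReal γ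
  cont_aE : ∀ i, ∀ y ∈ S.internalNodes i, Continuous fun p => S.aE i p y
  cont_aI : ∀ i, ∀ y ∈ S.internalNodes i, Continuous fun p => S.aI i p y
  cont_bE : ∀ i p₀, Tendsto (fun p => eLpNorm (S.bE i p - S.bE i p₀) ∞ (volume.restrict Q.Ω))
    (𝓝 p₀) (𝓝 0)
  cont_bI : ∀ i p₀, Tendsto (fun p => eLpNorm (S.bI i p - S.bI i p₀) ∞ (volume.restrict Q.Ω))
    (𝓝 p₀) (𝓝 0)
  cont_cE : ∀ i p₀, Tendsto (fun p => eLpNorm (S.cE i p - S.cE i p₀) ∞ (volume.restrict Q.Ω))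
    (𝓝 p₀) (𝓝 0)
  cont_cI : ∀ i p₀, Tendsto (fun p => eLpNorm (S.cI i p - S.cI i p₀) ∞ (volume.restrict Q.Ω))
    (𝓝 p₀) (𝓝 0)
  cont_fD : ∀ i p₀, Tendsto (fun p => eLpNorm (S.fD i p - S.fD i p₀) ∞ (volume.restrict Q.Ω))
    (𝓝 p₀) (𝓝 0)

/-- Monotonicity: the rows of the matrix of the explicit operator at internal nodes have
non-positive off-diagonal entries, all entries of `h_i E - Id` are non-positive (at boundary nodes
the rows are those of `-Id`), and the implicit operator has the local monotonicity property. -/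
structure Monotone : Prop where
  off_diag : ∀ i p, ∀ y ∈ S.internalNodes i, ∀ z ∈ (S.mesh i).vertices, z ≠ y →
    S.opE i p (hat (S.mesh i) z) y ≤ 0
  diag : ∀ i p, ∀ y ∈ S.internalNodes i, S.h i * S.opE i p (hat (S.mesh i) y) y - 1 ≤ 0
  lmp : ∀ i p, ∀ u ∈ P1Space (S.mesh i), ∀ y ∈ S.internalNodes i, u y ≤ 0 → IsLocalMin u y →
    S.opI i p u y ≤ 0

/-- `v i k` is the numerical solution at level `i` and time `s_i^k`: it starts from `P i v_T` at the
final time, at earlier times it is a finite element function equal to `P i g` on the boundary, and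
it satisfies the discrete Isaacs equation at the internal nodes. -/
structure IsNumericalSolution (v : ℕ → ℕ → E d → ℝ) : Prop where
  mem : ∀ i, ∀ k ≤ S.N i, v i k ∈ P1Space (S.mesh i)
  final : ∀ i, EqOn (v i (S.N i)) (S.P i Q.vT : E d → ℝ) (closure Q.Ω)
  boundary : ∀ i, ∀ k < S.N i, EqOn (v i k) (S.P i Q.g : E d → ℝ) (frontier Q.Ω)
  scheme : ∀ i, ∀ k < S.N i, ∀ y ∈ S.internalNodes i,
    - ((v i (k + 1) y - v i k y) / S.h i) +
      ⨅ β : B, ⨆ α : A,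
        (S.opE i (α, β) (v i (k + 1)) y + S.opI i (α, β) (v i k) y - S.opF i (α, β) y) = 0

/-- `ζ ∈ W^{1,∞}([0,T] × closure Ω)` (Lipschitz representative), with `P i ζ → ζ` uniformly. -/
def AdmissibleBarrier (ζ : ℝ × E d → ℝ) : Prop :=
  (∃ K : ℝ≥0, LipschitzOnWith K ζ Q.cyl) ∧
  TendstoUniformlyOn (fun i (z : ℝ × E d) => (S.P i (fun x => ζ (z.1, x)) : E d → ℝ) z.2) ζ atTop
    Q.cyl

/-- Existence of upper barriers at the points of `ω`. The last two conjuncts say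
`q_{t,y,ε} → y` and `liminf (ζ_{y,ε}(t,y) - ζ_{y,ε}(t,q_{t,y,ε})) ≥ 0` as `ε → 0`. -/
def UpperBarriers (ω : Set (E d)) (v : ℕ → ℕ → E d → ℝ) : Prop :=
  ∀ y ∈ ω, ∃ ζ : ℝ → ℝ × E d → ℝ,
    (∀ ε > 0, S.AdmissibleBarrier (ζ ε) ∧
      ∃ i₀, ∀ i ≥ i₀, ∀ k ≤ S.N i, ∃ z ∈ frontier Q.Ω,
        IsMinOn (fun x => v i k x - (S.P i (fun x' => ζ ε (S.time i k, x')) : E d → ℝ) x)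
          (closure Q.Ω) z) ∧
    ∀ t ∈ Icc 0 Q.T, ∃ q : ℝ → E d,
      (∀ ε > 0, q ε ∈ frontier Q.Ω ∧
        IsMinOn (fun x => Q.g x - ζ ε (t, x)) (frontier Q.Ω) (q ε)) ∧
      Tendsto q (𝓝[>] 0) (𝓝 y) ∧
      ∀ η > 0, ∀ᶠ ε in 𝓝[>] (0 : ℝ), - η ≤ ζ ε (t, y) - ζ ε (t, q ε)

/-- Existence of lower barriers at the points of `ω`. The last two conjuncts say
`r_{t,y,ε} → y` and `limsup (ξ_{y,ε}(t,y) - ξ_{y,ε}(t,r_{t,y,ε})) ≤ 0` as `ε → 0`. -/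
def LowerBarriers (ω : Set (E d)) (v : ℕ → ℕ → E d → ℝ) : Prop :=
  ∀ y ∈ ω, ∃ ξ : ℝ → ℝ × E d → ℝ,
    (∀ ε > 0, S.AdmissibleBarrier (ξ ε) ∧
      ∃ i₀, ∀ i ≥ i₀, ∀ k ≤ S.N i, ∃ z ∈ frontier Q.Ω,
        IsMaxOn (fun x => v i k x - (S.P i (fun x' => ξ ε (S.time i k, x')) : E d → ℝ) x)
          (closure Q.Ω) z) ∧
    ∀ t ∈ Icc 0 Q.T, ∃ r : ℝ → E d,
      (∀ ε > 0, r ε ∈ frontier Q.Ω ∧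
        IsMaxOn (fun x => Q.g x - ξ ε (t, x)) (frontier Q.Ω) (r ε)) ∧
      Tendsto r (𝓝[>] 0) (𝓝 y) ∧
      ∀ η > 0, ∀ᶠ ε in 𝓝[>] (0 : ℝ), ξ ε (t, y) - ξ ε (t, r ε) ≤ η

/-- The filter of triples (level `i`, time index `k`, node `y`) with `i → ∞` and
`(s_i^k, y) → z`. -/
def nodeFilter (z : ℝ × E d) : Filter (ℕ × ℕ × E d) :=
  comap (fun q => q.1) atTop ⊓ comap (fun q => (S.time q.1 q.2.1, q.2.2)) (𝓝 z) ⊓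
    𝓟 {q | q.2.1 ≤ S.N q.1 ∧ q.2.2 ∈ (S.mesh q.1).vertices}

/-- The upper envelope of the numerical solutions (as an extended real number). -/
def upperEnvelope (v : ℕ → ℕ → E d → ℝ) (z : ℝ × E d) : EReal :=
  limsup (fun q : ℕ × ℕ × E d => (v q.1 q.2.1 q.2.2 : EReal)) (S.nodeFilter z)

/-- The lower envelope of the numerical solutions (as an extended real number). -/
def lowerEnvelope (v : ℕ → ℕ → E d → ℝ) (z : ℝ × E d) : EReal :=
  liminf (fun q : ℕ × ℕ × E d => (v q.1 q.2.1 q.2.2 : EReal)) (S.nodeFilter z)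

/-- `V i` extends the numerical solution `v i` from the time steps to `[0,T]`: for
`t ∈ [s_i^k, s_i^{k+1}]` its value lies between those of `v i k` and `v i (k+1)`. Examples are the
piecewise linear and the piecewise constant extensions in time. -/
def IsTimeExtension (v : ℕ → ℕ → E d → ℝ) (V : ℕ → ℝ × E d → ℝ) : Prop :=
  ∀ i, ∀ k < S.N i, ∀ t ∈ Icc (S.time i k) (S.time i (k + 1)), ∀ x ∈ closure Q.Ω,
    V i (t, x) ∈ uIcc (v i k x) (v i (k + 1) x)

end Discretisation

end Isaacs

end

namespace Isaacs

/-! ### Barycentric coordinates and piecewise linear functions -/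

section Mesh

variable {d : ℕ} {M : Geometry.SimplicialComplex ℝ (E d)}

/-! The argument is the method of half-relaxed limits: a monotone, stable and consistent scheme
converges once comparison holds for the limit problem. The upper limit `U` and the lower limit `L`
of the nodal values satisfy `L ≤ U` by construction. They are shown to be a subsolution and a
supersolution, strongly on `ω`, so comparison gives `U ≤ L`. The common function is the solution,
comparison also yields uniqueness, and equality of the two limits gives uniform convergence on the
compact cylinder (`tendstoUniformlyOn_of_limits`).

Monotonicity (`scheme_le_of_touching`, `le_scheme_of_touching`): if a discrete function lies above
the numerical solution at time step `k + 1` and touches it at step `k` in an internal node, then it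
satisfies the discrete inequality there. The explicit part contributes through the sign and size of
its matrix entries, the implicit part through its local monotonicity.

Consistency (`consistency`): interpolants would not suffice on general meshes, but for an elliptic
projection, orthogonality and one integration by parts against the hat function turn `⟨∇ P w, ∇ φ̂⟩`
into an average of `-Δ w` near the node. Isotropy matters here, because the diffusion coefficient is
a scalar factor outside this product. Since the projection acts only in space and converges for
fixed smooth functions, `exists_separable_majorant` first replaces a `C²` test function by a smooth
function of `x` plus a function of `t`, up to a small change of the Laplacian. The time part then
enters the scheme merely as additive constants.

Viscosity inequalities (`IsUpperLimit.lscEnv_F_nonpos` and its counterpart): maximisers of the nodal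
values minus the projected test function approach the contact point. At a lateral boundary point
either the limit equals `g` there, and the envelope inequality is trivial, or the approximating
nodes are eventually internal and the scheme can be used.

Final time and stability: the projection of a smooth approximation of `v_T`, shifted by `± (2ε + K
(T - t))`, is a discrete super- or subsolution (`exists_upper_bound`, `exists_lower_bound`). This
bounds the scheme and identifies both limits at `t = T`. On `ω` the barriers do the same job
(`eventually_le_of_barrier`). Lower limits are handled throughout as negatives of upper limits of
`-v`. -/

theorem affineMap_sum_smul {s : Finset (E d)} {w : E d → ℝ} (hw : ∑ z ∈ s, w z = 1)
    (L : E d →ᵃ[ℝ] ℝ) : L (∑ z ∈ s, w z • z) = ∑ z ∈ s, w z * L z := by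
  have h : ∀ x, L x = L.linear x + L 0 := fun x => congrFun L.decomp x
  calc L (∑ z ∈ s, w z • z) = ∑ z ∈ s, w z * L.linear z + (∑ z ∈ s, w z) * L 0 := by
        rw [h, map_sum, hw, one_mul]
        simp_rw [map_smul, smul_eq_mul]
    _ = ∑ z ∈ s, w z * L z := by
        rw [Finset.sum_mul, ← Finset.sum_add_distrib]
        exact Finset.sum_congr rfl fun z _ => by rw [h z, mul_add]

/-- An affinely independent set extends to an affine basis of the whole space, and a barycentric
coordinate of that basis is a globally defined affine function. -/
theorem exists_affineMap_indicator {s : Finset (E d)}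
    (hs : AffineIndependent ℝ ((↑) : s → E d)) (y : E d) :
    ∃ L : E d →ᵃ[ℝ] ℝ, ∀ z ∈ s, L z = if z = y then 1 else 0 := by
  classical
  by_cases hy : y ∈ s
  · obtain ⟨t, hst, hti, htop⟩ :=
      exists_subset_affineIndependent_affineSpan_eq_top (k := ℝ) (s := (s : Set (E d))) hs
    let b : AffineBasis t ℝ (E d) := ⟨((↑) : t → E d), hti, by simpa using htop⟩
    refine ⟨b.coord ⟨y, hst hy⟩, fun z hz => ?_⟩
    have := b.coord_apply ⟨y, hst hy⟩ ⟨z, hst hz⟩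
    change b.coord ⟨y, hst hy⟩ (b ⟨z, hst hz⟩) = _
    rw [this]
    simp [Subtype.ext_iff, eq_comm]
  · refine ⟨0, fun z hz => ?_⟩
    rw [if_neg]
    · rfl
    · rintro rfl
      exact hy hz

/-- `w` is the family of barycentric coordinates of `x` in the simplex `s`. -/
def IsBary (s : Finset (E d)) (w : E d → ℝ) (x : E d) : Prop :=
  (∀ z ∈ s, 0 ≤ w z) ∧ (∀ z ∉ s, w z = 0) ∧ ∑ z ∈ s, w z = 1 ∧ ∑ z ∈ s, w z • z = x

theorem exists_isBary {s : Finset (E d)} {x : E d} (hx : x ∈ convexHull ℝ (s : Set (E d))) :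
    ∃ w, IsBary s w x := by
  classical
  obtain ⟨w, h0, h1, h2⟩ := Finset.mem_convexHull'.1 hx
  refine ⟨fun z => if z ∈ s then w z else 0, fun z hz => by simpa [hz] using h0 z hz,
    fun z hz => by simp [hz], ?_, ?_⟩
  · rw [← h1]
    exact Finset.sum_congr rfl fun z hz => by simp [hz]
  · rw [← h2]
    exact Finset.sum_congr rfl fun z hz => by simp [hz]

theorem IsBary.mem {s : Finset (E d)} {x : E d} {w : E d → ℝ} (h : IsBary s w x) :
    x ∈ convexHull ℝ (s : Set (E d)) :=
  Finset.mem_convexHull'.2 ⟨w, h.1, h.2.2.1, h.2.2.2⟩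

theorem IsBary.nonneg {s : Finset (E d)} {x : E d} {w : E d → ℝ} (h : IsBary s w x) (z : E d) :
    0 ≤ w z := by
  by_cases hz : z ∈ s
  · exact h.1 z hz
  · exact (h.2.1 z hz).ge

theorem IsBary.mono {s t : Finset (E d)} {x : E d} {w : E d → ℝ} (h : IsBary s w x) (hst : s ⊆ t) :
    IsBary t w x := by
  refine ⟨fun z _ => h.nonneg z, fun z hz => h.2.1 z fun h' => hz (hst h'), ?_, ?_⟩
  · rw [← h.2.2.1]
    exact (Finset.sum_subset hst fun z _ hz => h.2.1 z hz).symm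
  · rw [← h.2.2.2]
    exact (Finset.sum_subset hst fun z _ hz => by rw [h.2.1 z hz, zero_smul]).symm

theorem IsBary.affine {s : Finset (E d)} {x : E d} {w : E d → ℝ} (h : IsBary s w x)
    (L : E d →ᵃ[ℝ] ℝ) : L x = ∑ z ∈ s, w z * L z := by
  rw [← h.2.2.2, affineMap_sum_smul h.2.2.1]

/-- The affine function that is one at a vertex and zero at the others reads off the weight of that
vertex from the point alone. -/
theorem IsBary.unique_of_indep {s : Finset (E d)} (hs : AffineIndependent ℝ ((↑) : s → E d))
    {x : E d} {w w' : E d → ℝ} (h : IsBary s w x) (h' : IsBary s w' x) : w = w' := by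
  classical
  funext y
  by_cases hy : y ∈ s
  · obtain ⟨L, hL⟩ := exists_affineMap_indicator hs y
    have key : ∀ {w}, IsBary s w x → L x = w y := fun {w} h => by
      rw [h.affine, Finset.sum_eq_single y]
      · simp [hL y hy]
      · intro z hz hzy
        simp [hL z hz, hzy]
      · exact fun h' => absurd hy h'
    rw [← key h, ← key h']
  · rw [h.2.1 y hy, h'.2.1 y hy]

/-- Two faces meet in the hull of their common vertices. Coordinates with respect to these, extended
by zero, are coordinates in both faces. This is what makes `hat` well defined. -/
theorem IsBary.unique {s t : Finset (E d)} (hs : s ∈ M.faces) (ht : t ∈ M.faces)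
    {x : E d} {w w' : E d → ℝ} (h : IsBary s w x) (h' : IsBary t w' x) : w = w' := by
  classical
  have hx := M.inter_subset_convexHull hs ht ⟨h.mem, h'.mem⟩
  rw [← Finset.coe_inter] at hx
  obtain ⟨v, hv⟩ := exists_isBary hx
  rw [h.unique_of_indep (M.indep hs) (hv.mono Finset.inter_subset_left),
    h'.unique_of_indep (M.indep ht) (hv.mono Finset.inter_subset_right)]

theorem hat_eq {s : Finset (E d)} (hs : s ∈ M.faces) {x : E d} {w : E d → ℝ} (h : IsBary s w x)
    (y : E d) : hat M y x = w y := by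
  have : {c : ℝ | ∃ s ∈ M.faces, ∃ w : E d → ℝ, (∀ z ∈ s, 0 ≤ w z) ∧ (∀ z ∉ s, w z = 0) ∧
    ∑ z ∈ s, w z = 1 ∧ ∑ z ∈ s, w z • z = x ∧ c = w y} = {w y} := by
    ext c
    constructor
    · rintro ⟨t, ht, w', h1, h2, h3, h4, rfl⟩
      have h' : IsBary t w' x := ⟨h1, h2, h3, h4⟩
      rw [mem_singleton_iff, h.unique hs ht h']
    · rintro rfl
      exact ⟨s, hs, w, h.1, h.2.1, h.2.2.1, h.2.2.2, rfl⟩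
  rw [hat, this, csSup_singleton]

theorem isBary_hat {s : Finset (E d)} (hs : s ∈ M.faces) {x : E d}
    (hx : x ∈ convexHull ℝ (s : Set (E d))) : IsBary s (fun z => hat M z x) x := by
  obtain ⟨w, hw⟩ := exists_isBary hx
  have : (fun z => hat M z x) = w := funext fun z => hat_eq hs hw z
  rwa [this]

theorem hat_eq_zero_of_notMem {x : E d} (hx : x ∉ M.space) (y : E d) : hat M y x = 0 := by
  have : {c : ℝ | ∃ s ∈ M.faces, ∃ w : E d → ℝ, (∀ z ∈ s, 0 ≤ w z) ∧ (∀ z ∉ s, w z = 0) ∧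
    ∑ z ∈ s, w z = 1 ∧ ∑ z ∈ s, w z • z = x ∧ c = w y} = ∅ := by
    refine eq_empty_of_forall_notMem ?_
    rintro c ⟨t, ht, w', h1, h2, h3, h4, rfl⟩
    have h' : IsBary t w' x := ⟨h1, h2, h3, h4⟩
    exact hx (Geometry.SimplicialComplex.mem_space_iff.2 ⟨t, ht, h'.mem⟩)
  rw [hat, this, Real.sSup_empty]

theorem hat_nonneg (y x : E d) : 0 ≤ hat M y x := by
  by_cases hx : x ∈ M.space
  · obtain ⟨s, hs, hxs⟩ := Geometry.SimplicialComplex.mem_space_iff.1 hx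
    exact (isBary_hat hs hxs).nonneg y
  · rw [hat_eq_zero_of_notMem hx]

theorem hat_self {y : E d} (hy : y ∈ M.vertices) : hat M y y = 1 := by
  -- By definition a vertex is a point whose singleton is a face, and on this face the weights sum
  -- to the single weight at `y`.
  have := (isBary_hat (M := M) (s := {y}) hy (x := y) (by simp)).2.2.1
  simpa using this

theorem hat_mem_P1Space (y : E d) : hat M y ∈ P1Space M := by
  classical
  intro s hs
  obtain ⟨L, hL⟩ := exists_affineMap_indicator (M.indep hs) y
  refine ⟨L, fun x hx => ?_⟩
  have h := isBary_hat hs hx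
  rw [h.affine]
  by_cases hy : y ∈ s
  · rw [Finset.sum_eq_single y]
    · simp [hL y hy]
    · intro z hz hzy
      simp [hL z hz, hzy]
    · exact fun h' => absurd hy h'
  · have h1 : hat M y x = 0 := h.2.1 y hy
    rw [h1]
    symm
    refine Finset.sum_eq_zero fun z hz => ?_
    have : z ≠ y := by
      rintro rfl
      exact hy hz
    simp [hL z hz, this]

theorem finite_vertices (hM : M.faces.Finite) : M.vertices.Finite := by
  rw [Geometry.SimplicialComplex.vertices_eq]
  exact hM.biUnion fun s _ => s.finite_toSet

theorem mem_vertices_of_mem {s : Finset (E d)} (hs : s ∈ M.faces) {z : E d} (hz : z ∈ s) :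
    z ∈ M.vertices := by
  rw [Geometry.SimplicialComplex.vertices_eq]
  exact mem_biUnion hs hz

/-- On a simplex, a piecewise linear function is determined by its values at the vertices. -/
theorem P1Space.eq_sum_of_mem {u : E d → ℝ} (hu : u ∈ P1Space M) {s : Finset (E d)}
    (hs : s ∈ M.faces) {x : E d} (hx : x ∈ convexHull ℝ (s : Set (E d))) :
    u x = ∑ z ∈ s, hat M z x * u z := by
  obtain ⟨L, hL⟩ := hu s hs
  rw [hL hx, (isBary_hat hs hx).affine]
  exact Finset.sum_congr rfl fun z hz => by rw [hL (subset_convexHull ℝ _ hz)]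

theorem P1Space.eq_sum {u : E d → ℝ} (hu : u ∈ P1Space M) (hV : M.vertices.Finite)
    {x : E d} (hx : x ∈ M.space) : u x = ∑ z ∈ hV.toFinset, u z * hat M z x := by
  obtain ⟨s, hs, hxs⟩ := Geometry.SimplicialComplex.mem_space_iff.1 hx
  rw [P1Space.eq_sum_of_mem hu hs hxs]
  rw [Finset.sum_subset (s₂ := hV.toFinset)]
  · exact Finset.sum_congr rfl fun z _ => mul_comm _ _
  · exact fun z hz => hV.mem_toFinset.2 (mem_vertices_of_mem hs hz)
  · intro z _ hz
    have h1 : hat M z x = 0 := (isBary_hat hs hxs).2.1 z hz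
    rw [h1, zero_mul]

/-- Lower bounds at the vertices of a simplex hold on the simplex. -/
theorem P1Space.le_of_forall_mem {u : E d → ℝ} (hu : u ∈ P1Space M) {s : Finset (E d)}
    (hs : s ∈ M.faces) {c : ℝ} (hc : ∀ z ∈ s, c ≤ u z) {x : E d}
    (hx : x ∈ convexHull ℝ (s : Set (E d))) : c ≤ u x := by
  have h := isBary_hat hs hx
  have h1 : ∑ z ∈ s, hat M z x = 1 := h.2.2.1
  rw [P1Space.eq_sum_of_mem hu hs hx]
  calc c = ∑ z ∈ s, hat M z x * c := by rw [← Finset.sum_mul, h1, one_mul]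
    _ ≤ _ := Finset.sum_le_sum fun z hz => mul_le_mul_of_nonneg_left (hc z hz) (hat_nonneg z x)

theorem P1Space.le_of_forall_vertices {u : E d → ℝ} (hu : u ∈ P1Space M) {c : ℝ}
    (hc : ∀ z ∈ M.vertices, c ≤ u z) {x : E d} (hx : x ∈ M.space) : c ≤ u x := by
  obtain ⟨s, hs, hxs⟩ := Geometry.SimplicialComplex.mem_space_iff.1 hx
  exact P1Space.le_of_forall_mem hu hs (fun z hz => hc z (mem_vertices_of_mem hs hz)) hxs

theorem const_mem_P1Space (c : ℝ) : (fun _ => c) ∈ P1Space M :=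
  fun _ _ => ⟨AffineMap.const ℝ _ c, fun _ _ => rfl⟩

theorem isClosed_simplex (s : Finset (E d)) : IsClosed (convexHull ℝ (s : Set (E d))) :=
  (Set.Finite.isCompact_convexHull ℝ s.finite_toSet).isClosed

theorem le_meshSize (hM : M.faces.Finite) {s : Finset (E d)} (hs : s ∈ M.faces) {x y : E d}
    (hx : x ∈ convexHull ℝ (s : Set (E d))) (hy : y ∈ convexHull ℝ (s : Set (E d))) :
    dist x y ≤ meshSize M := by
  have := hM.to_subtype
  refine (Metric.dist_le_diam_of_mem
    (Set.Finite.isCompact_convexHull ℝ s.finite_toSet).isBounded hx hy).trans ?_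
  -- Finiteness of the mesh is essential: an unbounded real supremum would default to zero.
  exact le_ciSup (f := fun s : M.faces => Metric.diam (convexHull ℝ ((s : Finset (E d)) :
    Set (E d)))) (Set.finite_range _).bddAbove ⟨s, hs⟩

theorem dist_le_meshSize_of_hat_ne_zero (hM : M.faces.Finite) {x y : E d} (h : hat M y x ≠ 0) :
    dist x y ≤ meshSize M := by
  have hx : x ∈ M.space := by
    by_contra hx
    exact h (hat_eq_zero_of_notMem hx y)
  obtain ⟨s, hs, hxs⟩ := Geometry.SimplicialComplex.mem_space_iff.1 hx
  have hy : y ∈ s := by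
    by_contra hy
    exact h ((isBary_hat hs hxs).2.1 y hy)
  exact le_meshSize hM hs hxs (subset_convexHull ℝ _ hy)

theorem P1Space.continuousOn {u : E d → ℝ} (hu : u ∈ P1Space M) (hM : M.faces.Finite) :
    ContinuousOn u M.space := by
  unfold Geometry.SimplicialComplex.space
  have := hM.to_subtype
  rw [biUnion_eq_iUnion]
  refine LocallyFinite.continuousOn_iUnion (locallyFinite_of_finite _)
    (fun s => isClosed_simplex _) fun s => ?_
  obtain ⟨L, hL⟩ := hu s s.2
  exact (AffineMap.continuous_of_finiteDimensional L).continuousOn.congr hL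

/-- A bound for the slopes of a piecewise linear function on the simplices. -/
theorem P1Space.exists_slope_bound {u : E d → ℝ} (hu : u ∈ P1Space M) (hM : M.faces.Finite) :
    ∃ K : ℝ≥0, ∀ s ∈ M.faces, ∃ L : E d →ᵃ[ℝ] ℝ, EqOn u L (convexHull ℝ (s : Set (E d))) ∧
      ∀ x y, |L x - L y| ≤ K * dist x y := by
  have h1 : ∀ s ∈ M.faces, ∃ K : ℝ≥0, ∃ L : E d →ᵃ[ℝ] ℝ,
      EqOn u L (convexHull ℝ (s : Set (E d))) ∧ ∀ x y, |L x - L y| ≤ K * dist x y := by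
    intro s hs
    obtain ⟨L, hL⟩ := hu s hs
    refine ⟨‖LinearMap.toContinuousLinearMap L.linear‖₊, L, hL, fun x y => ?_⟩
    have : L x - L y = LinearMap.toContinuousLinearMap L.linear (x - y) := by
      simpa using (L.linearMap_vsub x y).symm
    rw [this, dist_eq_norm]
    exact (LinearMap.toContinuousLinearMap L.linear).le_opNorm (x - y)
  choose! K hK using h1
  refine ⟨∑ s ∈ hM.toFinset, K s, fun s hs => ?_⟩
  obtain ⟨L, hL, hl⟩ := hK s hs
  refine ⟨L, hL, fun x y => (hl x y).trans ?_⟩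
  gcongr
  exact_mod_cast Finset.single_le_sum (f := K) (fun _ _ => zero_le) (hM.mem_toFinset.2 hs)

end Mesh

/-- A function which is Lipschitz on each of finitely many closed sets covering the space, and
continuous, is Lipschitz. -/
theorem lipschitzWith_of_finite_closed_cover {F : Type*} [NormedAddCommGroup F] [NormedSpace ℝ F]
    {f : F → ℝ} {K : ℝ≥0} {ι : Type*} [Finite ι] {C : ι → Set F} (hC : ∀ i, IsClosed (C i))
    (hcov : ∀ x, ∃ i, x ∈ C i) (hf : ∀ i, LipschitzOnWith K f (C i)) : LipschitzWith K f := by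
  have hcont : Continuous f := by
    rw [← continuousOn_univ, ← iUnion_eq_univ_iff.2 hcov]
    exact LocallyFinite.continuousOn_iUnion (locallyFinite_of_finite _) hC
      fun i => (hf i).continuousOn
  have key : ∀ x y, f y - f x ≤ K * dist y x := by
    intro x y
    set c : ℝ → F := fun t => x + t • (y - x) with hc
    have hcc : Continuous c := by fun_prop
    have hdist : ∀ s t, dist (c s) (c t) = |s - t| * dist y x := by
      intro s t
      rw [dist_eq_norm, dist_eq_norm, hc]
      rw [add_sub_add_left_eq_sub, ← sub_smul, norm_smul, Real.norm_eq_abs]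
    -- A mean value inequality along the segment in which the right slopes need to be small only
    -- frequently, not eventually.
    have := image_le_of_liminf_slope_right_le_deriv_boundary (f := fun t => f (c t)) (a := 0)
      (b := 1) (hcont.comp hcc).continuousOn (B := fun t => f x + t * (K * dist y x))
      (B' := fun _ => K * dist y x) (by simp [hc]) (by fun_prop)
      (fun t _ => by
        simpa using (((hasDerivAt_id t).mul_const (K * dist y x)).const_add (f x)).hasDerivWithinAt)
      ?_ (right_mem_Icc.2 zero_le_one)
    · simp [hc] at this
      linarith
    · intro t _ r hr
      have h1 : ∃ᶠ z in 𝓝[>] t, ∃ i, c z ∈ C i := (Eventually.of_forall fun z => hcov _).frequently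
      -- With finitely many sets, one of them is visited arbitrarily close to `t`. It is closed, so
      -- it contains the base point too, and its Lipschitz bound controls those slopes.
      have h2 : ∃ i, ∃ᶠ z in 𝓝[>] t, c z ∈ C i := by
        by_contra! h
        exact h1 (by
          filter_upwards [eventually_all.2 h] with z hz
          simpa using hz)
      obtain ⟨i, hi⟩ := h2
      have ht : c t ∈ C i := by
        refine (hC i).mem_of_frequently_of_tendsto hi ?_
        exact (hcc.tendsto t).mono_left nhdsWithin_le_nhds
      refine (hi.and_eventually self_mem_nhdsWithin).mono fun z ⟨hz, hzt⟩ => lt_of_le_of_lt ?_ hr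
      have hzt' : 0 < z - t := sub_pos.2 hzt
      rw [slope_def_field, div_le_iff₀ hzt']
      have h3 := (hf i).dist_le_mul _ hz _ ht
      rw [hdist, abs_of_pos hzt', Real.dist_eq] at h3
      have := le_abs_self (f (c z) - f (c t))
      linarith
  refine LipschitzWith.of_dist_le_mul fun x y => ?_
  rw [Real.dist_eq, abs_le]
  have h1 := key x y
  have h2 := key y x
  rw [dist_comm] at h1
  constructor <;> linarith

/-! ### Hat functions at internal nodes -/

section Domain

variable {d : ℕ} {M : Geometry.SimplicialComplex ℝ (E d)} {Ω : Set (E d)}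

/-- A Lipschitz domain lies on one side of its boundary. The points strictly below the graph form an
open set missing `Ω`, hence missing its closure, and moving from a boundary point against the
vertical direction enters this set at once. -/
theorem HasLipschitzBoundary.interior_closure_subset (h : HasLipschitzBoundary Ω) :
    interior (closure Ω) ⊆ Ω := by
  intro x hx
  by_contra hxΩ
  have hfr : x ∈ frontier Ω :=
    ⟨interior_subset hx, fun h' => hxΩ (interior_subset h')⟩
  obtain ⟨e, r, K, γ, he, hr, hγ, hiff⟩ := h x hfr
  have hee : inner ℝ e e = (1 : ℝ) := by rw [real_inner_self_eq_norm_sq, he]; norm_num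
  have hx0 : inner ℝ x e ≤ γ (x - inner ℝ x e • e) := by
    by_contra hlt
    exact hxΩ ((hiff x (Metric.mem_ball_self hr)).2 (not_le.1 hlt))
  set U : Set (E d) := Metric.ball x r ∩ {z | inner ℝ z e < γ (z - inner ℝ z e • e)} with hU
  have hUo : IsOpen U := by
    refine Metric.isOpen_ball.inter (isOpen_lt (by fun_prop) ?_)
    exact hγ.continuous.comp (by fun_prop)
  have hUd : Disjoint U Ω := by
    rw [Set.disjoint_left]
    rintro z ⟨hz1, hz2⟩ hz3
    exact lt_asymm hz2 ((hiff z hz1).1 hz3)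
  have hUc : Disjoint U (closure Ω) := hUd.closure_right hUo
  have hc : Tendsto (fun t : ℝ => x - t • e) (𝓝[>] 0) (𝓝 x) := by
    have : Continuous (fun t : ℝ => x - t • e) := by fun_prop
    simpa using (this.tendsto 0).mono_left nhdsWithin_le_nhds
  have h1 : ∀ᶠ t : ℝ in 𝓝[>] 0, x - t • e ∈ interior (closure Ω) :=
    hc.eventually (isOpen_interior.mem_nhds hx)
  have h2 : ∀ᶠ t : ℝ in 𝓝[>] 0, x - t • e ∈ Metric.ball x r :=
    hc.eventually (Metric.ball_mem_nhds x hr)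
  obtain ⟨t, ht1, ht2, ht0⟩ := (h1.and (h2.and self_mem_nhdsWithin)).exists
  refine Set.disjoint_left.1 hUc ⟨ht2, ?_⟩ (interior_subset ht1)
  have h3 : inner ℝ (x - t • e) e = inner ℝ x e - t := by
    rw [inner_sub_left, real_inner_smul_left, hee, mul_one]
  have ht0' : (0 : ℝ) < t := ht0
  change inner ℝ (x - t • e) e < γ ((x - t • e) - inner ℝ (x - t • e) e • e)
  have h4 : (x - t • e) - inner ℝ (x - t • e) e • e = x - inner ℝ x e • e := by
    rw [h3, sub_smul]
    abel
  rw [h4, h3]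
  linarith

/-- The open star of an interior vertex lies in the interior of the mesh. -/
theorem mem_interior_space_of_hat_pos (hM : M.faces.Finite) {y : E d}
    (hy : y ∈ interior M.space) {x : E d} (hx : 0 < hat M y x) : x ∈ interior M.space := by
  classical
  have hxs : x ∈ M.space := by
    by_contra h
    exact hx.ne' (hat_eq_zero_of_notMem h y)
  obtain ⟨s₀, hs₀, hxs₀⟩ := Geometry.SimplicialComplex.mem_space_iff.1 hxs
  have hb₀ := isBary_hat hs₀ hxs₀
  -- The carrier of `x`, the face whose vertices all have positive weight at `x`. It contains `y`.
  set s := s₀.filter fun z => 0 < hat M z x with hsdef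
  have hys : y ∈ s := by
    refine Finset.mem_filter.2 ⟨?_, hx⟩
    by_contra h
    exact hx.ne' (hb₀.2.1 y h)
  have hs : s ∈ M.faces := M.down_closed hs₀ (Finset.filter_subset _ _) ⟨y, hys⟩
  have hzero : ∀ z ∉ s, hat M z x = 0 := by
    intro z hz
    by_cases hz' : z ∈ s₀
    · by_contra hne
      exact hz (Finset.mem_filter.2 ⟨hz', lt_of_le_of_ne (hat_nonneg z x) (Ne.symm hne)⟩)
    · exact hb₀.2.1 z hz'
  have hb : IsBary s (fun z => hat M z x) x := by
    refine ⟨fun z _ => hat_nonneg z x, hzero, ?_, ?_⟩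
    · rw [← hb₀.2.2.1]
      exact Finset.sum_subset (Finset.filter_subset _ _) fun z _ hz => hzero z hz
    · conv_rhs => rw [← hb₀.2.2.2]
      exact Finset.sum_subset (Finset.filter_subset _ _) fun z _ hz => by
        simp [hzero z hz]
  have hpos : ∀ z ∈ s, 0 < hat M z x := fun z hz => (Finset.mem_filter.1 hz).2
  have hc : Tendsto (fun t : ℝ => y + t • (x - y)) (𝓝[>] 0) (𝓝 y) := by
    have : Continuous (fun t : ℝ => y + t • (x - y)) := by fun_prop
    simpa using (this.tendsto 0).mono_left nhdsWithin_le_nhds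
  have h1 : ∀ᶠ t : ℝ in 𝓝[>] 0, t ∈ Ioo (0 : ℝ) 1 := Ioo_mem_nhdsGT one_pos
  obtain ⟨t, ht1, ht2⟩ := ((hc.eventually (isOpen_interior.mem_nhds hy)).and h1).exists
  -- A point slightly off `y` towards `x` is still interior to the mesh, and all its weights in the
  -- carrier are positive.
  set q := y + t • (x - y) with hq
  have hyc : y ∈ convexHull ℝ (s : Set (E d)) := subset_convexHull ℝ _ hys
  have hqc : q ∈ convexHull ℝ (s : Set (E d)) :=
    (convex_convexHull ℝ _).add_smul_sub_mem hyc hb.mem ⟨ht2.1.le, ht2.2.le⟩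
  have hbq := isBary_hat hs hqc
  have hqpos : ∀ z ∈ s, 0 < hat M z q := by
    intro z hz
    obtain ⟨L, hL⟩ := hat_mem_P1Space (M := M) z s hs
    have h2 : hat M z q = (1 - t) * hat M z y + t * hat M z x := by
      rw [hL hqc, hL hyc, hL hb.mem, hq]
      have : y + t • (x - y) = AffineMap.lineMap y x t := by
        simp [AffineMap.lineMap_apply, add_comm]
      rw [this, AffineMap.apply_lineMap]
      simp [AffineMap.lineMap_apply]
      ring
    rw [h2]
    have h3 := hat_nonneg (M := M) z y
    have h4 := hpos z hz
    have h5 := ht2.1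
    have h6 := ht2.2
    have : 0 ≤ (1 - t) * hat M z y := mul_nonneg (by linarith) h3
    have : 0 < t * hat M z x := mul_pos h5 h4
    linarith
  have hev : ∀ᶠ p in 𝓝 q, p ∈ M.space ∧ ∀ z ∈ s, 0 < hat M z p ∧
      0 < hat M z p + hat M z x - hat M z q := by
    refine Eventually.and (mem_interior_iff_mem_nhds.1 ht1) ?_
    refine (Finset.eventually_all s).2 fun z hz => ?_
    have hcz : ContinuousAt (hat M z) q :=
      (P1Space.continuousOn (hat_mem_P1Space z) hM).continuousAt (mem_interior_iff_mem_nhds.1 ht1)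
    refine (hcz.eventually (lt_mem_nhds (hqpos z hz))).and ?_
    have h7 := hcz.eventually (lt_mem_nhds (show hat M z q - hat M z x < hat M z q by
      linarith [hpos z hz]))
    filter_upwards [h7] with p hp
    linarith
  have htrans : Tendsto (fun x' : E d => x' + (q - x)) (𝓝 x) (𝓝 q) := by
    have : Continuous (fun x' : E d => x' + (q - x)) := by fun_prop
    simpa using this.tendsto x
  rw [mem_interior_iff_mem_nhds]
  -- A neighbourhood of `q` in the mesh is transported to `x` by translation. Any face containing
  -- the translate `p` of `x'` contains the carrier, and `p + x - q = x'` has in it the weights of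
  -- `p` plus those of `x` minus those of `q`, still non-negative for `p` near `q`.
  filter_upwards [htrans.eventually hev] with x' hx'
  obtain ⟨hp, hpz⟩ := hx'
  set p := x' + (q - x) with hpdef
  obtain ⟨s', hs', hps'⟩ := Geometry.SimplicialComplex.mem_space_iff.1 hp
  have hbp := isBary_hat hs' hps'
  have hss' : s ⊆ s' := by
    intro z hz
    by_contra h
    exact (hpz z hz).1.ne' (hbp.2.1 z h)
  have hbx' := hb.mono hss'
  have hbq' := hbq.mono hss'
  refine Geometry.SimplicialComplex.convexHull_subset_space hs' (IsBary.mem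
    (w := fun z => hat M z p + hat M z x - hat M z q) ⟨?_, ?_, ?_, ?_⟩)
  · intro z _
    by_cases hz : z ∈ s
    · exact (hpz z hz).2.le
    · have h8 : hat M z q = 0 := hbq.2.1 z hz
      have := hat_nonneg (M := M) z p
      have := hat_nonneg (M := M) z x
      linarith
  · intro z hz
    have h8 : hat M z q = 0 := hbq'.2.1 z hz
    have h9 : hat M z x = 0 := hbx'.2.1 z hz
    have h10 : hat M z p = 0 := hbp.2.1 z hz
    simp [h8, h9, h10]
  · rw [Finset.sum_sub_distrib, Finset.sum_add_distrib, hbp.2.2.1, hbx'.2.2.1, hbq'.2.2.1]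
    ring
  · simp_rw [sub_smul, add_smul]
    rw [Finset.sum_sub_distrib, Finset.sum_add_distrib, hbp.2.2.2, hbx'.2.2.2, hbq'.2.2.2, hpdef]
    abel

/-- `M` is a finite mesh of the closure of the bounded open set `Ω`, which is the interior of its
closure. -/
structure IsMeshOf (M : Geometry.SimplicialComplex ℝ (E d)) (Ω : Set (E d)) : Prop where
  finite : M.faces.Finite
  space_eq : M.space = closure Ω
  isOpen : IsOpen Ω
  isBounded : Bornology.IsBounded Ω
  interior_closure : interior (closure Ω) ⊆ Ω

variable (h : IsMeshOf M Ω)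
include h

theorem IsMeshOf.subset_space : Ω ⊆ M.space := by
  rw [h.space_eq]
  exact subset_closure

theorem IsMeshOf.isCompact_closure : IsCompact (closure Ω) := h.isBounded.isCompact_closure

/-- The open star of an internal node is interior to the closure of `Ω`, hence inside `Ω`. This
removes all boundary terms in the integrations by parts. -/
theorem IsMeshOf.hat_eq_zero {y : E d} (hy : y ∈ M.vertices ∩ Ω) {x : E d} (hx : x ∉ Ω) :
    hat M y x = 0 := by
  by_contra hne
  refine hx (h.interior_closure ?_)
  rw [← h.space_eq]
  refine mem_interior_space_of_hat_pos h.finite ?_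
    (lt_of_le_of_ne (hat_nonneg y x) (Ne.symm hne))
  exact (interior_maximal h.subset_space h.isOpen) hy.2

/-- The simplices together with the complement of `Ω`, on which the hat function vanishes, form a
finite closed cover of the whole space. -/
theorem IsMeshOf.exists_lipschitzWith_hat {y : E d} (hy : y ∈ M.vertices ∩ Ω) :
    ∃ K : ℝ≥0, LipschitzWith K (hat M y) := by
  obtain ⟨K, hK⟩ := P1Space.exists_slope_bound (hat_mem_P1Space (M := M) y) h.finite
  have := h.finite.to_subtype
  refine ⟨K, lipschitzWith_of_finite_closed_cover (ι := Option M.faces)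
    (C := fun o => o.elim Ωᶜ fun s => convexHull ℝ ((s : Finset (E d)) : Set (E d))) ?_ ?_ ?_⟩
  · rintro (_ | s)
    · exact h.isOpen.isClosed_compl
    · exact isClosed_simplex _
  · intro x
    by_cases hx : x ∈ Ω
    · obtain ⟨s, hs, hxs⟩ := Geometry.SimplicialComplex.mem_space_iff.1 (h.subset_space hx)
      exact ⟨some ⟨s, hs⟩, hxs⟩
    · exact ⟨none, hx⟩
  · rintro (_ | s)
    · refine LipschitzOnWith.of_dist_le_mul fun x hx x' hx' => ?_
      rw [h.hat_eq_zero hy hx, h.hat_eq_zero hy hx', dist_self]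
      positivity
    · obtain ⟨L, hL, hl⟩ := hK s s.2
      refine LipschitzOnWith.of_dist_le_mul fun x hx x' hx' => ?_
      rw [hL hx, hL hx', Real.dist_eq]
      exact hl x x'

theorem IsMeshOf.hasCompactSupport_hat {y : E d} (hy : y ∈ M.vertices ∩ Ω) :
    HasCompactSupport (hat M y) :=
  HasCompactSupport.intro h.isCompact_closure fun _ hx =>
    h.hat_eq_zero hy fun h' => hx (subset_closure h')

theorem IsMeshOf.continuous_hat {y : E d} (hy : y ∈ M.vertices ∩ Ω) : Continuous (hat M y) := by
  obtain ⟨K, hK⟩ := h.exists_lipschitzWith_hat hy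
  exact hK.continuous

theorem IsMeshOf.integrable_hat {y : E d} (hy : y ∈ M.vertices ∩ Ω) :
    Integrable (hat M y) volume :=
  (h.continuous_hat hy).integrable_of_hasCompactSupport (h.hasCompactSupport_hat hy)

theorem IsMeshOf.integral_hat_pos {y : E d} (hy : y ∈ M.vertices ∩ Ω) :
    0 < ∫ x in Ω, |hat M y x| := by
  have h1 : ∫ x in Ω, |hat M y x| = ∫ x, hat M y x := by
    simp_rw [abs_of_nonneg (hat_nonneg (M := M) y _)]
    exact setIntegral_eq_integral_of_forall_compl_eq_zero fun x hx => h.hat_eq_zero hy hx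
  rw [h1]
  refine (h.continuous_hat hy).integral_pos_of_hasCompactSupport_nonneg_nonzero
    (h.hasCompactSupport_hat hy) (hat_nonneg y) (x := y) ?_
  rw [hat_self hy.1]
  exact one_ne_zero

theorem IsMeshOf.hatN_nonneg {y : E d} (hy : y ∈ M.vertices ∩ Ω) (x : E d) : 0 ≤ hatN Ω M y x :=
  div_nonneg (hat_nonneg y x) (h.integral_hat_pos hy).le

theorem IsMeshOf.integrable_hatN {y : E d} (hy : y ∈ M.vertices ∩ Ω) :
    Integrable (hatN Ω M y) (volume.restrict Ω) :=
  (h.integrable_hat hy).integrableOn.div_const _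

theorem IsMeshOf.integral_hatN {y : E d} (hy : y ∈ M.vertices ∩ Ω) :
    ∫ x in Ω, hatN Ω M y x = 1 := by
  have hpos := h.integral_hat_pos hy
  unfold hatN
  rw [integral_div]
  simp_rw [abs_of_nonneg (hat_nonneg (M := M) y _)] at hpos ⊢
  exact div_self hpos.ne'

/-- Averages against the normalised hat function. -/
theorem IsMeshOf.abs_integral_mul_hatN_sub_le {y : E d} (hy : y ∈ M.vertices ∩ Ω) {G : E d → ℝ}
    {c ε : ℝ} (hG : AEStronglyMeasurable G (volume.restrict Ω))
    (hbd : ∀ᵐ x ∂(volume.restrict Ω), hat M y x ≠ 0 → |G x - c| ≤ ε) :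
    |(∫ x in Ω, G x * hatN Ω M y x) - c| ≤ ε := by
  have hint := h.integrable_hatN hy
  have hmul : ∀ᵐ x ∂(volume.restrict Ω), ‖(G x - c) * hatN Ω M y x‖ ≤ ε * hatN Ω M y x := by
    filter_upwards [hbd] with x hx
    rw [Real.norm_eq_abs, abs_mul, abs_of_nonneg (h.hatN_nonneg hy x)]
    by_cases h0 : hat M y x = 0
    · simp [hatN, h0]
    · exact mul_le_mul_of_nonneg_right (hx h0) (h.hatN_nonneg hy x)
  have hi : Integrable (fun x => (G x - c) * hatN Ω M y x) (volume.restrict Ω) :=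
    (hint.const_mul ε).mono' ((hG.sub aestronglyMeasurable_const).mul hint.aestronglyMeasurable)
      hmul
  have hsplit : ∫ x in Ω, G x * hatN Ω M y x = (∫ x in Ω, (G x - c) * hatN Ω M y x) + c := by
    have h1 : ∀ x, G x * hatN Ω M y x = (G x - c) * hatN Ω M y x + c * hatN Ω M y x :=
      fun x => by ring
    simp_rw [h1]
    rw [integral_add hi (hint.const_mul c), integral_const_mul, h.integral_hatN hy, mul_one]
  rw [hsplit, add_sub_cancel_right, ← Real.norm_eq_abs]
  refine (norm_integral_le_of_norm_le (hint.const_mul ε) hmul).trans ?_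
  rw [integral_const_mul, h.integral_hatN hy, mul_one]

/-- Outside `Ω` the function attains its minimum zero. Fermat's rule needs no differentiability,
because the derivative is zero by default where it does not exist. -/
theorem IsMeshOf.gradient_hatN_eq_zero {y : E d} (hy : y ∈ M.vertices ∩ Ω) {x : E d} (hx : x ∉ Ω) :
    ∇ (hatN Ω M y) x = 0 := by
  have : IsLocalMin (hatN Ω M y) x := by
    refine Eventually.of_forall fun x' => ?_
    have h0 : hatN Ω M y x = 0 := by simp [hatN, h.hat_eq_zero hy hx]
    rw [h0]
    exact h.hatN_nonneg hy x'
  rw [gradient, this.fderiv_eq_zero, map_zero]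

/-! ### Gradients of piecewise linear functions -/

omit h in
theorem norm_gradient (f : E d → ℝ) (x : E d) : ‖∇ f x‖ = ‖fderiv ℝ f x‖ := by
  rw [gradient, LinearIsometryEquiv.norm_map]

omit h in
theorem measurable_gradient (f : E d → ℝ) : Measurable (∇ f) :=
  (LinearIsometryEquiv.continuous _).measurable.comp (measurable_fderiv ℝ f)

/-- The bound holds at every point, also on the skeleton of the mesh. A directional derivative is a
limit of right slopes along a ray; the ray returns to one fixed simplex arbitrarily close to `x`,
and there the slopes are those of an affine function. -/
theorem IsMeshOf.exists_norm_gradient_le {u : E d → ℝ} (hu : u ∈ P1Space M) :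
    ∃ K : ℝ, ∀ x ∈ Ω, ‖∇ u x‖ ≤ K := by
  obtain ⟨K, hK⟩ := P1Space.exists_slope_bound hu h.finite
  refine ⟨K, fun x hx => ?_⟩
  rw [norm_gradient]
  refine ContinuousLinearMap.opNorm_le_bound _ K.2 fun e => ?_
  by_cases hd : DifferentiableAt ℝ u x
  swap
  · rw [fderiv_zero_of_not_differentiableAt hd]
    simp only [_root_.zero_apply, norm_zero]
    exact mul_nonneg K.2 (norm_nonneg _)
  have hder : HasDerivAt (fun t : ℝ => u (x + t • e)) (fderiv ℝ u x e) 0 := by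
    have h1 : HasFDerivAt u (fderiv ℝ u x) (x + (0 : ℝ) • e) := by
      simpa using hd.hasFDerivAt
    have h2 : HasDerivAt (fun t : ℝ => x + t • e) e 0 := by
      simpa using ((hasDerivAt_id (0 : ℝ)).smul_const e).const_add x
    exact h1.comp_hasDerivAt 0 h2
  have htend := (hasDerivAt_iff_tendsto_slope.1 hder).mono_left
    (nhdsWithin_mono 0 (fun z (hz : z ∈ Ioi (0 : ℝ)) => ne_of_gt hz))
  have hcc : Continuous fun t : ℝ => x + t • e := by fun_prop
  have hct : Tendsto (fun t : ℝ => x + t • e) (𝓝[>] 0) (𝓝 x) := by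
    simpa using (hcc.tendsto 0).mono_left nhdsWithin_le_nhds
  have h1 : ∀ᶠ t : ℝ in 𝓝[>] 0, ∃ s : M.faces,
      x + t • e ∈ convexHull ℝ ((s : Finset (E d)) : Set (E d)) := by
    filter_upwards [hct.eventually (h.isOpen.mem_nhds hx)] with t ht
    obtain ⟨s, hs, hxs⟩ := Geometry.SimplicialComplex.mem_space_iff.1 (h.subset_space ht)
    exact ⟨⟨s, hs⟩, hxs⟩
  have hfin := h.finite.to_subtype
  have h2 : ∃ s : M.faces, ∃ᶠ t : ℝ in 𝓝[>] 0,
      x + t • e ∈ convexHull ℝ ((s : Finset (E d)) : Set (E d)) := by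
    by_contra! hcon
    obtain ⟨t, ht1, ht2⟩ := (h1.and (eventually_all.2 hcon)).exists
    obtain ⟨s, hs⟩ := ht1
    exact ht2 s hs
  obtain ⟨s, hs⟩ := h2
  obtain ⟨L, hL, hl⟩ := hK s s.2
  have hxs : x ∈ convexHull ℝ ((s : Finset (E d)) : Set (E d)) :=
    (isClosed_simplex _).mem_of_frequently_of_tendsto hs hct
  have hmem : fderiv ℝ u x e ∈ Metric.closedBall (0 : ℝ) (K * ‖e‖) := by
    refine Metric.isClosed_closedBall.mem_of_frequently_of_tendsto ?_ htend
    refine (hs.and_eventually self_mem_nhdsWithin).mono fun t ⟨ht, ht0⟩ => ?_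
    have ht0' : (0 : ℝ) < t := ht0
    rw [mem_closedBall_zero_iff, slope_def_field, sub_zero, zero_smul, add_zero, hL ht, hL hxs,
      norm_div, Real.norm_eq_abs, Real.norm_eq_abs, abs_of_pos ht0', div_le_iff₀ ht0']
    refine (hl _ _).trans (le_of_eq ?_)
    rw [dist_eq_norm, add_sub_cancel_left, norm_smul, Real.norm_eq_abs, abs_of_pos ht0']
    ring
  simpa using hmem

/-- The skeleton is negligible, since frontiers of convex sets are null sets; a degenerate simplex
is its own frontier. -/
theorem IsMeshOf.ae_differentiableAt {u : E d → ℝ} (hu : u ∈ P1Space M) :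
    ∀ᵐ x ∂(volume.restrict Ω), DifferentiableAt ℝ u x := by
  have h1 : ∀ᵐ x ∂(volume : Measure (E d)), ∀ s ∈ M.faces,
      x ∉ frontier (convexHull ℝ (s : Set (E d))) := by
    refine (ae_ball_iff h.finite.countable).2 fun s _ => ?_
    exact measure_eq_zero_iff_ae_notMem.1 ((convex_convexHull ℝ _).addHaar_frontier volume)
  filter_upwards [ae_restrict_mem h.isOpen.measurableSet, ae_restrict_of_ae h1] with x hx hxf
  obtain ⟨s, hs, hxs⟩ := Geometry.SimplicialComplex.mem_space_iff.1 (h.subset_space hx)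
  obtain ⟨L, hL⟩ := hu s hs
  have hxi : x ∈ interior (convexHull ℝ (s : Set (E d))) := by
    by_contra hni
    exact hxf s hs ⟨subset_closure hxs, hni⟩
  have hLd : DifferentiableAt ℝ L x := by
    have : (L : E d → ℝ) = fun x => LinearMap.toContinuousLinearMap L.linear x + L 0 :=
      L.decomp
    rw [this]
    fun_prop
  refine hLd.congr_of_eventuallyEq ?_
  filter_upwards [mem_interior_iff_mem_nhds.1 hxi] with z hz
  exact hL hz

theorem IsMeshOf.exists_abs_le {u : E d → ℝ} (hu : u ∈ P1Space M) :
    ∃ C : ℝ, ∀ x ∈ closure Ω, |u x| ≤ C := by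
  have hc := P1Space.continuousOn hu h.finite
  rw [h.space_eq] at hc
  exact h.isCompact_closure.exists_bound_of_continuousOn hc

end Domain

/-! ### Integration by parts -/

section Parts

variable {d : ℕ} {M : Geometry.SimplicialComplex ℝ (E d)} {Ω : Set (E d)}

theorem ae_norm_le_of_eLpNorm_top_le {X F : Type*} [MeasurableSpace X] {μ : Measure X}
    [NormedAddCommGroup F] {f : X → F} {C : ℝ} (hC : 0 ≤ C)
    (h : eLpNorm f ∞ μ ≤ ENNReal.ofReal C) : ∀ᵐ x ∂μ, ‖f x‖ ≤ C := by
  filter_upwards [ae_le_eLpNormEssSup (f := f) (μ := μ)] with x hx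
  rw [← eLpNorm_exponent_top] at hx
  have := hx.trans h
  rwa [← ofReal_norm, ENNReal.ofReal_le_ofReal_iff hC] at this

theorem exists_ae_norm_le_of_memLp_top {X F : Type*} [MeasurableSpace X] {μ : Measure X}
    [NormedAddCommGroup F] {f : X → F} (h : MemLp f ∞ μ) : ∃ C : ℝ, 0 ≤ C ∧ ∀ᵐ x ∂μ, ‖f x‖ ≤ C :=
  ⟨(eLpNorm f ∞ μ).toReal, ENNReal.toReal_nonneg,
    ae_norm_le_of_eLpNorm_top_le ENNReal.toReal_nonneg
      (by rw [ENNReal.ofReal_toReal h.2.ne])⟩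

theorem contDiff_two_of_smooth {p : E d → ℝ} (hp : ContDiff ℝ (⊤ : ℕ∞) p) : ContDiff ℝ 2 p :=
  contDiff_infty.1 hp 2

theorem contDiff_fderiv_of_two {p : E d → ℝ} (hp : ContDiff ℝ 2 p) :
    ContDiff ℝ 1 (fderiv ℝ p) :=
  hp.fderiv_right (by norm_num)

theorem continuous_gradient {p : E d → ℝ} (hp : ContDiff ℝ 2 p) : Continuous (∇ p) :=
  (LinearIsometryEquiv.continuous _).comp (contDiff_fderiv_of_two hp).continuous

theorem laplacian_eq_sum_fderiv (p : E d → ℝ) (x : E d) :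
    Laplacian.laplacian p x = ∑ i, fderiv ℝ (fderiv ℝ p) x
      (EuclideanSpace.basisFun (Fin d) ℝ i) (EuclideanSpace.basisFun (Fin d) ℝ i) := by
  rw [InnerProductSpace.laplacian_eq_iteratedFDeriv_orthonormalBasis p
    (EuclideanSpace.basisFun (Fin d) ℝ)]
  simp [iteratedFDeriv_two_apply]

theorem continuous_laplacian {p : E d → ℝ} (hp : ContDiff ℝ 2 p) :
    Continuous (Laplacian.laplacian p) := by
  have : Laplacian.laplacian p = fun x => ∑ i, fderiv ℝ (fderiv ℝ p) x
      (EuclideanSpace.basisFun (Fin d) ℝ i) (EuclideanSpace.basisFun (Fin d) ℝ i) :=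
    funext (laplacian_eq_sum_fderiv p)
  rw [this]
  have h := (contDiff_fderiv_of_two hp).continuous_fderiv one_ne_zero
  fun_prop

/-- Links classical test functions with the Galerkin orthogonality, which is stated for weak
gradients. -/
theorem hasWeakGradient_of_contDiff {p : E d → ℝ} (hp : ContDiff ℝ 2 p) :
    HasWeakGradient Ω p (∇ p) := by
  intro φ hφ hφc hφs e
  have hcf : Continuous (fderiv ℝ p) := hp.continuous_fderiv two_ne_zero
  have hcφ : Continuous (fderiv ℝ φ) := hφ.continuous_fderiv (by simp)
  have hd : Differentiable ℝ p := hp.differentiable two_ne_zero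
  have hdφ : Differentiable ℝ φ := hφ.differentiable (by simp)
  have h0 : ∀ x, x ∉ Ω → φ x = 0 := fun x hx => image_eq_zero_of_notMem_tsupport
    fun h => hx (hφs h)
  have h0' : ∀ x, x ∉ Ω → fderiv ℝ φ x = 0 := fun x hx =>
    image_eq_zero_of_notMem_tsupport fun h => hx (hφs (tsupport_fderiv_subset ℝ h))
  rw [setIntegral_eq_integral_of_forall_compl_eq_zero fun x hx => by rw [h0' x hx]; simp,
    setIntegral_eq_integral_of_forall_compl_eq_zero fun x hx => by rw [h0 x hx]; simp]
  simp_rw [inner_gradient_left]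
  refine integral_mul_fderiv_eq_neg_fderiv_mul_of_integrable ?_ ?_ ?_ (fun x _ => hd x)
    fun x _ => hdφ x
  · exact Continuous.integrable_of_hasCompactSupport (by fun_prop) hφc.mul_left
  · refine Continuous.integrable_of_hasCompactSupport (by fun_prop) ?_
    exact HasCompactSupport.mul_left (hφc.fderiv_apply ℝ e)
  · exact Continuous.integrable_of_hasCompactSupport (by fun_prop) hφc.mul_left

variable (h : IsMeshOf M Ω)
include h

theorem IsMeshOf.memLp_of_continuous {F : Type*} [NormedAddCommGroup F]
    {f : E d → F} (hf : Continuous f) (q : ℝ≥0∞) : MemLp f q (volume.restrict Ω) := by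
  obtain ⟨C, hC⟩ := h.isCompact_closure.exists_bound_of_continuousOn hf.continuousOn
  have : IsFiniteMeasure (volume.restrict Ω) :=
    ⟨by simpa using h.isBounded.measure_lt_top⟩
  refine MemLp.of_bound hf.aestronglyMeasurable C ?_
  filter_upwards [ae_restrict_mem h.isOpen.measurableSet] with x hx
  exact hC x (subset_closure hx)

theorem IsMeshOf.integrable_gradient_inner (y : E d) {u : E d → ℝ}
    (hu : ∃ K : ℝ, ∀ x ∈ Ω, ‖∇ u x‖ ≤ K) :
    Integrable (fun x => inner ℝ (∇ u x) (∇ (hatN Ω M y) x)) (volume.restrict Ω) := by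
  have : IsFiniteMeasure (volume.restrict Ω) :=
    ⟨by simpa using h.isBounded.measure_lt_top⟩
  obtain ⟨K, hK⟩ := hu
  have hm : hatN Ω M y ∈ P1Space M := by
    have : hatN Ω M y = (∫ z in Ω, |hat M y z|)⁻¹ • hat M y := by
      funext x
      simp [hatN, div_eq_inv_mul]
    rw [this]
    exact (P1Space M).smul_mem _ (hat_mem_P1Space y)
  obtain ⟨K', hK'⟩ := h.exists_norm_gradient_le hm
  refine Integrable.of_bound (C := K * K')
    ((measurable_gradient u).inner (measurable_gradient _)).aestronglyMeasurable ?_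
  filter_upwards [ae_restrict_mem h.isOpen.measurableSet] with x hx
  refine (norm_inner_le_norm _ _).trans ?_
  exact mul_le_mul (hK x hx) (hK' x hx) (norm_nonneg _) ((norm_nonneg _).trans (hK x hx))

/-- The hat function of an internal node is Lipschitz, compactly supported and zero off `Ω`, so
integration by parts over the whole space applies in each coordinate and leaves no boundary term. -/
theorem IsMeshOf.integral_gradient_hatN {y : E d} (hy : y ∈ M.vertices ∩ Ω) {p : E d → ℝ}
    (hp : ContDiff ℝ 2 p) :
    ∫ x in Ω, inner ℝ (∇ p x) (∇ (hatN Ω M y) x) =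
      ∫ x in Ω, (- Laplacian.laplacian p x) * hatN Ω M y x := by
  set φ := hatN Ω M y with hφ
  set b := EuclideanSpace.basisFun (Fin d) ℝ with hb
  have hpos := h.integral_hat_pos hy
  have hfin : IsFiniteMeasure (volume.restrict Ω) :=
    ⟨by simpa using h.isBounded.measure_lt_top⟩
  have hφeq : φ = fun x => (∫ z in Ω, |hat M y z|)⁻¹ * hat M y x := by
    funext x
    simp [hφ, hatN, div_eq_inv_mul]
  obtain ⟨K, hK⟩ := h.exists_lipschitzWith_hat hy
  obtain ⟨K', hK'⟩ : ∃ K', LipschitzWith K' φ := by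
    refine ⟨‖(∫ z in Ω, |hat M y z|)⁻¹‖₊ * K, ?_⟩
    rw [hφeq]
    exact (lipschitzWith_smul _).comp hK
  have hφ0 : ∀ x, x ∉ Ω → φ x = 0 := fun x hx => by
    rw [hφeq]
    simp [h.hat_eq_zero hy hx]
  have hφc : HasCompactSupport φ := HasCompactSupport.intro h.isCompact_closure fun x hx =>
    hφ0 x fun h' => hx (subset_closure h')
  have hφd : ∀ᵐ x ∂(volume : Measure (E d)), DifferentiableAt ℝ φ x := hK'.ae_differentiableAt
  have hφ0' : ∀ x, x ∉ Ω → fderiv ℝ φ x = 0 := fun x hx => by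
    have := h.gradient_hatN_eq_zero hy hx
    rw [← norm_eq_zero, ← norm_gradient, this, norm_zero]
  obtain ⟨R, hR⟩ : ∃ R, Ω ⊆ Metric.ball (0 : E d) R := by
    obtain ⟨R, hR⟩ := h.isBounded.subset_ball 0
    exact ⟨R, hR⟩
  have hcD := contDiff_fderiv_of_two hp
  have key : ∀ i, ∫ x in Ω, fderiv ℝ p x (b i) * fderiv ℝ φ x (b i) =
      ∫ x in Ω, - (fderiv ℝ (fderiv ℝ p) x (b i) (b i) * φ x) := by
    intro i
    have hDi : ContDiff ℝ 1 fun x => fderiv ℝ p x (b i) := hcD.clm_apply contDiff_const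
    -- The derivative of `p` is only locally Lipschitz. It is replaced by a globally Lipschitz
    -- function that agrees with it on a ball containing `Ω`.
    obtain ⟨L, hL⟩ := hDi.locallyLipschitz.locallyLipschitzOn
      |>.exists_lipschitzOnWith_of_compact (isCompact_closedBall (0 : E d) R)
    obtain ⟨f, hf, hfe⟩ := hL.extend_real
    have hparts := hf.integral_lineDeriv_mul_eq (μ := volume) hK' hφc (b i)
    have h1 : ∫ x, lineDeriv ℝ f x (b i) * φ x =
        ∫ x in Ω, fderiv ℝ (fderiv ℝ p) x (b i) (b i) * φ x := by
      rw [← setIntegral_eq_integral_of_forall_compl_eq_zero (s := Ω)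
        fun x hx => by rw [hφ0 x hx, mul_zero]]
      refine setIntegral_congr_fun h.isOpen.measurableSet fun x hx => ?_
      have hev : f =ᶠ[𝓝 x] fun x => fderiv ℝ p x (b i) := by
        filter_upwards [Metric.isOpen_ball.mem_nhds (hR hx)] with z hz
        exact (hfe (Metric.ball_subset_closedBall hz)).symm
      have hd : DifferentiableAt ℝ (fderiv ℝ p) x := hcD.differentiable one_ne_zero x
      have h2 : HasFDerivAt (fun x => fderiv ℝ p x (b i))
          ((ContinuousLinearMap.apply ℝ ℝ (b i)).comp (fderiv ℝ (fderiv ℝ p) x)) x :=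
        (ContinuousLinearMap.apply ℝ ℝ (b i)).hasFDerivAt.comp x hd.hasFDerivAt
      have h3 : lineDeriv ℝ f x (b i) = fderiv ℝ (fderiv ℝ p) x (b i) (b i) := by
        rw [hev.lineDeriv_eq, h2.differentiableAt.lineDeriv_eq_fderiv, h2.fderiv]
        rfl
      simp only [h3]
    have h4 : ∫ x, lineDeriv ℝ φ x (-(b i)) * f x =
        - ∫ x in Ω, fderiv ℝ p x (b i) * fderiv ℝ φ x (b i) := by
      rw [← integral_neg]
      have h5 : ∫ x, lineDeriv ℝ φ x (-(b i)) * f x = ∫ x, -(fderiv ℝ φ x (b i)) * f x := by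
        refine integral_congr_ae ?_
        filter_upwards [hφd] with x hx
        rw [lineDeriv_neg, hx.lineDeriv_eq_fderiv]
      rw [h5, ← setIntegral_eq_integral_of_forall_compl_eq_zero (s := Ω)
        fun x hx => by rw [hφ0' x hx]; simp]
      refine setIntegral_congr_fun h.isOpen.measurableSet fun x hx => ?_
      have : f x = fderiv ℝ p x (b i) := (hfe (Metric.ball_subset_closedBall (hR hx))).symm
      simp only [this]
      ring
    rw [h1, h4] at hparts
    rw [integral_neg, hparts, neg_neg]
  have hinner : ∀ x, inner ℝ (∇ p x) (∇ φ x) = ∑ i, fderiv ℝ p x (b i) * fderiv ℝ φ x (b i) := by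
    intro x
    rw [← b.sum_inner_mul_inner]
    refine Finset.sum_congr rfl fun i _ => ?_
    rw [inner_gradient_left, inner_gradient_right]
    simp
  simp_rw [hinner]
  rw [integral_finsetSum, Finset.sum_congr rfl fun i _ => key i, ← integral_finsetSum]
  · refine setIntegral_congr_fun h.isOpen.measurableSet fun x _ => ?_
    rw [laplacian_eq_sum_fderiv, neg_mul, Finset.sum_mul, Finset.sum_neg_distrib]
  · intro i _
    have hc2 : Continuous (fderiv ℝ (fderiv ℝ p)) := hcD.continuous_fderiv one_ne_zero
    have : Continuous fun x => fderiv ℝ (fderiv ℝ p) x (b i) (b i) := by fun_prop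
    exact (((this.mul hK'.continuous).integrable_of_hasCompactSupport hφc.mul_left).neg).integrableOn
  · intro i _
    have hc1 : Continuous fun x => fderiv ℝ p x (b i) := hcD.continuous.clm_apply continuous_const
    obtain ⟨C, hC⟩ := h.isCompact_closure.exists_bound_of_continuousOn hc1.continuousOn
    refine Integrable.of_bound (C := C * (K' * ‖b i‖)) (hc1.measurable.mul
      (measurable_fderiv_apply_const ℝ φ (b i))).aestronglyMeasurable ?_
    filter_upwards [ae_restrict_mem h.isOpen.measurableSet] with x hx
    rw [norm_mul]
    have h1 := hC x (subset_closure hx)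
    refine mul_le_mul h1 ?_ (norm_nonneg _) ((norm_nonneg _).trans h1)
    refine ((fderiv ℝ φ x).le_opNorm _).trans ?_
    gcongr
    exact norm_fderiv_le_of_lipschitz ℝ hK'

end Parts

/-! ### Discrete operators: linearity, matrix form and bounds uniform in the controls -/

section Operators

variable {d : ℕ} {A B : Type*} [MetricSpace A] [MetricSpace B] {Q : Problem d A B}
  (S : Discretisation Q)

theorem Discretisation.isMeshOf (i : ℕ) : IsMeshOf (S.mesh i) Q.Ω :=
  ⟨S.finite_mesh i, S.space_mesh i, Q.isOpen_Ω, Q.isBounded_Ω,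
    Q.lipschitz_Ω.interior_closure_subset⟩

theorem Problem.ae_mem (Q : Problem d A B) : ∀ᵐ x ∂(volume.restrict Q.Ω), x ∈ Q.Ω :=
  ae_restrict_mem Q.isOpen_Ω.measurableSet

theorem Problem.isCompact_closure (Q : Problem d A B) : IsCompact (closure Q.Ω) :=
  Q.isBounded_Ω.isCompact_closure

variable {S}

theorem P1Space.aestronglyMeasurable {i : ℕ} {u : E d → ℝ} (hu : u ∈ P1Space (S.mesh i)) :
    AEStronglyMeasurable u (volume.restrict Q.Ω) := by
  have hc := P1Space.continuousOn hu (S.finite_mesh i)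
  exact (hc.mono (S.isMeshOf i).subset_space).aestronglyMeasurable Q.isOpen_Ω.measurableSet

theorem aestronglyMeasurable_lowerOrder {i : ℕ} {b : E d → E d} {c : E d → ℝ}
    (hb : AEStronglyMeasurable b (volume.restrict Q.Ω))
    (hc : AEStronglyMeasurable c (volume.restrict Q.Ω))
    {u : E d → ℝ} (hu : u ∈ P1Space (S.mesh i)) :
    AEStronglyMeasurable (fun x => - inner ℝ (b x) (∇ u x) + c x * u x)
      (volume.restrict Q.Ω) :=
  ((hb.inner (measurable_gradient u).aestronglyMeasurable).neg).add
    (hc.mul (P1Space.aestronglyMeasurable hu))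

/-- The first and zeroth order terms are bounded in terms of bounds for the coefficients. -/
theorem exists_lowerOrder_bound {i : ℕ} {u : E d → ℝ} (hu : u ∈ P1Space (S.mesh i)) :
    ∃ K : ℝ, 0 ≤ K ∧ ∀ (b : E d → E d) (c : E d → ℝ) (C : ℝ), 0 ≤ C →
      (∀ᵐ x ∂(volume.restrict Q.Ω), ‖b x‖ ≤ C) → (∀ᵐ x ∂(volume.restrict Q.Ω), ‖c x‖ ≤ C) →
      ∀ᵐ x ∂(volume.restrict Q.Ω), |- inner ℝ (b x) (∇ u x) + c x * u x| ≤ C * K := by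
  obtain ⟨K, hK⟩ := (S.isMeshOf i).exists_norm_gradient_le hu
  obtain ⟨K', hK'⟩ := (S.isMeshOf i).exists_abs_le hu
  refine ⟨|K| + |K'|, by positivity, fun b c C hC hb hc => ?_⟩
  filter_upwards [hb, hc, Q.ae_mem] with x hbx hcx hx
  have h1 : |inner ℝ (b x) (∇ u x)| ≤ C * |K| :=
    (abs_real_inner_le_norm _ _).trans
      (mul_le_mul hbx ((hK x hx).trans (le_abs_self K)) (norm_nonneg _) hC)
  have h2 : |c x * u x| ≤ C * |K'| := by
    rw [abs_mul]
    exact mul_le_mul hcx ((hK' x (subset_closure hx)).trans (le_abs_self K')) (abs_nonneg _) hC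
  calc _ ≤ |- inner ℝ (b x) (∇ u x)| + |c x * u x| := abs_add_le _ _
    _ ≤ C * |K| + C * |K'| := by rw [abs_neg]; exact add_le_add h1 h2
    _ = _ := by ring

theorem integrable_lowerOrder {i : ℕ} {b : E d → E d} {c : E d → ℝ}
    (hb : MemLp b ∞ (volume.restrict Q.Ω)) (hc : MemLp c ∞ (volume.restrict Q.Ω))
    {u : E d → ℝ} (hu : u ∈ P1Space (S.mesh i)) {y : E d} (hy : y ∈ S.internalNodes i) :
    Integrable (fun x => (- inner ℝ (b x) (∇ u x) + c x * u x) * hatN Q.Ω (S.mesh i) y x)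
      (volume.restrict Q.Ω) := by
  obtain ⟨K, hK0, hK⟩ := exists_lowerOrder_bound hu
  obtain ⟨C, hC0, hC⟩ := exists_ae_norm_le_of_memLp_top hb
  obtain ⟨C', hC0', hC'⟩ := exists_ae_norm_le_of_memLp_top hc
  refine ((S.isMeshOf i).integrable_hatN hy).bdd_mul (c := max C C' * K)
    (aestronglyMeasurable_lowerOrder hb.1 hc.1 hu) ?_
  exact hK b c (max C C') (hC0.trans (le_max_left _ _))
    (hC.mono fun x hx => hx.trans (le_max_left _ _))
    (hC'.mono fun x hx => hx.trans (le_max_right _ _))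

theorem integrable_gradient_P1 {i : ℕ} {u : E d → ℝ} (hu : u ∈ P1Space (S.mesh i)) (y : E d) :
    Integrable (fun x => inner ℝ (∇ u x) (∇ (hatN Q.Ω (S.mesh i) y) x)) (volume.restrict Q.Ω) :=
  (S.isMeshOf i).integrable_gradient_inner y ((S.isMeshOf i).exists_norm_gradient_le hu)

theorem discOp_add {i : ℕ} {a : E d → ℝ} {b : E d → E d} {c : E d → ℝ}
    (hb : MemLp b ∞ (volume.restrict Q.Ω)) (hc : MemLp c ∞ (volume.restrict Q.Ω))
    {u w : E d → ℝ} (hu : u ∈ P1Space (S.mesh i)) (hw : w ∈ P1Space (S.mesh i))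
    {y : E d} (hy : y ∈ S.internalNodes i) :
    S.discOp i a b c (u + w) y = S.discOp i a b c u y + S.discOp i a b c w y := by
  -- Additivity of the pointwise gradient can fail on the skeleton, where the default value zero
  -- intervenes.
  have hgrad : ∀ᵐ x ∂(volume.restrict Q.Ω), ∇ (u + w) x = ∇ u x + ∇ w x := by
    filter_upwards [(S.isMeshOf i).ae_differentiableAt hu,
      (S.isMeshOf i).ae_differentiableAt hw] with x hux hwx
    rw [gradient, fderiv_add hux hwx, map_add]
    rfl
  unfold Discretisation.discOp
  have h1 : ∫ x in Q.Ω, inner ℝ (∇ (u + w) x) (∇ (hatN Q.Ω (S.mesh i) y) x) =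
      (∫ x in Q.Ω, inner ℝ (∇ u x) (∇ (hatN Q.Ω (S.mesh i) y) x)) +
      ∫ x in Q.Ω, inner ℝ (∇ w x) (∇ (hatN Q.Ω (S.mesh i) y) x) := by
    rw [← integral_add (integrable_gradient_P1 hu y) (integrable_gradient_P1 hw y)]
    refine integral_congr_ae ?_
    filter_upwards [hgrad] with x hx
    rw [hx, inner_add_left]
  have h2 : ∫ x in Q.Ω, (- inner ℝ (b x) (∇ (u + w) x) + c x * (u + w) x) *
        hatN Q.Ω (S.mesh i) y x =
      (∫ x in Q.Ω, (- inner ℝ (b x) (∇ u x) + c x * u x) * hatN Q.Ω (S.mesh i) y x) +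
      ∫ x in Q.Ω, (- inner ℝ (b x) (∇ w x) + c x * w x) * hatN Q.Ω (S.mesh i) y x := by
    rw [← integral_add (integrable_lowerOrder hb hc hu hy) (integrable_lowerOrder hb hc hw hy)]
    refine integral_congr_ae ?_
    filter_upwards [hgrad] with x hx
    rw [hx, inner_add_right, Pi.add_apply]
    ring
  rw [h1, h2]
  ring

theorem discOp_smul {i : ℕ} {a : E d → ℝ} {b : E d → E d} {c : E d → ℝ}
    (r : ℝ) {u : E d → ℝ} (hu : u ∈ P1Space (S.mesh i)) {y : E d} :
    S.discOp i a b c (r • u) y = r * S.discOp i a b c u y := by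
  have hgrad : ∀ᵐ x ∂(volume.restrict Q.Ω), ∇ (r • u) x = r • ∇ u x := by
    filter_upwards [(S.isMeshOf i).ae_differentiableAt hu] with x hux
    rw [gradient, fderiv_const_smul hux, map_smul]
    rfl
  unfold Discretisation.discOp
  have h1 : ∫ x in Q.Ω, inner ℝ (∇ (r • u) x) (∇ (hatN Q.Ω (S.mesh i) y) x) =
      r * ∫ x in Q.Ω, inner ℝ (∇ u x) (∇ (hatN Q.Ω (S.mesh i) y) x) := by
    rw [← integral_const_mul]
    refine integral_congr_ae ?_
    filter_upwards [hgrad] with x hx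
    rw [hx, real_inner_smul_left]
  have h2 : ∫ x in Q.Ω, (- inner ℝ (b x) (∇ (r • u) x) + c x * (r • u) x) *
        hatN Q.Ω (S.mesh i) y x =
      r * ∫ x in Q.Ω, (- inner ℝ (b x) (∇ u x) + c x * u x) * hatN Q.Ω (S.mesh i) y x := by
    rw [← integral_const_mul]
    refine integral_congr_ae ?_
    filter_upwards [hgrad] with x hx
    rw [hx, real_inner_smul_right, Pi.smul_apply, smul_eq_mul]
    ring
  rw [h1, h2]
  ring

/-- Members of `P1Space` are arbitrary outside the mesh. As `Ω` is open, the operator does not see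
this ambiguity. -/
theorem discOp_congr {i : ℕ} {a : E d → ℝ} {b : E d → E d} {c : E d → ℝ}
    {u w : E d → ℝ} (huw : EqOn u w Q.Ω) {y : E d} :
    S.discOp i a b c u y = S.discOp i a b c w y := by
  have hgrad : ∀ x ∈ Q.Ω, ∇ u x = ∇ w x := fun x hx =>
    (Filter.eventuallyEq_of_mem (Q.isOpen_Ω.mem_nhds hx) huw).gradient_eq
  unfold Discretisation.discOp
  congr 1
  · congr 1
    refine setIntegral_congr_fun Q.isOpen_Ω.measurableSet fun x hx => ?_
    simp only [hgrad x hx]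
  · refine setIntegral_congr_fun Q.isOpen_Ω.measurableSet fun x hx => ?_
    simp only [hgrad x hx, huw hx]

theorem discOp_const {i : ℕ} {a : E d → ℝ} {b : E d → E d} {c : E d → ℝ} (m : ℝ) {y : E d} :
    S.discOp i a b c (fun _ => m) y = ∫ x in Q.Ω, (c x * m) * hatN Q.Ω (S.mesh i) y x := by
  unfold Discretisation.discOp
  have : ∀ x : E d, ∇ (fun _ : E d => m) x = 0 := fun x => gradient_fun_const x m
  simp [this]

/-- The discrete operator at an internal node as a linear form on the finite element space. -/
noncomputable def discOpLin (S : Discretisation Q) {i : ℕ} (a : E d → ℝ) {b : E d → E d} {c : E d → ℝ}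
    (hb : MemLp b ∞ (volume.restrict Q.Ω)) (hc : MemLp c ∞ (volume.restrict Q.Ω))
    {y : E d} (hy : y ∈ S.internalNodes i) : P1Space (S.mesh i) →ₗ[ℝ] ℝ where
  toFun u := S.discOp i a b c u y
  map_add' u w := discOp_add hb hc u.2 w.2 hy
  map_smul' r u := discOp_smul r u.2

theorem discOp_sub {i : ℕ} {a : E d → ℝ} {b : E d → E d} {c : E d → ℝ}
    (hb : MemLp b ∞ (volume.restrict Q.Ω)) (hc : MemLp c ∞ (volume.restrict Q.Ω))
    {u w : E d → ℝ} (hu : u ∈ P1Space (S.mesh i)) (hw : w ∈ P1Space (S.mesh i))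
    {y : E d} (hy : y ∈ S.internalNodes i) :
    S.discOp i a b c (u - w) y = S.discOp i a b c u y - S.discOp i a b c w y := by
  have h1 : u - w = u + (-1 : ℝ) • w := by
    rw [neg_one_smul, sub_eq_add_neg]
  rw [h1, discOp_add hb hc hu ((P1Space _).smul_mem _ hw) hy, discOp_smul _ hw]
  ring

/-- The operator in terms of its matrix row at `y`, the form in which the sign conditions on the
explicit part are assumed. -/
theorem discOp_eq_sum {i : ℕ} {a : E d → ℝ} {b : E d → E d} {c : E d → ℝ}
    (hb : MemLp b ∞ (volume.restrict Q.Ω)) (hc : MemLp c ∞ (volume.restrict Q.Ω))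
    {u : E d → ℝ} (hu : u ∈ P1Space (S.mesh i)) {y : E d} (hy : y ∈ S.internalNodes i) :
    S.discOp i a b c u y = ∑ z ∈ (finite_vertices (S.finite_mesh i)).toFinset,
      u z * S.discOp i a b c (hat (S.mesh i) z) y := by
  have h1 := map_sum (discOpLin S a hb hc hy)
    (fun z => u z • (⟨hat (S.mesh i) z, hat_mem_P1Space z⟩ : P1Space (S.mesh i)))
    (finite_vertices (S.finite_mesh i)).toFinset
  simp only [map_smul, smul_eq_mul] at h1
  refine Eq.trans ?_ h1
  refine discOp_congr fun x hx => ?_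
  rw [P1Space.eq_sum hu (finite_vertices (S.finite_mesh i)) ((S.isMeshOf i).subset_space hx)]
  simp

/-- A bound of the discrete operator in terms of bounds of its coefficients. -/
theorem exists_discOp_bound {i : ℕ} {u : E d → ℝ} (hu : u ∈ P1Space (S.mesh i)) {y : E d}
    (hy : y ∈ S.internalNodes i) (C : ℝ) (hC : 0 ≤ C) :
    ∃ K : ℝ, ∀ (a : E d → ℝ) (b : E d → E d) (c : E d → ℝ),
      MemLp b ∞ (volume.restrict Q.Ω) → MemLp c ∞ (volume.restrict Q.Ω) → |a y| ≤ C →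
      (∀ᵐ x ∂(volume.restrict Q.Ω), ‖b x‖ ≤ C) → (∀ᵐ x ∂(volume.restrict Q.Ω), ‖c x‖ ≤ C) →
      |S.discOp i a b c u y| ≤ K := by
  obtain ⟨K, hK0, hK⟩ := exists_lowerOrder_bound hu
  refine ⟨C * |∫ x in Q.Ω, inner ℝ (∇ u x) (∇ (hatN Q.Ω (S.mesh i) y) x)| + C * K,
    fun a b c hbm hcm ha hb hc => ?_⟩
  unfold Discretisation.discOp
  refine (abs_add_le _ _).trans (add_le_add ?_ ?_)
  · rw [abs_mul]
    exact mul_le_mul_of_nonneg_right ha (abs_nonneg _)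
  · have := (S.isMeshOf i).abs_integral_mul_hatN_sub_le hy (c := 0) (ε := C * K)
      (aestronglyMeasurable_lowerOrder hbm.1 hcm.1 hu) ?_
    · simpa using this
    · filter_upwards [hK b c C hC hb hc] with x hx _
      simpa using hx

/-! ### Bounds which are uniform with respect to the controls -/

/-- Compactness of the control set turns the bound near each control (its own norm plus one) into a
global one. Such bounds are indispensable for the Isaacs functional, as real infima and suprema of
unbounded families are meaningless defaults. -/
theorem exists_uniform_ae_bound {X Y F : Type*} [TopologicalSpace X] [CompactSpace X]
    [MeasurableSpace Y] {μ : Measure Y} [NormedAddCommGroup F] {f : X → Y → F}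
    (hf : ∀ p, MemLp (f p) ∞ μ)
    (hc : ∀ p₀, Tendsto (fun p => eLpNorm (f p - f p₀) ∞ μ) (𝓝 p₀) (𝓝 0)) :
    ∃ C : ℝ, 0 ≤ C ∧ ∀ p, ∀ᵐ x ∂μ, ‖f p x‖ ≤ C := by
  have : ∃ C : ℝ, 0 ≤ C ∧ ∀ p ∈ (univ : Set X), ∀ᵐ x ∂μ, ‖f p x‖ ≤ C := by
    refine isCompact_univ.induction_on (p := fun s => ∃ C : ℝ, 0 ≤ C ∧ ∀ p ∈ s,
      ∀ᵐ x ∂μ, ‖f p x‖ ≤ C) ⟨0, le_rfl, by simp⟩ ?_ ?_ ?_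
    · rintro s t hst ⟨C, hC, h⟩
      exact ⟨C, hC, fun p hp => h p (hst hp)⟩
    · rintro s t ⟨C, hC, h⟩ ⟨C', hC', h'⟩
      refine ⟨max C C', hC.trans (le_max_left _ _), ?_⟩
      rintro p (hp | hp)
      · exact (h p hp).mono fun x hx => hx.trans (le_max_left _ _)
      · exact (h' p hp).mono fun x hx => hx.trans (le_max_right _ _)
    · intro p₀ _
      obtain ⟨C, hC, hCx⟩ := exists_ae_norm_le_of_memLp_top (hf p₀)
      have h1 := (hc p₀).eventually (ge_mem_nhds (show (0 : ℝ≥0∞) < ENNReal.ofReal 1 by simp))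
      refine ⟨_, mem_nhdsWithin_of_mem_nhds h1, C + 1, by positivity, fun p hp => ?_⟩
      filter_upwards [hCx, ae_norm_le_of_eLpNorm_top_le zero_le_one hp] with x hx1 hx2
      have h3 : f p x = f p₀ x + (f p - f p₀) x := by simp
      rw [h3]
      exact (norm_add_le _ _).trans (add_le_add hx1 hx2)
  obtain ⟨C, hC, h⟩ := this
  exact ⟨C, hC, fun p => h p (mem_univ p)⟩

theorem exists_opE_bound [CompactSpace A] [CompactSpace B] (hcons : S.Consistent) {i : ℕ}
    {u : E d → ℝ} (hu : u ∈ P1Space (S.mesh i)) {y : E d} (hy : y ∈ S.internalNodes i) :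
    ∃ K : ℝ, ∀ p, |S.opE i p u y| ≤ K := by
  obtain ⟨C₁, hC₁, h₁⟩ := exists_uniform_ae_bound (hcons.memLp_bE i) (hcons.cont_bE i)
  obtain ⟨C₂, hC₂, h₂⟩ := exists_uniform_ae_bound (hcons.memLp_cE i) (hcons.cont_cE i)
  obtain ⟨C₃, h₃⟩ := isCompact_univ.exists_bound_of_continuousOn (hcons.cont_aE i y hy).continuousOn
  obtain ⟨K, hK⟩ := exists_discOp_bound hu hy (max (max C₁ C₂) C₃)
    (hC₁.trans ((le_max_left _ _).trans (le_max_left _ _)))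
  exact ⟨K, fun p => hK _ _ _ (hcons.memLp_bE i p) (hcons.memLp_cE i p)
    ((h₃ p (mem_univ p)).trans (le_max_right _ _))
    ((h₁ p).mono fun x hx => hx.trans ((le_max_left _ _).trans (le_max_left _ _)))
    ((h₂ p).mono fun x hx => hx.trans ((le_max_right _ _).trans (le_max_left _ _)))⟩

theorem exists_opI_bound [CompactSpace A] [CompactSpace B] (hcons : S.Consistent) {i : ℕ}
    {u : E d → ℝ} (hu : u ∈ P1Space (S.mesh i)) {y : E d} (hy : y ∈ S.internalNodes i) :
    ∃ K : ℝ, ∀ p, |S.opI i p u y| ≤ K := by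
  obtain ⟨C₁, hC₁, h₁⟩ := exists_uniform_ae_bound (hcons.memLp_bI i) (hcons.cont_bI i)
  obtain ⟨C₂, hC₂, h₂⟩ := exists_uniform_ae_bound (hcons.memLp_cI i) (hcons.cont_cI i)
  obtain ⟨C₃, h₃⟩ := isCompact_univ.exists_bound_of_continuousOn (hcons.cont_aI i y hy).continuousOn
  obtain ⟨K, hK⟩ := exists_discOp_bound hu hy (max (max C₁ C₂) C₃)
    (hC₁.trans ((le_max_left _ _).trans (le_max_left _ _)))
  exact ⟨K, fun p => hK _ _ _ (hcons.memLp_bI i p) (hcons.memLp_cI i p)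
    ((h₃ p (mem_univ p)).trans (le_max_right _ _))
    ((h₁ p).mono fun x hx => hx.trans ((le_max_left _ _).trans (le_max_left _ _)))
    ((h₂ p).mono fun x hx => hx.trans ((le_max_right _ _).trans (le_max_left _ _)))⟩

theorem exists_opF_bound [CompactSpace A] [CompactSpace B] (hcons : S.Consistent) {i : ℕ}
    {y : E d} (hy : y ∈ S.internalNodes i) : ∃ K : ℝ, ∀ p, |S.opF i p y| ≤ K := by
  obtain ⟨C, hC, h⟩ := exists_uniform_ae_bound (hcons.memLp_fD i) (hcons.cont_fD i)
  refine ⟨C, fun p => ?_⟩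
  have := (S.isMeshOf i).abs_integral_mul_hatN_sub_le hy (c := 0) (ε := C)
    (hcons.memLp_fD i p).1 ((h p).mono fun x hx _ => by simpa using hx)
  simpa [Discretisation.opF] using this

end Operators

/-! ### Infima of suprema -/

section InfSup

variable {A B : Type*}

/-- The Isaacs functional `inf_β sup_α`. -/
noncomputable def infSup (X : A × B → ℝ) : ℝ := ⨅ β : B, ⨆ α : A, X (α, β)

variable [Nonempty A] [Nonempty B]

/-- Monotonicity of `inf sup` and its compatibility with constants, in one statement. This is all
that is used about the nonlinearity, so no convexity enters. -/
theorem infSup_le_add {X Y : A × B → ℝ} {C ε : ℝ} (hX : ∀ p, |X p| ≤ C) (hY : ∀ p, |Y p| ≤ C)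
    (h : ∀ p, X p ≤ Y p + ε) : infSup X ≤ infSup Y + ε := by
  rw [← sub_le_iff_le_add]
  refine le_ciInf fun β => ?_
  rw [sub_le_iff_le_add]
  have hbdd : ∀ {Z : A × B → ℝ}, (∀ p, |Z p| ≤ C) → ∀ β, BddAbove (range fun α => Z (α, β)) := by
    rintro Z hZ β
    exact ⟨C, by rintro _ ⟨α, rfl⟩; exact (abs_le.1 (hZ _)).2⟩
  have hbelow : BddBelow (range fun β => ⨆ α, X (α, β)) := by
    refine ⟨-C, ?_⟩
    rintro _ ⟨β, rfl⟩
    obtain ⟨α⟩ := ‹Nonempty A›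
    exact (abs_le.1 (hX (α, β))).1.trans (le_ciSup (hbdd hX β) α)
  refine (ciInf_le hbelow β).trans (ciSup_le fun α => (h _).trans ?_)
  exact add_le_add_left (le_ciSup (hbdd hY β) α) ε

theorem infSup_const (c : ℝ) : infSup (fun _ : A × B => c) = c := by
  simp [infSup]

theorem abs_infSup_le {X : A × B → ℝ} {C : ℝ} (hC : 0 ≤ C) (hX : ∀ p, |X p| ≤ C) :
    |infSup X| ≤ C := by
  have h0 : ∀ p : A × B, |(fun _ : A × B => (0 : ℝ)) p| ≤ C := fun _ => by simpa using hC
  have h1 := infSup_le_add hX h0 (ε := C) fun p => by simpa using (abs_le.1 (hX p)).2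
  have h2 := infSup_le_add h0 hX (ε := C) fun p => by linarith [(abs_le.1 (hX p)).1]
  rw [infSup_const] at h1 h2
  exact abs_le.2 ⟨by linarith, by linarith⟩

end InfSup

/-! ### Monotonicity of the scheme -/

section Scheme

variable {d : ℕ} {A B : Type*} [MetricSpace A] [MetricSpace B] {Q : Problem d A B}
  {S : Discretisation Q}

theorem Discretisation.h_pos (S : Discretisation Q) (i : ℕ) : 0 < S.h i :=
  div_pos Q.T_pos (Nat.cast_pos.2 (S.N_pos i))

/-- For non-negative nodal values the off-diagonal entries only decrease the sum, and the diagonal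
entry is at most `1 / h`. Equivalently, `Id - h E` is a monotone operator. -/
theorem h_mul_opE_le (hcons : S.Consistent) (hmon : S.Monotone) {i : ℕ} (p : A × B) {w : E d → ℝ}
    (hw : w ∈ P1Space (S.mesh i)) (h0 : ∀ z ∈ (S.mesh i).vertices, 0 ≤ w z) {y : E d}
    (hy : y ∈ S.internalNodes i) : S.opE i p w y ≤ w y / S.h i := by
  classical
  rw [le_div_iff₀ (S.h_pos i), mul_comm]
  have hfin := finite_vertices (S.finite_mesh i)
  have hymem : y ∈ hfin.toFinset := hfin.mem_toFinset.2 hy.1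
  have hsum : S.opE i p w y = ∑ z ∈ hfin.toFinset, w z * S.opE i p (hat (S.mesh i) z) y :=
    discOp_eq_sum (hcons.memLp_bE i p) (hcons.memLp_cE i p) hw hy
  rw [← Finset.add_sum_erase _ _ hymem] at hsum
  have h1 : ∑ z ∈ hfin.toFinset.erase y, w z * S.opE i p (hat (S.mesh i) z) y ≤ 0 := by
    refine Finset.sum_nonpos fun z hz => ?_
    have hz' := Finset.mem_erase.1 hz
    have hzv := hfin.mem_toFinset.1 hz'.2
    exact mul_nonpos_of_nonneg_of_nonpos (h0 z hzv) (hmon.off_diag i p y hy z hzv hz'.1)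
  have h2 := hmon.diag i p y hy
  have h3 : S.opE i p w y ≤ w y * S.opE i p (hat (S.mesh i) y) y := by linarith
  calc S.h i * S.opE i p w y ≤ S.h i * (w y * S.opE i p (hat (S.mesh i) y) y) :=
        mul_le_mul_of_nonneg_left h3 (S.h_pos i).le
    _ = w y * (S.h i * S.opE i p (hat (S.mesh i) y) y) := by ring
    _ ≤ w y * 1 := mul_le_mul_of_nonneg_left (by linarith) (h0 y hy.1)
    _ = w y := mul_one _

/-- A minimum over the nodes is a minimum over the mesh for piecewise linear functions, hence a
local minimum at an internal node. -/
theorem opI_nonpos (hmon : S.Monotone) {i : ℕ} (p : A × B) {u : E d → ℝ}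
    (hu : u ∈ P1Space (S.mesh i)) {y : E d} (hy : y ∈ S.internalNodes i) (hy0 : u y ≤ 0)
    (hmin : ∀ z ∈ (S.mesh i).vertices, u y ≤ u z) : S.opI i p u y ≤ 0 := by
  refine hmon.lmp i p u hu y hy hy0 ?_
  filter_upwards [Q.isOpen_Ω.mem_nhds hy.2] with x hx
  exact P1Space.le_of_forall_vertices hu hmin ((S.isMeshOf i).subset_space hx)

/-- The discrete Hamiltonian with the explicit part evaluated at `W₁` and the implicit one
at `W₀`. -/
noncomputable def Discretisation.discHam (S : Discretisation Q) (i : ℕ) (W₁ W₀ : E d → ℝ)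
    (y : E d) (p : A × B) : ℝ :=
  S.opE i p W₁ y + S.opI i p W₀ y - S.opF i p y

variable [CompactSpace A] [CompactSpace B]

theorem exists_discHam_bound (hcons : S.Consistent) {i : ℕ} {W₁ W₀ : E d → ℝ}
    (h₁ : W₁ ∈ P1Space (S.mesh i)) (h₀ : W₀ ∈ P1Space (S.mesh i)) {y : E d}
    (hy : y ∈ S.internalNodes i) : ∃ C, ∀ p, |S.discHam i W₁ W₀ y p| ≤ C := by
  obtain ⟨K₁, hK₁⟩ := exists_opE_bound hcons h₁ hy
  obtain ⟨K₂, hK₂⟩ := exists_opI_bound hcons h₀ hy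
  obtain ⟨K₃, hK₃⟩ := exists_opF_bound hcons hy
  refine ⟨K₁ + K₂ + K₃, fun p => ?_⟩
  have h1 := abs_le.1 (hK₁ p)
  have h2 := abs_le.1 (hK₂ p)
  have h3 := abs_le.1 (hK₃ p)
  unfold Discretisation.discHam
  rw [abs_le]
  constructor <;> linarith

variable [Nonempty A] [Nonempty B] {v : ℕ → ℕ → E d → ℝ}

theorem infSup_discHam_le (hcons : S.Consistent) {i : ℕ} {W₁ W₀ V₁ V₀ : E d → ℝ}
    (hW₁ : W₁ ∈ P1Space (S.mesh i)) (hW₀ : W₀ ∈ P1Space (S.mesh i))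
    (hV₁ : V₁ ∈ P1Space (S.mesh i)) (hV₀ : V₀ ∈ P1Space (S.mesh i)) {y : E d}
    (hy : y ∈ S.internalNodes i) {ε : ℝ}
    (hle : ∀ p, S.discHam i W₁ W₀ y p ≤ S.discHam i V₁ V₀ y p + ε) :
    infSup (S.discHam i W₁ W₀ y) ≤ infSup (S.discHam i V₁ V₀ y) + ε := by
  obtain ⟨C, hC⟩ := exists_discHam_bound hcons hW₁ hW₀ hy
  obtain ⟨C', hC'⟩ := exists_discHam_bound hcons hV₁ hV₀ hy
  exact infSup_le_add (C := max C C') (fun p => (hC p).trans (le_max_left _ _))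
    (fun p => (hC' p).trans (le_max_right _ _)) hle

/-- Touching the numerical solution from above at an internal node. -/
theorem scheme_le_of_touching (hv : S.IsNumericalSolution v) (hcons : S.Consistent)
    (hmon : S.Monotone) {i k : ℕ} (hk : k < S.N i) {y : E d} (hy : y ∈ S.internalNodes i)
    {W₁ W₀ : E d → ℝ} (hW₁ : W₁ ∈ P1Space (S.mesh i)) (hW₀ : W₀ ∈ P1Space (S.mesh i))
    (h₁ : ∀ z ∈ (S.mesh i).vertices, v i (k + 1) z ≤ W₁ z) (hy0 : W₀ y ≤ v i k y)
    (h₀ : ∀ z ∈ (S.mesh i).vertices, W₀ y - v i k y ≤ W₀ z - v i k z) :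
    - ((W₁ y - v i k y) / S.h i) + infSup (S.discHam i W₁ W₀ y) ≤ 0 := by
  have hv1 := hv.mem i (k + 1) hk
  have hv0 := hv.mem i k hk.le
  have hs : - ((v i (k + 1) y - v i k y) / S.h i) +
    infSup (S.discHam i (v i (k + 1)) (v i k) y) = 0 := hv.scheme i k hk y hy
  -- This `ε` is exactly the change of the time difference quotient when `v i (k + 1)` is replaced
  -- by `W₁`, so the error of the explicit part cancels against it.
  have hle := infSup_discHam_le hcons hW₁ hW₀ hv1 hv0 hy (ε := (W₁ y - v i (k + 1) y) / S.h i)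
    fun p => by
      have h2 := h_mul_opE_le hcons hmon p (w := W₁ - v i (k + 1)) (Submodule.sub_mem _ hW₁ hv1)
        (fun z hz => by simpa using h₁ z hz) hy
      have h3 := opI_nonpos hmon p (u := W₀ - v i k) (Submodule.sub_mem _ hW₀ hv0) hy
        (by simpa using hy0) (fun z hz => by simpa using h₀ z hz)
      have h4 : S.opE i p (W₁ - v i (k + 1)) y = S.opE i p W₁ y - S.opE i p (v i (k + 1)) y :=
        discOp_sub (hcons.memLp_bE i p) (hcons.memLp_cE i p) hW₁ hv1 hy
      have h5 : S.opI i p (W₀ - v i k) y = S.opI i p W₀ y - S.opI i p (v i k) y :=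
        discOp_sub (hcons.memLp_bI i p) (hcons.memLp_cI i p) hW₀ hv0 hy
      rw [h4, Pi.sub_apply] at h2
      rw [h5] at h3
      unfold Discretisation.discHam
      linarith
  rw [sub_div] at hle hs ⊢
  linarith

/-- Touching the numerical solution from below at an internal node. -/
theorem le_scheme_of_touching (hv : S.IsNumericalSolution v) (hcons : S.Consistent)
    (hmon : S.Monotone) {i k : ℕ} (hk : k < S.N i) {y : E d} (hy : y ∈ S.internalNodes i)
    {W₁ W₀ : E d → ℝ} (hW₁ : W₁ ∈ P1Space (S.mesh i)) (hW₀ : W₀ ∈ P1Space (S.mesh i))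
    (h₁ : ∀ z ∈ (S.mesh i).vertices, W₁ z ≤ v i (k + 1) z) (hy0 : v i k y ≤ W₀ y)
    (h₀ : ∀ z ∈ (S.mesh i).vertices, v i k y - W₀ y ≤ v i k z - W₀ z) :
    0 ≤ - ((W₁ y - v i k y) / S.h i) + infSup (S.discHam i W₁ W₀ y) := by
  have hv1 := hv.mem i (k + 1) hk
  have hv0 := hv.mem i k hk.le
  have hs : - ((v i (k + 1) y - v i k y) / S.h i) +
    infSup (S.discHam i (v i (k + 1)) (v i k) y) = 0 := hv.scheme i k hk y hy
  have hle := infSup_discHam_le hcons hv1 hv0 hW₁ hW₀ hy (ε := (v i (k + 1) y - W₁ y) / S.h i)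
    fun p => by
      have h2 := h_mul_opE_le hcons hmon p (w := v i (k + 1) - W₁) (Submodule.sub_mem _ hv1 hW₁)
        (fun z hz => by simpa using h₁ z hz) hy
      have h3 := opI_nonpos hmon p (u := v i k - W₀) (Submodule.sub_mem _ hv0 hW₀) hy
        (by simpa using hy0) (fun z hz => by simpa using h₀ z hz)
      have h4 : S.opE i p (v i (k + 1) - W₁) y = S.opE i p (v i (k + 1)) y - S.opE i p W₁ y :=
        discOp_sub (hcons.memLp_bE i p) (hcons.memLp_cE i p) hv1 hW₁ hy
      have h5 : S.opI i p (v i k - W₀) y = S.opI i p (v i k) y - S.opI i p W₀ y :=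
        discOp_sub (hcons.memLp_bI i p) (hcons.memLp_cI i p) hv0 hW₀ hy
      rw [h4, Pi.sub_apply] at h2
      rw [h5] at h3
      unfold Discretisation.discHam
      linarith
  rw [sub_div] at hle hs ⊢
  linarith

end Scheme

/-! ### Consistency -/

section Consistency

variable {d : ℕ} {A B : Type*} [MetricSpace A] [MetricSpace B] {Q : Problem d A B}
  {S : Discretisation Q}

/-- The Hamiltonian of the Isaacs equation for fixed controls. -/
noncomputable def Problem.ham (Q : Problem d A B) (x : E d) (q : ℝ) (P : E d) (s : ℝ)
    (p : A × B) : ℝ :=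
  - Q.a p x * q - inner ℝ (Q.b p x) P + Q.c p x * s - Q.f p x

/-- The Hamiltonian as a function of the values of the coefficients. -/
noncomputable def symbol {d : ℕ} (z : ℝ × E d × ℝ × ℝ × ℝ × E d × ℝ) : ℝ :=
  - z.1 * z.2.2.2.2.1 - inner ℝ z.2.1 z.2.2.2.2.2.1 + z.2.2.1 * z.2.2.2.2.2.2 - z.2.2.2.1

/-- Uniform continuity on the ball of radius `R + 1`: taking `δ ≤ 1` means that only one of the two
arguments has to be bounded beforehand. -/
theorem symbol_uniform {d : ℕ} (R : ℝ) {ε : ℝ} (hε : 0 < ε) : ∃ δ > 0,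
    ∀ z z' : ℝ × E d × ℝ × ℝ × ℝ × E d × ℝ, ‖z‖ ≤ R → dist z' z ≤ δ →
      |symbol z' - symbol z| ≤ ε := by
  have hc : Continuous (symbol (d := d)) := by
    unfold symbol
    fun_prop
  have hu := (isCompact_closedBall (0 : ℝ × E d × ℝ × ℝ × ℝ × E d × ℝ)
    (R + 1)).uniformContinuousOn_of_continuous hc.continuousOn
  obtain ⟨δ, hδ, h⟩ := Metric.uniformContinuousOn_iff.1 hu ε hε
  refine ⟨min (δ / 2) 1, by positivity, fun z z' hz hzz' => ?_⟩
  have h1 : ‖z'‖ ≤ R + 1 := by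
    have h2 : ‖z'‖ ≤ ‖z‖ + dist z' z := by
      rw [dist_eq_norm]
      simpa using norm_add_le z (z' - z)
    linarith [hzz'.trans (min_le_right _ _)]
  have h3 := h z' (by simpa using h1) z (by simpa using hz.trans (by linarith))
    (lt_of_le_of_lt (hzz'.trans (min_le_left _ _)) (by linarith))
  rw [Real.dist_eq] at h3
  exact h3.le

theorem uniform_modulus [CompactSpace A] [CompactSpace B] {F : Type*} [NormedAddCommGroup F]
    {g : A × B → E d → F} {K : Set (E d)} (hK : IsCompact K)
    (hg : ContinuousOn (fun q : (A × B) × E d => g q.1 q.2) (univ ×ˢ K)) {δ : ℝ} (hδ : 0 < δ) :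
    ∃ ρ > 0, ∀ p, ∀ x ∈ K, ∀ y ∈ K, dist x y < ρ → dist (g p x) (g p y) < δ := by
  have hu := (isCompact_univ.prod hK).uniformContinuousOn_of_continuous hg
  obtain ⟨ρ, hρ, h⟩ := Metric.uniformContinuousOn_iff.1 hu δ hδ
  refine ⟨ρ, hρ, fun p x hx y hy hxy => h (p, x) ⟨mem_univ _, hx⟩ (p, y) ⟨mem_univ _, hy⟩ ?_⟩
  simpa [Prod.dist_eq] using hxy

theorem uniform_bound [CompactSpace A] [CompactSpace B] {F : Type*} [NormedAddCommGroup F]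
    {g : A × B → E d → F} {K : Set (E d)} (hK : IsCompact K)
    (hg : ContinuousOn (fun q : (A × B) × E d => g q.1 q.2) (univ ×ˢ K)) :
    ∃ C : ℝ, 0 ≤ C ∧ ∀ p, ∀ x ∈ K, ‖g p x‖ ≤ C := by
  obtain ⟨C, hC⟩ := (isCompact_univ.prod hK).exists_bound_of_continuousOn hg
  exact ⟨|C|, abs_nonneg _, fun p x hx => (hC (p, x) ⟨mem_univ _, hx⟩).trans (le_abs_self _)⟩

/-- Sets of full measure are dense in the open set `Ω`. This upgrades convergence of projections in
`L^∞` to pointwise control up to the boundary. -/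
theorem le_of_ae_le_of_continuousOn {Ω : Set (E d)} (hΩ : IsOpen Ω) {f : E d → ℝ}
    (hf : ContinuousOn f (closure Ω)) {c : ℝ} (h : ∀ᵐ x ∂(volume.restrict Ω), f x ≤ c) :
    ∀ x ∈ closure Ω, f x ≤ c := by
  have hd : Dense {x : E d | x ∈ Ω → f x ≤ c} :=
    Measure.dense_of_ae ((ae_restrict_iff' hΩ.measurableSet).1 h)
  intro x hx
  have hx' : x ∈ closure (Ω ∩ {x : E d | x ∈ Ω → f x ≤ c}) :=
    closure_minimal (hd.open_subset_closure_inter hΩ) isClosed_closure hx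
  have hne : (𝓝[Ω ∩ {x : E d | x ∈ Ω → f x ≤ c}] x).NeBot := mem_closure_iff_nhdsWithin_neBot.1 hx'
  refine le_of_tendsto (x := 𝓝[Ω ∩ {x : E d | x ∈ Ω → f x ≤ c}] x)
    ((hf x hx).mono (inter_subset_left.trans subset_closure)) ?_
  filter_upwards [self_mem_nhdsWithin] with z hz
  exact hz.2 hz.1

theorem P1Space.continuousOn_closure {i : ℕ} {u : E d → ℝ} (hu : u ∈ P1Space (S.mesh i)) :
    ContinuousOn u (closure Q.Ω) := by
  have := P1Space.continuousOn hu (S.finite_mesh i)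
  rwa [S.space_mesh] at this

theorem projection_smooth (hP : S.EllipticProjection) {w : E d → ℝ}
    (hw : ContDiff ℝ (⊤ : ℕ∞) w) {δ : ℝ} (hδ : 0 < δ) : ∀ᶠ i in atTop,
    (∀ x ∈ closure Q.Ω, |(S.P i w : E d → ℝ) x - w x| ≤ δ) ∧
    ∀ᵐ x ∂(volume.restrict Q.Ω), ‖∇ (S.P i w : E d → ℝ) x - ∇ w x‖ ≤ δ := by
  filter_upwards [(hP.convergence w hw).eventually
    (ge_mem_nhds (show (0 : ℝ≥0∞) < ENNReal.ofReal δ by simpa using hδ))] with i hi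
  constructor
  · have h1 := ae_norm_le_of_eLpNorm_top_le hδ.le (le_self_add.trans hi)
    refine le_of_ae_le_of_continuousOn Q.isOpen_Ω ?_ h1
    exact ((P1Space.continuousOn_closure (S.P i w).2).sub hw.continuous.continuousOn).abs
  · have h1 := ae_norm_le_of_eLpNorm_top_le hδ.le (le_add_self.trans hi)
    filter_upwards [h1, (S.isMeshOf i).ae_differentiableAt (S.P i w).2] with x hx hd
    have h2 : ∇ ((S.P i w : E d → ℝ) - w) x = ∇ (S.P i w : E d → ℝ) x - ∇ w x := by
      rw [gradient, fderiv_sub hd (hw.differentiable (by simp) x), map_sub]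
      rfl
    rwa [h2] at hx

theorem consistent_limit (hcons : S.Consistent) {δ : ℝ} (hδ : 0 < δ) : ∀ᶠ i in atTop, ∀ p,
    (∀ y ∈ S.internalNodes i, ∀ᵐ x ∂(volume.restrict Q.Ω), hat (S.mesh i) y x ≠ 0 →
      |Q.a p x - (S.aE i p y + S.aI i p y)| ≤ δ) ∧
    (∀ᵐ x ∂(volume.restrict Q.Ω), ‖Q.b p x - (S.bE i p x + S.bI i p x)‖ ≤ δ) ∧
    (∀ᵐ x ∂(volume.restrict Q.Ω), |Q.c p x - (S.cE i p x + S.cI i p x)| ≤ δ) ∧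
    (∀ᵐ x ∂(volume.restrict Q.Ω), |Q.f p x - S.fD i p x| ≤ δ) := by
  filter_upwards [hcons.limit.eventually
    (ge_mem_nhds (show (0 : ℝ≥0∞) < ENNReal.ofReal δ by simpa using hδ))] with i hi p
  have hp := (le_iSup _ p).trans hi
  refine ⟨fun y hy => ?_, ?_, ?_, ?_⟩
  · have h1 := ((le_iSup₂ (f := fun y (_ : y ∈ S.internalNodes i) =>
      eLpNorm (fun x => Q.a p x - (S.aE i p y + S.aI i p y)) ∞
        (volume.restrict (Q.Ω ∩ tsupport (hat (S.mesh i) y)))) y hy).trans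
      (le_self_add.trans (le_self_add.trans le_self_add))).trans hp
    have h2 := ae_norm_le_of_eLpNorm_top_le hδ.le h1
    rw [ae_restrict_iff' (Q.isOpen_Ω.measurableSet.inter
      (isClosed_tsupport _).measurableSet)] at h2
    rw [ae_restrict_iff' Q.isOpen_Ω.measurableSet]
    filter_upwards [h2] with x hx hxΩ hne
    -- The frozen value at `y` is close to `a` only on the star of the node, which suffices as every
    -- average is weighted by the hat function.
    exact hx ⟨hxΩ, subset_tsupport _ hne⟩
  · exact ae_norm_le_of_eLpNorm_top_le hδ.le
      ((le_add_self.trans (le_self_add.trans le_self_add)).trans hp)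
  · exact ae_norm_le_of_eLpNorm_top_le hδ.le ((le_add_self.trans le_self_add).trans hp)
  · exact ae_norm_le_of_eLpNorm_top_le hδ.le (le_add_self.trans hp)

/-- The discrete Hamiltonian of a projection plus constants as an average. -/
theorem discHam_eq_integral (hP : S.EllipticProjection) (hcons : S.Consistent) {w : E d → ℝ}
    (hw : ContDiff ℝ (⊤ : ℕ∞) w) {i : ℕ} {y : E d} (hy : y ∈ S.internalNodes i) (p : A × B)
    (m₁ m₂ : ℝ) :
    S.discHam i (fun x => (S.P i w : E d → ℝ) x + m₁) (fun x => (S.P i w : E d → ℝ) x + m₂) y p =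
      ∫ x in Q.Ω, (symbol (S.aE i p y + S.aI i p y, S.bE i p x + S.bI i p x,
        S.cE i p x + S.cI i p x, S.fD i p x, Laplacian.laplacian w x,
        ∇ (S.P i w : E d → ℝ) x, (S.P i w : E d → ℝ) x + m₂) + S.cE i p x * (m₁ - m₂)) *
        hatN Q.Ω (S.mesh i) y x := by
  have hw2 := contDiff_two_of_smooth hw
  set W : E d → ℝ := (S.P i w : E d → ℝ) with hW
  set φ := hatN Q.Ω (S.mesh i) y with hφ
  have hm := S.isMeshOf i
  -- The central point of consistency: the gradient of the projection may be replaced by that of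
  -- `w`, and the derivative on the hat function then moved onto `w`. The Laplacian of `w` appears
  -- although `P w` has no useful second derivatives.
  have horth := hP.orthogonality i w (∇ w) (hm.memLp_of_continuous hw2.continuous 2)
    (hm.memLp_of_continuous (continuous_gradient hw2) 2) (hasWeakGradient_of_contDiff hw2) y hy
  rw [hm.integral_gradient_hatN hy hw2] at horth
  have hE : S.opE i p (fun x => W x + m₁) y = S.opE i p W y + ∫ x in Q.Ω, (S.cE i p x * m₁) * φ x := by
    rw [hφ, ← discOp_const (S := S) (i := i) (a := S.aE i p) (b := S.bE i p) (c := S.cE i p) m₁]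
    exact discOp_add (hcons.memLp_bE i p) (hcons.memLp_cE i p) (S.P i w).2
      (const_mem_P1Space m₁) hy
  have hI : S.opI i p (fun x => W x + m₂) y = S.opI i p W y + ∫ x in Q.Ω, (S.cI i p x * m₂) * φ x := by
    rw [hφ, ← discOp_const (S := S) (i := i) (a := S.aI i p) (b := S.bI i p) (c := S.cI i p) m₂]
    exact discOp_add (hcons.memLp_bI i p) (hcons.memLp_cI i p) (S.P i w).2
      (const_mem_P1Space m₂) hy
  have hφi := hm.integrable_hatN hy
  have hmul : ∀ {c : E d → ℝ}, MemLp c ∞ (volume.restrict Q.Ω) →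
      Integrable (fun x => c x * φ x) (volume.restrict Q.Ω) := by
    intro c hc
    obtain ⟨C, _, hC⟩ := exists_ae_norm_le_of_memLp_top hc
    exact hφi.bdd_mul hc.1 hC
  have i1 : Integrable (fun x => (S.aE i p y + S.aI i p y) * (-Laplacian.laplacian w x * φ x))
      (volume.restrict Q.Ω) :=
    (hmul (hm.memLp_of_continuous (continuous_laplacian hw2).neg ∞)).const_mul _
  have i2 := integrable_lowerOrder (hcons.memLp_bE i p) (hcons.memLp_cE i p) (S.P i w).2 hy
  have i3 := integrable_lowerOrder (hcons.memLp_bI i p) (hcons.memLp_cI i p) (S.P i w).2 hy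
  have i4 : Integrable (fun x => (S.cE i p x * m₁) * φ x) (volume.restrict Q.Ω) :=
    hmul ((hcons.memLp_cE i p).mul_const m₁)
  have i5 : Integrable (fun x => (S.cI i p x * m₂) * φ x) (volume.restrict Q.Ω) :=
    hmul ((hcons.memLp_cI i p).mul_const m₂)
  have i6 := hmul (hcons.memLp_fD i p)
  unfold Discretisation.discHam
  rw [hE, hI]
  unfold Discretisation.opE Discretisation.opI Discretisation.discOp Discretisation.opF
  rw [← hφ, ← hW] at horth
  rw [← hφ, horth]
  have hsplit : ∀ x, (symbol (S.aE i p y + S.aI i p y, S.bE i p x + S.bI i p x,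
        S.cE i p x + S.cI i p x, S.fD i p x, Laplacian.laplacian w x,
        ∇ W x, W x + m₂) + S.cE i p x * (m₁ - m₂)) * φ x =
      (S.aE i p y + S.aI i p y) * (-Laplacian.laplacian w x * φ x) +
      (- inner ℝ (S.bE i p x) (∇ W x) + S.cE i p x * W x) * φ x +
      (- inner ℝ (S.bI i p x) (∇ W x) + S.cI i p x * W x) * φ x +
      (S.cE i p x * m₁) * φ x + (S.cI i p x * m₂) * φ x - S.fD i p x * φ x := by
    intro x
    simp only [symbol, inner_add_left]
    ring
  simp_rw [hsplit]
  set f₂ : E d → ℝ := fun x =>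
    (- inner ℝ (S.bE i p x) (∇ W x) + S.cE i p x * W x) * φ x with hf₂
  set f₃ : E d → ℝ := fun x =>
    (- inner ℝ (S.bI i p x) (∇ W x) + S.cI i p x * W x) * φ x with hf₃
  have a2 : Integrable (fun x => (S.aE i p y + S.aI i p y) * (-Laplacian.laplacian w x * φ x) +
    f₂ x) (volume.restrict Q.Ω) := i1.add i2
  have a3 : Integrable (fun x => (S.aE i p y + S.aI i p y) * (-Laplacian.laplacian w x * φ x) +
    f₂ x + f₃ x) (volume.restrict Q.Ω) := a2.add i3
  have a4 : Integrable (fun x => (S.aE i p y + S.aI i p y) * (-Laplacian.laplacian w x * φ x) +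
    f₂ x + f₃ x + (S.cE i p x * m₁) * φ x) (volume.restrict Q.Ω) := a3.add i4
  have a5 : Integrable (fun x => (S.aE i p y + S.aI i p y) * (-Laplacian.laplacian w x * φ x) +
    f₂ x + f₃ x + (S.cE i p x * m₁) * φ x + (S.cI i p x * m₂) * φ x) (volume.restrict Q.Ω) :=
    a4.add i5
  rw [integral_sub a5 i6, integral_add a4 i5, integral_add a3 i4, integral_add a2 i3,
    integral_add i1 i2, integral_const_mul]
  ring

/-- The discrete Hamiltonian is an average of `symbol` over the star of `y`, where all arguments are
uniformly close to their limits at `y`. Different shifts in the explicit and the implicit part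
matter only through the explicit reaction term, which gives `γ |m₁ - m₂|` with `γ` independent of
`w`. -/
theorem consistency [CompactSpace A] [CompactSpace B] (hP : S.EllipticProjection)
    (hcons : S.Consistent) : ∃ γ : ℝ, 0 ≤ γ ∧ ∀ w : E d → ℝ, ContDiff ℝ (⊤ : ℕ∞) w → ∀ C : ℝ,
    ∀ ε > 0, ∀ᶠ i in atTop, ∀ p, ∀ y ∈ S.internalNodes i, ∀ m₁ m₂ : ℝ, |m₂| ≤ C →
      |S.discHam i (fun x => (S.P i w : E d → ℝ) x + m₁) (fun x => (S.P i w : E d → ℝ) x + m₂) y p -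
        Q.ham y (Laplacian.laplacian w y) (∇ w y) ((S.P i w : E d → ℝ) y + m₂) p| ≤
        ε + γ * |m₁ - m₂| := by
  obtain ⟨γ, hγ⟩ := hcons.bound_c
  refine ⟨max γ 0, le_max_right _ _, fun w hw C ε hε => ?_⟩
  have hw2 := contDiff_two_of_smooth hw
  have hcK := Q.isCompact_closure
  have cst : ∀ {F : Type} [NormedAddCommGroup F] {g : E d → F}, Continuous g →
      ContinuousOn (fun q : (A × B) × E d => (fun (_ : A × B) x => g x) q.1 q.2)
        (univ ×ˢ closure Q.Ω) := fun hg => (hg.comp continuous_snd).continuousOn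
  have cΔ := cst (continuous_laplacian hw2)
  have cg := cst (continuous_gradient hw2)
  have cw := cst hw2.continuous
  obtain ⟨Ca, ha0, ha⟩ := uniform_bound hcK Q.cont_a
  obtain ⟨Cb, hb0, hb⟩ := uniform_bound hcK Q.cont_b
  obtain ⟨Cc, hc0, hc⟩ := uniform_bound hcK Q.cont_c
  obtain ⟨Cf, hf0, hf⟩ := uniform_bound hcK Q.cont_f
  obtain ⟨CΔ, hΔ0, hΔ⟩ := uniform_bound (g := fun _ => Laplacian.laplacian w) hcK cΔ
  obtain ⟨Cg, hg0, hg⟩ := uniform_bound (g := fun _ => ∇ w) hcK cg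
  obtain ⟨Cw, hw0, hwb⟩ := uniform_bound (g := fun _ => w) hcK cw
  -- A bound for all arguments of `symbol` at the node; the summand one allows for the error of the
  -- projection.
  set R := Ca + Cb + Cc + Cf + CΔ + Cg + (Cw + 1 + |C|) with hR
  have hC0 := abs_nonneg C
  obtain ⟨δ, hδ, hsym⟩ := symbol_uniform (d := d) R hε
  have hδ3 : 0 < min (δ / 3) 1 := by positivity
  -- One third, because the last argument collects three errors: the projection at `x`, the
  -- projection at `y` and the oscillation of `w`.
  set η := min (δ / 3) 1 with hη
  have hηδ : 3 * η ≤ δ := by linarith [min_le_left (δ / 3) 1]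
  have hη1 : η ≤ 1 := min_le_right _ _
  obtain ⟨ρa, ρa0, ma⟩ := uniform_modulus hcK Q.cont_a hδ3
  obtain ⟨ρb, ρb0, mb⟩ := uniform_modulus hcK Q.cont_b hδ3
  obtain ⟨ρc, ρc0, mc⟩ := uniform_modulus hcK Q.cont_c hδ3
  obtain ⟨ρf, ρf0, mf⟩ := uniform_modulus hcK Q.cont_f hδ3
  obtain ⟨ρΔ, ρΔ0, mΔ⟩ := uniform_modulus (g := fun _ => Laplacian.laplacian w) hcK cΔ hδ3
  obtain ⟨ρg, ρg0, mg⟩ := uniform_modulus (g := fun _ => ∇ w) hcK cg hδ3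
  obtain ⟨ρw, ρw0, mw⟩ := uniform_modulus (g := fun _ => w) hcK cw hδ3
  have hρ : ∀ {ρ : ℝ}, 0 < ρ → ∀ᶠ i in atTop, meshSize (S.mesh i) < ρ := fun h =>
    S.meshSize_tendsto.eventually (gt_mem_nhds h)
  filter_upwards [consistent_limit hcons hδ3, projection_smooth hP hw hδ3, hρ ρa0, hρ ρb0, hρ ρc0,
    hρ ρf0, hρ ρΔ0, hρ ρg0, hρ ρw0] with i hlim hproj sa sb sc sf sΔ sg sw p y hy m₁ m₂ hm₂
  obtain ⟨la, lb, lc, lf⟩ := hlim p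
  have hym : y ∈ closure Q.Ω := subset_closure hy.2
  have hcE : ∀ᵐ x ∂(volume.restrict Q.Ω), ‖S.cE i p x‖ ≤ max γ 0 := by
    refine ae_norm_le_of_eLpNorm_top_le (le_max_right _ _) ((le_self_add.trans (hγ i p)).trans ?_)
    exact ENNReal.ofReal_le_ofReal (le_max_left _ _)
  set W : E d → ℝ := (S.P i w : E d → ℝ) with hW
  rw [discHam_eq_integral hP hcons hw hy]
  have htarget : Q.ham y (Laplacian.laplacian w y) (∇ w y) (W y + m₂) p =
      symbol (Q.a p y, Q.b p y, Q.c p y, Q.f p y, Laplacian.laplacian w y, ∇ w y, W y + m₂) := rfl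
  rw [htarget]
  refine (S.isMeshOf i).abs_integral_mul_hatN_sub_le hy ?_ ?_
  · refine AEStronglyMeasurable.add ?_ ((hcons.memLp_cE i p).1.mul_const _)
    unfold symbol
    have e1 : AEStronglyMeasurable (fun x => S.bE i p x + S.bI i p x) (volume.restrict Q.Ω) :=
      (hcons.memLp_bE i p).1.add (hcons.memLp_bI i p).1
    have e2 : AEStronglyMeasurable (fun x => S.cE i p x + S.cI i p x) (volume.restrict Q.Ω) :=
      (hcons.memLp_cE i p).1.add (hcons.memLp_cI i p).1
    have e3 : AEStronglyMeasurable (fun x => W x + m₂) (volume.restrict Q.Ω) :=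
      (P1Space.aestronglyMeasurable (S.P i w).2).add aestronglyMeasurable_const
    have e4 : AEStronglyMeasurable (fun x => ∇ W x) (volume.restrict Q.Ω) :=
      (measurable_gradient W).aestronglyMeasurable
    have e5 : AEStronglyMeasurable (fun x => Laplacian.laplacian w x) (volume.restrict Q.Ω) :=
      (continuous_laplacian hw2).aestronglyMeasurable
    exact (((e5.const_mul (-(S.aE i p y + S.aI i p y))).sub (e1.inner e4)).add (e2.mul e3)).sub (hcons.memLp_fD i p).1
  · filter_upwards [la y hy, lb, lc, lf, hproj.2, hcE, Q.ae_mem] with x xa xb xc xf xg xcE hx hne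
    have hxm : x ∈ closure Q.Ω := subset_closure hx
    have hd := dist_le_meshSize_of_hat_ne_zero (S.finite_mesh i) hne
    have da := ma p x hxm y hym (hd.trans_lt sa)
    have db := mb p x hxm y hym (hd.trans_lt sb)
    have dc := mc p x hxm y hym (hd.trans_lt sc)
    have df := mf p x hxm y hym (hd.trans_lt sf)
    have dΔ := mΔ p x hxm y hym (hd.trans_lt sΔ)
    have dg := mg p x hxm y hym (hd.trans_lt sg)
    have dw := mw p x hxm y hym (hd.trans_lt sw)
    have pw := hproj.1 x hxm
    have pw' := hproj.1 y hym
    rw [add_sub_right_comm]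
    refine (abs_add_le _ _).trans (add_le_add ?_ ?_)
    · refine hsym _ _ ?_ ?_
      · have n1 := ha p y hym
        have n2 := hb p y hym
        have n3 := hc p y hym
        have n4 := hf p y hym
        have n5 := hΔ p y hym
        have n6 := hg p y hym
        have n7 := hwb p y hym
        have n8 : ‖W y + m₂‖ ≤ Cw + 1 + |C| := by
          have h1 : W y + m₂ = w y + (W y - w y) + m₂ := by ring
          rw [h1]
          refine (norm_add_le _ _).trans (add_le_add ((norm_add_le _ _).trans
            (add_le_add n7 (pw'.trans hη1))) (hm₂.trans (le_abs_self C)))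
        simp only [Prod.norm_def, max_le_iff]
        refine ⟨?_, ?_, ?_, ?_, ?_, ?_, ?_⟩ <;> linarith
      · have tri : ∀ {F : Type} [NormedAddCommGroup F] (u u' u'' : F), ‖u' - u‖ ≤ η →
            dist u' u'' < η → dist u u'' ≤ δ := by
          intro F _ u u' u'' h1 h2
          have h3 : dist u u' ≤ η := by rwa [dist_comm, dist_eq_norm]
          linarith [dist_triangle u u' u'']
        simp only [Prod.dist_eq, max_le_iff]
        refine ⟨tri _ _ _ (xa hne) da, tri _ _ _ xb db, tri _ _ _ xc dc, tri _ _ _ xf df, by linarith,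
          tri _ _ _ (by rwa [norm_sub_rev]) dg, ?_⟩
        rw [Real.dist_eq] at dw ⊢
        have h1 := abs_le.1 pw
        have h2 := abs_le.1 pw'
        have h3 := abs_lt.1 dw
        rw [abs_le]
        constructor <;> linarith
    · rw [abs_mul]
      exact mul_le_mul_of_nonneg_right xcE (abs_nonneg _)

end Consistency

/-! ### Envelopes of node functions -/

section Envelope

variable {d : ℕ} {A B : Type*} [MetricSpace A] [MetricSpace B] {Q : Problem d A B}
  {S : Discretisation Q}

theorem time_N (S : Discretisation Q) (i : ℕ) : S.time i (S.N i) = Q.T := by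
  have : (S.N i : ℝ) ≠ 0 := Nat.cast_ne_zero.2 (S.N_pos i).ne'
  unfold Discretisation.time Discretisation.h
  field_simp

theorem time_succ (S : Discretisation Q) (i k : ℕ) : S.time i (k + 1) = S.time i k + S.h i := by
  unfold Discretisation.time
  push_cast
  ring

theorem time_mono (S : Discretisation Q) (i : ℕ) : StrictMono (S.time i) := by
  intro k l hkl
  exact mul_lt_mul_of_pos_right (Nat.cast_lt.2 hkl) (S.h_pos i)

theorem time_mem_Icc (S : Discretisation Q) {i k : ℕ} (hk : k ≤ S.N i) :
    S.time i k ∈ Icc 0 Q.T := by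
  refine ⟨mul_nonneg (Nat.cast_nonneg _) (S.h_pos i).le, ?_⟩
  rw [← time_N S i]
  exact (time_mono S i).monotone hk

theorem h_tendsto (S : Discretisation Q) : Tendsto S.h atTop (𝓝 0) :=
  tendsto_const_nhds.div_atTop (tendsto_natCast_atTop_atTop.comp S.N_tendsto)

theorem vertices_subset_closure {i : ℕ} {y : E d} (hy : y ∈ (S.mesh i).vertices) :
    y ∈ closure Q.Ω := by
  rw [← S.space_mesh i]
  exact Geometry.SimplicialComplex.vertices_subset_space hy

theorem node_mem_cyl {i k : ℕ} (hk : k ≤ S.N i) {y : E d} (hy : y ∈ (S.mesh i).vertices) :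
    (S.time i k, y) ∈ Q.cyl :=
  ⟨time_mem_Icc S hk, vertices_subset_closure hy⟩

theorem isCompact_cyl (Q : Problem d A B) : IsCompact Q.cyl :=
  isCompact_Icc.prod Q.isCompact_closure

/-- One neighbourhood serves all sufficiently fine levels. This uniformity underlies semicontinuity
of the limits and the compactness arguments. -/
theorem eventually_nodeFilter {z : ℝ × E d} {R : ℕ × ℕ × E d → Prop} :
    (∀ᶠ q in S.nodeFilter z, R q) ↔ ∃ U ∈ 𝓝 z, ∀ᶠ i in atTop, ∀ k ≤ S.N i,
      ∀ y ∈ (S.mesh i).vertices, (S.time i k, y) ∈ U → R (i, k, y) := by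
  constructor
  · intro h
    obtain ⟨V, hV, hVR⟩ := mem_inf_principal.1 h |> mem_inf_iff_superset.1
    obtain ⟨W, hW, hVW⟩ := hVR
    obtain ⟨I, hI, hIV⟩ := mem_comap.1 hV
    obtain ⟨U, hU, hUW⟩ := mem_comap.1 hW
    refine ⟨U, hU, ?_⟩
    filter_upwards [hI] with i hi k hk y hy hyU
    exact hVW ⟨hIV hi, hUW hyU⟩ ⟨hk, hy⟩
  · rintro ⟨U, hU, h⟩
    refine mem_inf_principal.2 (mem_inf_iff_superset.2 ⟨_, preimage_mem_comap h, _,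
      preimage_mem_comap hU, ?_⟩)
    rintro ⟨i, k, y⟩ ⟨h1, h2⟩ ⟨h3, h4⟩
    exact h1 k h3 y h4 h2

theorem exists_vertex_near {i : ℕ} {x : E d} (hx : x ∈ closure Q.Ω) :
    ∃ y ∈ (S.mesh i).vertices, dist y x ≤ meshSize (S.mesh i) := by
  rw [← S.space_mesh i] at hx
  obtain ⟨s, hs, hxs⟩ := Geometry.SimplicialComplex.mem_space_iff.1 hx
  obtain ⟨y, hy⟩ := Geometry.SimplicialComplex.nonempty_of_mem_faces hs
  exact ⟨y, mem_vertices_of_mem hs hy,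
    le_meshSize (S.finite_mesh i) hs (subset_convexHull ℝ _ hy) hxs⟩

theorem exists_time_between (S : Discretisation Q) (i : ℕ) {t : ℝ} (ht : t ∈ Icc 0 Q.T) :
    ∃ k < S.N i, t ∈ Icc (S.time i k) (S.time i (k + 1)) := by
  have hh := S.h_pos i
  by_cases hT : t < Q.T
  · refine ⟨⌊t / S.h i⌋₊, ?_, ?_, ?_⟩
    · rw [Nat.floor_lt (div_nonneg ht.1 hh.le), div_lt_iff₀ hh]
      have := time_N S i
      unfold Discretisation.time at this
      rwa [this]
    · unfold Discretisation.time
      rw [← le_div_iff₀ hh]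
      exact Nat.floor_le (div_nonneg ht.1 hh.le)
    · unfold Discretisation.time
      rw [← div_le_iff₀ hh]
      push_cast
      exact (Nat.lt_floor_add_one _).le
  -- At the final time the floor would give the index `N`, which has no successor step, so the last
  -- interval is used instead.
  · have hN := S.N_pos i
    have hteq : t = Q.T := le_antisymm ht.2 (not_lt.1 hT)
    refine ⟨S.N i - 1, Nat.sub_lt hN one_pos, ?_, ?_⟩
    · rw [hteq, ← time_N S i]
      exact (time_mono S i).monotone (Nat.sub_le _ _)
    · rw [Nat.sub_add_cancel (Nat.one_le_iff_ne_zero.2 hN.ne'), time_N, hteq]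

/-- Mesh and time step sizes tend to zero, so every point of the cylinder is approached by nodes.
Without this the two limits could not be ordered. -/
theorem nodeFilter_neBot {z : ℝ × E d} (hz : z ∈ Q.cyl) : (S.nodeFilter z).NeBot := by
  rw [← Filter.eventually_false_iff_eq_bot.not.trans Filter.neBot_iff.symm]
  intro h
  obtain ⟨U, hU, hev⟩ := eventually_nodeFilter.1 h
  obtain ⟨ε, hε, hball⟩ := Metric.mem_nhds_iff.1 hU
  obtain ⟨i, h1, h2, h3⟩ := (hev.and ((S.meshSize_tendsto.eventually (gt_mem_nhds hε)).and
    ((h_tendsto S).eventually (gt_mem_nhds hε)))).exists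
  obtain ⟨y, hy, hyx⟩ := exists_vertex_near (S := S) (i := i) hz.2
  obtain ⟨k, hk, hkt⟩ := exists_time_between S i hz.1
  refine h1 k hk.le y hy (hball ?_)
  rw [Metric.mem_ball, Prod.dist_eq, max_lt_iff]
  refine ⟨?_, hyx.trans_lt h2⟩
  rw [time_succ] at hkt
  simp only [Real.dist_eq]
  rw [abs_lt]
  constructor <;> linarith [hkt.1, hkt.2]

/-- `u` is the upper limit of the node functions `v` on the space-time cylinder. -/
structure IsUpperLimit (S : Discretisation Q) (v : ℕ → ℕ → E d → ℝ) (u : ℝ × E d → ℝ) : Prop where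
  eventually_lt : ∀ z ∈ Q.cyl, ∀ c, u z < c → ∀ᶠ q in S.nodeFilter z, v q.1 q.2.1 q.2.2 < c
  frequently_lt : ∀ z ∈ Q.cyl, ∀ c < u z, ∃ᶠ q in S.nodeFilter z, c < v q.1 q.2.1 q.2.2

/-- Bounds of the node functions on all sufficiently fine levels. -/
def EventuallyBounded (S : Discretisation Q) (v : ℕ → ℕ → E d → ℝ) (C : ℝ) : Prop :=
  ∀ᶠ i in atTop, ∀ k ≤ S.N i, ∀ y ∈ (S.mesh i).vertices, |v i k y| ≤ C

variable {v : ℕ → ℕ → E d → ℝ} {u : ℝ × E d → ℝ}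

theorem IsUpperLimit.le_of_eventually (hu : IsUpperLimit S v u) {z : ℝ × E d} (hz : z ∈ Q.cyl)
    {c : ℝ} (h : ∀ᶠ q in S.nodeFilter z, v q.1 q.2.1 q.2.2 ≤ c) : u z ≤ c := by
  by_contra hlt
  exact hu.frequently_lt z hz c (not_le.1 hlt) (h.mono fun q hq => not_lt.2 hq)

theorem EventuallyBounded.nodeFilter {C : ℝ} (h : EventuallyBounded S v C) (z : ℝ × E d) :
    ∀ᶠ q in S.nodeFilter z, |v q.1 q.2.1 q.2.2| ≤ C :=
  eventually_nodeFilter.2 ⟨univ, univ_mem, h.mono fun _ hi k hk y hy _ => hi k hk y hy⟩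

theorem IsUpperLimit.abs_le (hu : IsUpperLimit S v u) {C : ℝ} (h : EventuallyBounded S v C)
    {z : ℝ × E d} (hz : z ∈ Q.cyl) : |u z| ≤ C := by
  rw [_root_.abs_le]
  constructor
  · by_contra hlt
    have h1 := hu.eventually_lt z hz _ (not_le.1 hlt)
    have := nodeFilter_neBot (S := S) hz
    obtain ⟨q, hq1, hq2⟩ := (h1.and (h.nodeFilter z)).exists
    linarith [(_root_.abs_le.1 hq2).1]
  · exact hu.le_of_eventually hz ((h.nodeFilter z).mono fun q hq => (_root_.abs_le.1 hq).2)

/-- Stability keeps the envelope away from `±∞`, so passing to real values loses nothing. -/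
theorem coe_toReal_upperEnvelope {C : ℝ} (h : EventuallyBounded S v C) {z : ℝ × E d}
    (hz : z ∈ Q.cyl) : ((S.upperEnvelope v z).toReal : EReal) = S.upperEnvelope v z := by
  have := nodeFilter_neBot (S := S) hz
  refine EReal.coe_toReal ?_ ?_
  · refine ne_top_of_le_ne_top (EReal.coe_ne_top C) ?_
    refine limsup_le_of_le ?_ ((h.nodeFilter z).mono fun q hq => ?_)
    · isBoundedDefault
    · exact EReal.coe_le_coe (_root_.abs_le.1 hq).2
  · refine ne_bot_of_le_ne_bot (EReal.coe_ne_bot (-C)) ?_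
    refine le_limsup_of_frequently_le ((h.nodeFilter z).mono fun q hq => ?_).frequently ?_
    · exact EReal.coe_le_coe (_root_.abs_le.1 hq).1
    · isBoundedDefault

theorem isUpperLimit_upperEnvelope {C : ℝ} (h : EventuallyBounded S v C) :
    IsUpperLimit S v fun z => (S.upperEnvelope v z).toReal where
  eventually_lt z hz c hc := by
    have h1 : S.upperEnvelope v z < (c : EReal) := by
      rw [← coe_toReal_upperEnvelope h hz]
      exact EReal.coe_lt_coe hc
    exact (eventually_lt_of_limsup_lt h1).mono fun q hq => EReal.coe_lt_coe_iff.1 hq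
  frequently_lt z hz c hc := by
    have h1 : (c : EReal) < S.upperEnvelope v z := by
      rw [← coe_toReal_upperEnvelope h hz]
      exact EReal.coe_lt_coe hc
    exact (frequently_lt_of_lt_limsup (by isBoundedDefault) h1).mono
      fun q hq => EReal.coe_lt_coe_iff.1 hq

/-- Allows the theory to be developed for upper limits only. -/
theorem lowerEnvelope_eq_neg (S : Discretisation Q) (v : ℕ → ℕ → E d → ℝ) (z : ℝ × E d) :
    S.lowerEnvelope v z = - S.upperEnvelope (fun i k y => - v i k y) z := by
  have := EReal.limsup_neg (f := S.nodeFilter z)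
    (v := fun q : ℕ × ℕ × E d => (v q.1 q.2.1 q.2.2 : EReal))
  unfold Discretisation.lowerEnvelope Discretisation.upperEnvelope
  have h2 : (fun q : ℕ × ℕ × E d => ((- v q.1 q.2.1 q.2.2 : ℝ) : EReal)) =
      - fun q : ℕ × ℕ × E d => (v q.1 q.2.1 q.2.2 : EReal) := by
    funext q
    simp
  rw [h2, this, neg_neg]

theorem EventuallyBounded.neg {C : ℝ} (h : EventuallyBounded S v C) :
    EventuallyBounded S (fun i k y => - v i k y) C :=
  h.mono fun i hi k hk y hy => by simpa using hi k hk y hy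

/-- Upper limits are upper semicontinuous. -/
theorem IsUpperLimit.upperSemicontinuous (hu : IsUpperLimit S v u) {z : ℝ × E d} (hz : z ∈ Q.cyl)
    {c : ℝ} (hc : u z < c) : ∀ᶠ z' in 𝓝[Q.cyl] z, u z' < c := by
  obtain ⟨c', hc1, hc2⟩ := exists_between hc
  obtain ⟨U, hU, hev⟩ := eventually_nodeFilter.1 (hu.eventually_lt z hz c' hc1)
  have hU' := eventually_mem_nhds_iff.2 hU
  filter_upwards [mem_nhdsWithin_of_mem_nhds hU', self_mem_nhdsWithin] with z' hz' hzc
  refine (hu.le_of_eventually hzc ?_).trans_lt hc2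
  refine eventually_nodeFilter.2 ⟨U, hz', hev.mono fun i hi k hk y hy hyU => ?_⟩
  exact (hi k hk y hy hyU).le

/-- Continuous functions above the upper limit are asymptotically above the node functions,
uniformly. -/
theorem IsUpperLimit.eventually_le (hu : IsUpperLimit S v u) {φ : ℝ × E d → ℝ}
    (hφ : ContinuousOn φ Q.cyl) (hle : ∀ z ∈ Q.cyl, u z ≤ φ z) {ε : ℝ} (hε : 0 < ε) :
    ∀ᶠ i in atTop, ∀ k ≤ S.N i, ∀ y ∈ (S.mesh i).vertices,
      v i k y ≤ φ (S.time i k, y) + ε := by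
  have key : ∀ᶠ i in atTop, ∀ k ≤ S.N i, ∀ y ∈ (S.mesh i).vertices, (S.time i k, y) ∈ Q.cyl →
      v i k y ≤ φ (S.time i k, y) + ε := by
    -- The property is stable under finite unions and holds near each point, by the definition of
    -- the upper limit and continuity of `φ`.
    refine (isCompact_cyl Q).induction_on (p := fun s => ∀ᶠ i in atTop, ∀ k ≤ S.N i,
      ∀ y ∈ (S.mesh i).vertices, (S.time i k, y) ∈ s → v i k y ≤ φ (S.time i k, y) + ε) ?_ ?_ ?_ ?_
    · exact Eventually.of_forall fun i k _ y _ h => absurd h (notMem_empty _)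
    · exact fun s t hst ht => ht.mono fun i hi k hk y hy h => hi k hk y hy (hst h)
    · intro s t hs ht
      filter_upwards [hs, ht] with i h1 h2 k hk y hy h
      exact h.elim (h1 k hk y hy) (h2 k hk y hy)
    · intro z hz
      obtain ⟨U, hU, hev⟩ := eventually_nodeFilter.1
        (hu.eventually_lt z hz (φ z + ε / 2) (by linarith [hle z hz]))
      have h1 : ∀ᶠ z' in 𝓝[Q.cyl] z, φ z - ε / 2 < φ z' :=
        (hφ z hz).eventually (lt_mem_nhds (by linarith))
      refine ⟨_, inter_mem h1 (mem_nhdsWithin_of_mem_nhds hU), hev.mono fun i hi k hk y hy h => ?_⟩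
      have h2 := hi k hk y hy h.2
      have h3 : φ z - ε / 2 < φ (S.time i k, y) := h.1
      simp only at h2
      linarith
  exact key.mono fun i hi k hk y hy => hi k hk y hy (node_mem_cyl hk hy)

/-- Maximisers of the node functions minus a test function near a strict maximum point. -/
theorem IsUpperLimit.exists_maximiser (hu : IsUpperLimit S v u) {z₀ : ℝ × E d} (hz₀ : z₀ ∈ Q.cyl)
    {ψ ρ : ℝ × E d → ℝ} (hψ : Continuous ψ) (hρ : Continuous ρ)
    (hρ0 : ∀ z, 0 ≤ ρ z)
    (hmax : ∀ z ∈ Q.cyl, u z - ψ z + ρ z ≤ u z₀ - ψ z₀)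
    (hstrict : ∀ ε > 0, ∃ κ > 0, ∀ z, ρ z < κ → dist z z₀ < ε)
    {Ψ : ℕ → ℕ → E d → ℝ} (hΨ : ∀ ε > 0, ∀ᶠ i in atTop, ∀ k ≤ S.N i, ∀ y ∈ (S.mesh i).vertices,
      |Ψ i k y - ψ (S.time i k, y)| ≤ ε) {ε : ℝ} (hε : 0 < ε) :
    ∃ᶠ i in atTop, ∃ k ≤ S.N i, ∃ y ∈ (S.mesh i).vertices, dist (S.time i k, y) z₀ < ε ∧
      |v i k y - u z₀| < ε ∧ ∀ k' ≤ S.N i, ∀ y' ∈ (S.mesh i).vertices,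
        v i k' y' - Ψ i k' y' ≤ v i k y - Ψ i k y := by
  obtain ⟨ε', hε', hψ'⟩ := Metric.continuousAt_iff.1 (hψ.continuousAt (x := z₀)) (ε / 2)
    (by positivity)
  obtain ⟨κ, hκ, hκ'⟩ := hstrict (min ε ε') (by positivity)
  -- With `M = u z₀ - ψ z₀`, the maximiser satisfies `v - ψ > M - 4η`, losing `2η` for the
  -- competitor near `z₀` and `2η` for two replacements of `ψ` by `Ψ`. The uniform upper bound gives
  -- `v - ψ ≤ M - ρ + η`. Hence `ρ < 5η < κ`, which forces the maximiser close to `z₀`.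
  set η := min (κ / 6) (ε / 12) with hη
  have hη0 : 0 < η := by positivity
  have hη1 : 6 * η ≤ κ := by linarith [min_le_left (κ / 6) (ε / 12)]
  have hη2 : 12 * η ≤ ε := by linarith [min_le_right (κ / 6) (ε / 12)]
  have hup := hu.eventually_le (φ := fun z => ψ z + (u z₀ - ψ z₀) - ρ z)
    (by fun_prop) (fun z hz => by linarith [hmax z hz]) hη0
  have hψη : ∀ᶠ z in 𝓝 z₀, |ψ z - ψ z₀| < η := by
    have := hψ.continuousAt.eventually (Metric.ball_mem_nhds (ψ z₀) hη0)
    exact this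
  have hfreq : ∃ᶠ i in atTop, ∃ k ≤ S.N i, ∃ y ∈ (S.mesh i).vertices,
      u z₀ - ψ z₀ - 2 * η < v i k y - ψ (S.time i k, y) := by
    intro hnot
    refine hu.frequently_lt z₀ hz₀ (u z₀ - η) (by linarith) ?_
    refine eventually_nodeFilter.2 ⟨_, hψη, hnot.mono fun i hi k hk y hy hyU hlt => hi ?_⟩
    refine ⟨k, hk, y, hy, ?_⟩
    have h0 : |ψ (S.time i k, y) - ψ z₀| < η := hyU
    have := (abs_lt.1 h0).2
    linarith
  refine (hfreq.and_eventually (hup.and (hΨ η hη0))).mono ?_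
  rintro i ⟨⟨k₁, hk₁, y₁, hy₁, h1⟩, h2, h3⟩
  -- At each level there are finitely many nodes in space-time, so a global maximiser exists.
  have hfin : ((Iic (S.N i)) ×ˢ (S.mesh i).vertices).Finite :=
    (finite_Iic _).prod (finite_vertices (S.finite_mesh i))
  obtain ⟨⟨k, y⟩, ⟨hk, hy⟩, hky⟩ := hfin.exists_maximalFor
    (fun q : ℕ × E d => v i q.1 q.2 - Ψ i q.1 q.2) _ ⟨(k₁, y₁), hk₁, hy₁⟩
  have hall : ∀ k' ≤ S.N i, ∀ y' ∈ (S.mesh i).vertices,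
      v i k' y' - Ψ i k' y' ≤ v i k y - Ψ i k y := by
    intro k' hk' y' hy'
    by_contra hlt
    exact hlt (hky (j := (k', y')) ⟨hk', hy'⟩ (not_le.1 hlt).le)
  simp only at hy
  have hk' : k ≤ S.N i := hk
  have h4 := hall k₁ hk₁ y₁ hy₁
  have h5 := _root_.abs_le.1 (h3 k₁ hk₁ y₁ hy₁)
  have h6 := _root_.abs_le.1 (h3 k hk y hy)
  have h7 := h2 k hk y hy
  have h8 : dist (S.time i k, y) z₀ < min ε ε' := hκ' _ (by linarith)
  have h9 := hψ' (h8.trans_le (min_le_right _ _))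
  rw [Real.dist_eq, abs_lt] at h9
  have h10 := hρ0 (S.time i k, y)
  refine ⟨k, hk, y, hy, h8.trans_le (min_le_left _ _), ?_, hall⟩
  rw [abs_lt]
  constructor <;> linarith

end Envelope

/-! ### Separable test functions -/

/-- Second order Taylor expansion with a Peano remainder. -/
theorem taylor_second_order {F : Type*} [NormedAddCommGroup F] [NormedSpace ℝ F] {ψ : F → ℝ}
    (hψ : ContDiff ℝ 2 ψ) (z₀ : F) {ε : ℝ} (hε : 0 < ε) : ∃ r > 0, ∀ z, ‖z - z₀‖ < r →
      |ψ z - ψ z₀ - fderiv ℝ ψ z₀ (z - z₀) -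
        (1 / 2) * fderiv ℝ (fderiv ℝ ψ) z₀ (z - z₀) (z - z₀)| ≤ ε * ‖z - z₀‖ ^ 2 := by
  have hd : Differentiable ℝ ψ := hψ.differentiable two_ne_zero
  have hd1 : ContDiff ℝ 1 (fderiv ℝ ψ) := hψ.fderiv_right (by norm_num)
  have hd2 : Differentiable ℝ (fderiv ℝ ψ) := hd1.differentiable one_ne_zero
  set D := fderiv ℝ ψ z₀ with hD
  set H := fderiv ℝ (fderiv ℝ ψ) z₀ with hH
  have hsymm : ∀ a b, H a b = H b a := by
    have : IsSymmSndFDerivAt ℝ ψ z₀ := hψ.contDiffAt.isSymmSndFDerivAt (by simp)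
    exact fun a b => this a b
  have hlit := (hd2 z₀).hasFDerivAt.isLittleO.def hε
  obtain ⟨r, hr, hball⟩ := Metric.eventually_nhds_iff.1 hlit
  refine ⟨r, hr, fun z hz => ?_⟩
  set f : F → ℝ := fun z => ψ z - ψ z₀ - D (z - z₀) - (1 / 2) * H (z - z₀) (z - z₀) with hf
  have hderiv : ∀ z, HasFDerivAt f (fderiv ℝ ψ z - D - H (z - z₀)) z := by
    intro z
    have h1 : HasFDerivAt (fun z => z - z₀) (ContinuousLinearMap.id ℝ F) z :=
      (hasFDerivAt_id z).sub_const z₀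
    have h2 : HasFDerivAt (fun z => D (z - z₀)) D z := D.hasFDerivAt.comp z h1
    have h3 : HasFDerivAt (fun z => H (z - z₀)) H z := H.hasFDerivAt.comp z h1
    have h4 := h3.clm_apply h1
    have h5 := (((hd z).hasFDerivAt.sub_const (ψ z₀)).sub h2).sub (h4.const_mul (1 / 2))
    refine h5.congr_fderiv ?_
    ext e
    have h6 := hsymm e (z - z₀)
    simp only [_root_.sub_apply, _root_.smul_apply, _root_.add_apply, ContinuousLinearMap.comp_apply,
      ContinuousLinearMap.id_apply, ContinuousLinearMap.flip_apply, smul_eq_mul, h6]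
    ring
  -- Differentiability of the derivative at `z₀` bounds the derivative of the remainder by `ε ‖z -
  -- z₀‖` on this ball; the mean value inequality supplies the second factor.
  have hmv := (convex_closedBall z₀ ‖z - z₀‖).norm_image_sub_le_of_norm_hasFDerivWithin_le
    (f := f) (C := ε * ‖z - z₀‖) (fun z' _ => (hderiv z').hasFDerivWithinAt) ?_
    (Metric.mem_closedBall_self (norm_nonneg _))
    (show z ∈ Metric.closedBall z₀ ‖z - z₀‖ by simp [dist_eq_norm])
  · have h0 : f z₀ = 0 := by simp [hf]
    rw [h0, sub_zero, Real.norm_eq_abs] at hmv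
    calc _ ≤ _ := hmv
      _ = _ := by ring
  · intro z' hz'
    rw [Metric.mem_closedBall, dist_eq_norm] at hz'
    have h1 := hball (y := z') (by rw [dist_eq_norm]; exact hz'.trans_lt hz)
    exact h1.trans (mul_le_mul_of_nonneg_left hz' hε.le)

section TestFunctions

variable {d : ℕ}

/-- A quadratic function with a quartic penalisation. -/
noncomputable def quartic (x₀ : E d) (L : E d →L[ℝ] ℝ) (H : E d →L[ℝ] E d →L[ℝ] ℝ) (K : ℝ)
    (x : E d) : ℝ :=
  L (x - x₀) + H (x - x₀) (x - x₀) + K * (inner ℝ (x - x₀) (x - x₀)) ^ 2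

theorem contDiff_quartic (x₀ : E d) (L : E d →L[ℝ] ℝ) (H : E d →L[ℝ] E d →L[ℝ] ℝ) (K : ℝ)
    {n : WithTop ℕ∞} : ContDiff ℝ n (quartic x₀ L H K) := by
  unfold quartic
  have h1 : ContDiff ℝ n fun x : E d => x - x₀ := contDiff_id.sub contDiff_const
  exact ((L.contDiff.comp h1).add ((H.contDiff.comp h1).clm_apply h1)).add
    (contDiff_const.mul ((h1.inner ℝ h1).pow 2))

theorem fderiv_quartic (x₀ : E d) (L : E d →L[ℝ] ℝ) (H : E d →L[ℝ] E d →L[ℝ] ℝ) (K : ℝ) :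
    fderiv ℝ (quartic x₀ L H K) = fun x => L + (H + H.flip) (x - x₀) +
      (4 * K * inner ℝ (x - x₀) (x - x₀)) • innerSL ℝ (x - x₀) := by
  funext x
  have h1 : HasFDerivAt (fun z => z - x₀) (ContinuousLinearMap.id ℝ (E d)) x :=
    (hasFDerivAt_id x).sub_const x₀
  have h2 : HasFDerivAt (fun z => L (z - x₀)) L x := L.hasFDerivAt.comp x h1
  have h3 : HasFDerivAt (fun z => H (z - x₀)) H x := H.hasFDerivAt.comp x h1
  have h4 := h3.clm_apply h1
  have h5 := ((h1.inner ℝ h1).pow 2).const_mul K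
  have h6 := (h2.add h4).add h5
  refine HasFDerivAt.fderiv ?_
  refine h6.congr_fderiv ?_
  ext e
  have h7 : inner ℝ e (x - x₀) = inner ℝ (x - x₀) e := real_inner_comm _ _
  simp only [_root_.smul_apply, _root_.add_apply, ContinuousLinearMap.comp_apply,
    ContinuousLinearMap.id_apply, ContinuousLinearMap.flip_apply, smul_eq_mul, nsmul_eq_mul,
    fderivInnerCLM_apply, ContinuousLinearMap.prod_apply, innerSL_apply_apply, h7]
  push_cast
  ring

theorem fderiv_fderiv_quartic (x₀ : E d) (L : E d →L[ℝ] ℝ) (H : E d →L[ℝ] E d →L[ℝ] ℝ) (K : ℝ) :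
    fderiv ℝ (fderiv ℝ (quartic x₀ L H K)) x₀ = H + H.flip := by
  rw [fderiv_quartic]
  refine HasFDerivAt.fderiv ?_
  have h1 : HasFDerivAt (fun z => z - x₀) (ContinuousLinearMap.id ℝ (E d)) x₀ :=
    (hasFDerivAt_id x₀).sub_const x₀
  have h2 : HasFDerivAt (fun z => (H + H.flip) (z - x₀)) (H + H.flip) x₀ := (H + H.flip).hasFDerivAt.comp x₀ h1
  have h3 : HasFDerivAt (fun z => innerSL ℝ (z - x₀)) (innerSL ℝ : E d →L[ℝ] E d →L[ℝ] ℝ) x₀ := 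
    (innerSL ℝ : E d →L[ℝ] E d →L[ℝ] ℝ).hasFDerivAt.comp x₀ h1
  have h4 := ((h1.inner ℝ h1).const_mul (4 * K)).smul h3
  have h5 := (h2.const_add L).add h4
  refine h5.congr_fderiv ?_
  ext e e'
  simp

theorem gradient_quartic (x₀ : E d) (L : E d →L[ℝ] ℝ) (H : E d →L[ℝ] E d →L[ℝ] ℝ) (K : ℝ) :
    ∇ (quartic x₀ L H K) x₀ = (InnerProductSpace.toDual ℝ (E d)).symm L := by
  rw [gradient, fderiv_quartic]
  simp

theorem laplacian_quartic (x₀ : E d) (L : E d →L[ℝ] ℝ) (H : E d →L[ℝ] E d →L[ℝ] ℝ) (K : ℝ) :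
    Laplacian.laplacian (quartic x₀ L H K) x₀ =
      ∑ i, 2 * H (EuclideanSpace.basisFun (Fin d) ℝ i) (EuclideanSpace.basisFun (Fin d) ℝ i) := by
  rw [laplacian_eq_sum_fderiv, fderiv_fderiv_quartic]
  refine Finset.sum_congr rfl fun i _ => ?_
  rw [_root_.add_apply, _root_.add_apply, ContinuousLinearMap.flip_apply, two_mul]

end TestFunctions

section Touching

variable {d : ℕ} {A B : Type*} [MetricSpace A] [MetricSpace B] {Q : Problem d A B}
  {S : Discretisation Q} {v : ℕ → ℕ → E d → ℝ} {u : ℝ × E d → ℝ}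

/-- Young's inequality removes the mixed space-time terms. The large factor falls on `τ ^ 2`, where
it is harmless because the equation contains no second time derivative. -/
theorem quadratic_form_bound {H : ℝ × E d →L[ℝ] ℝ × E d →L[ℝ] ℝ} {η : ℝ} (hη : 0 < η) (τ : ℝ)
    (ξ : E d) : (1 / 2) * H (τ, ξ) (τ, ξ) ≤ (1 / 2) * H (0, ξ) (0, ξ) + η * ‖ξ‖ ^ 2 +
      (‖H‖ / 2 + ‖H‖ ^ 2 / (4 * η)) * τ ^ 2 := by
  have h0 : ((τ, ξ) : ℝ × E d) = (τ, 0) + (0, ξ) := by simp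
  have h1 : H (τ, ξ) (τ, ξ) = H (τ, 0) (τ, 0) + H (τ, 0) (0, ξ) + H (0, ξ) (τ, 0) +
      H (0, ξ) (0, ξ) := by
    rw [h0]
    simp only [map_add, _root_.add_apply]
    ring
  have hb : ∀ a b, H a b ≤ ‖H‖ * ‖a‖ * ‖b‖ := fun a b =>
    (le_abs_self _).trans (H.le_opNorm₂ a b)
  have hτ : ‖((τ, 0) : ℝ × E d)‖ = |τ| := by simp [Prod.norm_def]
  have hξ : ‖((0, ξ) : ℝ × E d)‖ = ‖ξ‖ := by simp [Prod.norm_def]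
  have h2 := hb (τ, 0) (τ, 0)
  have h3 := hb (τ, 0) (0, ξ)
  have h4 := hb (0, ξ) (τ, 0)
  rw [hτ] at h2 h3 h4
  rw [hξ] at h3 h4
  have h5 : ‖H‖ * |τ| * ‖ξ‖ ≤ η * ‖ξ‖ ^ 2 + ‖H‖ ^ 2 / (4 * η) * τ ^ 2 := by
    have h6 : 0 ≤ (2 * η * ‖ξ‖ - ‖H‖ * |τ|) ^ 2 / (4 * η) := by positivity
    have h7 : (2 * η * ‖ξ‖ - ‖H‖ * |τ|) ^ 2 / (4 * η) =
        η * ‖ξ‖ ^ 2 + ‖H‖ ^ 2 / (4 * η) * |τ| ^ 2 - ‖H‖ * |τ| * ‖ξ‖ := by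
      field_simp
      ring
    rw [sq_abs] at h7
    linarith
  have h8 : ‖H‖ * |τ| * |τ| = ‖H‖ * τ ^ 2 := by rw [mul_assoc, ← sq, sq_abs]
  rw [h1]
  linarith

/-- Near a local maximum point of `u - ψ`, the bounded function `u` lies globally below a smooth
separable function with nearly the same derivatives as `ψ`. -/
theorem exists_separable_majorant {C : ℝ} (hC : ∀ z ∈ Q.cyl, |u z| ≤ C) {ψ : ℝ × E d → ℝ}
    (hψ : ContDiff ℝ 2 ψ) {z₀ : ℝ × E d} (hz₀ : z₀ ∈ Ico 0 Q.T ×ˢ closure Q.Ω)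
    (hmax : IsLocalMaxOn (fun z => u z - ψ z) (Ico 0 Q.T ×ˢ closure Q.Ω) z₀) {η : ℝ}
    (hη : 0 < η) : ∃ (p : E d → ℝ) (θ : ℝ → ℝ), ContDiff ℝ (⊤ : ℕ∞) p ∧ Continuous θ ∧
      p z₀.2 = 0 ∧ θ z₀.1 = 0 ∧
      HasStrictDerivAt θ (deriv (fun t => ψ (t, z₀.2)) z₀.1) z₀.1 ∧
      ∇ p z₀.2 = ∇ (fun y => ψ (z₀.1, y)) z₀.2 ∧
      Laplacian.laplacian p z₀.2 =
        Laplacian.laplacian (fun y => ψ (z₀.1, y)) z₀.2 + 6 * η * d ∧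
      ∀ z ∈ Q.cyl, u z - (p z.2 + θ z.1) + (η * ‖z.2 - z₀.2‖ ^ 2 + (z.1 - z₀.1) ^ 2) ≤ u z₀ := by
  obtain ⟨t₀, x₀⟩ := z₀
  have hd : Differentiable ℝ ψ := hψ.differentiable two_ne_zero
  have hd1 : ContDiff ℝ 1 (fderiv ℝ ψ) := hψ.fderiv_right (by norm_num)
  have hd2 : Differentiable ℝ (fderiv ℝ ψ) := hd1.differentiable one_ne_zero
  set D := fderiv ℝ ψ (t₀, x₀) with hD
  set H := fderiv ℝ (fderiv ℝ ψ) (t₀, x₀) with hH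
  set ι := ContinuousLinearMap.inr ℝ ℝ (E d) with hι
  have hmk : ∀ x, HasFDerivAt (fun y : E d => ((t₀, y) : ℝ × E d)) ι x := fun x =>
    hasFDerivAt_prodMk_right t₀ x
  have hfx : ∀ x, fderiv ℝ (fun y => ψ (t₀, y)) x = (fderiv ℝ ψ (t₀, x)).comp ι := fun x =>
    ((hd (t₀, x)).hasFDerivAt.comp x (hmk x)).fderiv
  have hfxx : fderiv ℝ (fderiv ℝ (fun y => ψ (t₀, y))) x₀ =
      (ContinuousLinearMap.precomp ℝ ι).comp (H.comp ι) := by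
    rw [funext hfx]
    have h1 : HasFDerivAt (fun x => fderiv ℝ ψ (t₀, x)) (H.comp ι) x₀ :=
      (hd2 (t₀, x₀)).hasFDerivAt.comp x₀ (hmk x₀)
    exact ((ContinuousLinearMap.precomp ℝ ι).hasFDerivAt.comp x₀ h1).fderiv
  have hft : HasDerivAt (fun t => ψ (t, x₀)) (D (1, 0)) t₀ := by
    have h1 : HasDerivAt (fun t : ℝ => ((t, x₀) : ℝ × E d)) (1, 0) t₀ :=
      (hasDerivAt_id t₀).prodMk (hasDerivAt_const t₀ x₀)
    exact (hd (t₀, x₀)).hasFDerivAt.comp_hasDerivAt t₀ h1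
  set Hx : E d →L[ℝ] E d →L[ℝ] ℝ := (ContinuousLinearMap.precomp ℝ ι).comp (H.comp ι) with hHx
  have hHxa : ∀ a b, Hx a b = H (0, a) (0, b) := fun a b => rfl
  -- The last `η` absorbs the Taylor remainder in time; in space it is the second of the two `η` in
  -- `q`.
  set Cτ := ‖H‖ / 2 + ‖H‖ ^ 2 / (4 * η) + η with hCτ
  -- the quadratic part
  set q : ℝ × E d → ℝ := fun z => D (1, 0) * (z.1 - t₀) + D (0, z.2 - x₀) +
    (1 / 2) * Hx (z.2 - x₀) (z.2 - x₀) + 2 * η * ‖z.2 - x₀‖ ^ 2 + Cτ * (z.1 - t₀) ^ 2 with hq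
  obtain ⟨r₁, hr₁, htaylor⟩ := taylor_second_order hψ (t₀, x₀) hη
  have hnear : ∀ z, ‖z - (t₀, x₀)‖ < r₁ → ψ z ≤ ψ (t₀, x₀) + q z := by
    rintro ⟨t, x⟩ hz
    have h1 := (abs_le.1 (htaylor (t, x) hz)).2
    have h2 := quadratic_form_bound (H := H) hη (t - t₀) (x - x₀)
    have h3 : ((t, x) : ℝ × E d) - (t₀, x₀) = (t - t₀, x - x₀) := rfl
    rw [h3] at h1
    have h4 : ‖((t - t₀, x - x₀) : ℝ × E d)‖ ^ 2 ≤ (t - t₀) ^ 2 + ‖x - x₀‖ ^ 2 := by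
      rw [Prod.norm_def]
      rcases max_choice ‖t - t₀‖ ‖x - x₀‖ with h | h
      · rw [h, Real.norm_eq_abs, sq_abs]
        linarith [sq_nonneg ‖x - x₀‖]
      · rw [h]
        linarith [sq_nonneg (t - t₀)]
    have h5 : D (t - t₀, x - x₀) = D (1, 0) * (t - t₀) + D (0, x - x₀) := by
      have : ((t - t₀, x - x₀) : ℝ × E d) = (t - t₀) • (1, 0) + (0, x - x₀) := by simp
      rw [this, map_add, map_smul, smul_eq_mul]
      ring
    have h6 := mul_le_mul_of_nonneg_left h4 hη.le
    simp only [hq, hHxa, hCτ]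
    linarith
  obtain ⟨r₂, hr₂, hloc⟩ := Metric.eventually_nhds_iff.1 (eventually_nhdsWithin_iff.1 hmax)
  have hT : 0 < Q.T - t₀ := sub_pos.2 hz₀.1.2
  -- Radius on which Taylor's bound and the local maximum property hold, and which stays below the
  -- final time, where no maximum property is available.
  set r := min (min r₁ r₂) (Q.T - t₀) with hr
  have hr0 : 0 < r := by positivity
  have hqc : Continuous q := by
    have : Continuous fun z : ℝ × E d => Hx (z.2 - x₀) (z.2 - x₀) :=
      (Hx.continuous.comp (by fun_prop)).clm_apply (by fun_prop)
    fun_prop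
  obtain ⟨Cq, hCq⟩ := (isCompact_cyl Q).exists_bound_of_continuousOn hqc.continuousOn
  have hz₀c : (t₀, x₀) ∈ Q.cyl := ⟨⟨hz₀.1.1, hz₀.1.2.le⟩, hz₀.2⟩
  have hC0 : 0 ≤ C := (abs_nonneg _).trans (hC _ hz₀c)
  have hCq0 : 0 ≤ Cq := (norm_nonneg _).trans (hCq _ hz₀c)
  -- Outside radius `r` the quartic term exceeds the oscillation `2 * C` of `u` plus the size of the
  -- quadratic part, which makes the majorant global. Being of fourth order, it changes none of the
  -- derivatives that matter at the contact point.
  set K := (2 * C + Cq) / r ^ 4 with hK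
  have hK0 : 0 ≤ K := by positivity
  let I : E d →L[ℝ] E d →L[ℝ] ℝ := innerSL ℝ
  -- Two of the three `η` come from `q`, the third makes the maximum strict; in time the extra one
  -- in `Cτ + 1` does this. The Hessian gains `6 * η` in each direction.
  let G : E d →L[ℝ] E d →L[ℝ] ℝ := (1 / 2 : ℝ) • Hx + (3 * η) • I
  have hGa : ∀ a, G a a = (1 / 2) * Hx a a + 3 * η * ‖a‖ ^ 2 := fun a => by
    rw [← real_inner_self_eq_norm_sq]
    rfl
  refine ⟨quartic x₀ (D.comp ι) G K,
    fun t => D (1, 0) * (t - t₀) + (Cτ + 1) * (t - t₀) ^ 2 + K * (t - t₀) ^ 4,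
    contDiff_quartic _ _ _ _, by fun_prop, by simp [quartic], by simp, ?_, ?_, ?_, ?_⟩
  · simp only [hft.deriv]
    have h1 : HasStrictDerivAt (fun t : ℝ => t - t₀) 1 t₀ := (hasStrictDerivAt_id t₀).sub_const t₀
    have h2 := ((h1.const_mul (D (1, 0))).add ((h1.pow 2).const_mul (Cτ + 1))).add
      ((h1.pow 4).const_mul K)
    exact h2.congr_deriv (by simp)
  · rw [gradient_quartic, gradient, hfx]
  · rw [laplacian_quartic, laplacian_eq_sum_fderiv]
    simp only [hfxx]
    have h2 : ∀ i, 2 * G (EuclideanSpace.basisFun (Fin d) ℝ i)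
        (EuclideanSpace.basisFun (Fin d) ℝ i) = Hx (EuclideanSpace.basisFun (Fin d) ℝ i)
        (EuclideanSpace.basisFun (Fin d) ℝ i) + 6 * η := by
      intro i
      rw [hGa, (EuclideanSpace.basisFun (Fin d) ℝ).norm_eq_one]
      ring
    rw [Finset.sum_congr rfl fun i _ => h2 i, Finset.sum_add_distrib, Finset.sum_const,
      Finset.card_univ, Fintype.card_fin, nsmul_eq_mul]
    ring
  · rintro ⟨t, x⟩ hz
    have hp : quartic x₀ (D.comp ι) G K x =
        D (0, x - x₀) + (1 / 2) * Hx (x - x₀) (x - x₀) + 3 * η * ‖x - x₀‖ ^ 2 +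
          K * ‖x - x₀‖ ^ 4 := by
      unfold quartic
      rw [hGa, real_inner_self_eq_norm_sq]
      simp only [ContinuousLinearMap.comp_apply, hι, ContinuousLinearMap.inr_apply]
      ring
    simp only [hp]
    suffices h : u (t, x) ≤ u (t₀, x₀) + q (t, x) + K * (‖x - x₀‖ ^ 4 + (t - t₀) ^ 4) by
      simp only [hq] at h
      linarith
    by_cases hzr : ‖((t, x) : ℝ × E d) - (t₀, x₀)‖ < r
    · have h1 := hnear (t, x) (hzr.trans_le ((min_le_left _ _).trans (min_le_left _ _)))
      have h2 : (t, x) ∈ Ico 0 Q.T ×ˢ closure Q.Ω := by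
        refine ⟨⟨hz.1.1, ?_⟩, hz.2⟩
        have h3 := (norm_fst_le _).trans_lt (hzr.trans_le (min_le_right _ _))
        have h4 : |t - t₀| < Q.T - t₀ := h3
        change t < Q.T
        linarith [(abs_lt.1 h4).2]
      have h5 := hloc (y := (t, x)) (by
        rw [dist_eq_norm]
        exact hzr.trans_le ((min_le_left _ _).trans (min_le_right _ _))) h2
      simp only at h5
      have h6 : 0 ≤ K * (‖x - x₀‖ ^ 4 + (t - t₀) ^ 4) := by positivity
      linarith
    · have h1 : r ≤ ‖((t, x) : ℝ × E d) - (t₀, x₀)‖ := not_lt.1 hzr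
      have h2 : r ^ 4 ≤ ‖x - x₀‖ ^ 4 + (t - t₀) ^ 4 := by
        have h3 : ‖((t, x) : ℝ × E d) - (t₀, x₀)‖ = max |t - t₀| ‖x - x₀‖ := rfl
        rw [h3] at h1
        rcases le_max_iff.1 h1 with h | h
        · have := pow_le_pow_left₀ hr0.le h 4
          rw [Even.pow_abs (by decide)] at this
          have : 0 ≤ ‖x - x₀‖ ^ 4 := by positivity
          linarith
        · have := pow_le_pow_left₀ hr0.le h 4
          have : 0 ≤ (t - t₀) ^ 4 := by positivity
          linarith
      have h4 : 2 * C + Cq ≤ K * (‖x - x₀‖ ^ 4 + (t - t₀) ^ 4) := by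
        calc 2 * C + Cq = K * r ^ 4 := by rw [hK]; field_simp
          _ ≤ _ := mul_le_mul_of_nonneg_left h2 hK0
      have h5 := (abs_le.1 (hC _ hz)).2
      have h6 := (abs_le.1 (hC _ hz₀c)).1
      have h7 := (abs_le.1 (hCq _ hz)).1
      linarith

end Touching

/-! ### The viscosity inequalities -/

section Viscosity

variable {d : ℕ} {A B : Type*} [MetricSpace A] [MetricSpace B] {Q : Problem d A B}
  {S : Discretisation Q} {v : ℕ → ℕ → E d → ℝ} {u : ℝ × E d → ℝ}

theorem dist_lt_of_weighted_sq_lt {η : ℝ} (hη : 0 < η) (z₀ : ℝ × E d) {ε : ℝ} (hε : 0 < ε) :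
    ∃ κ > 0, ∀ z : ℝ × E d, η * ‖z.2 - z₀.2‖ ^ 2 + (z.1 - z₀.1) ^ 2 < κ → dist z z₀ < ε := by
  refine ⟨min (η * ε ^ 2) (ε ^ 2), by positivity, fun z hz => ?_⟩
  rw [Prod.dist_eq, max_lt_iff]
  constructor
  · rw [Real.dist_eq]
    refine abs_lt_of_sq_lt_sq ?_ hε.le
    have := hz.trans_le (min_le_right _ _)
    nlinarith [mul_nonneg hη.le (sq_nonneg ‖z.2 - z₀.2‖)]
  · rw [dist_eq_norm]
    have h1 := hz.trans_le (min_le_left _ _)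
    have h2 : η * ‖z.2 - z₀.2‖ ^ 2 < η * ε ^ 2 := by nlinarith [sq_nonneg (z.1 - z₀.1)]
    exact lt_of_pow_lt_pow_left₀ 2 hε.le (lt_of_mul_lt_mul_left h2 hη.le)

/-- Test functions touching the upper limit from above give separable test functions touching the
node functions from above. -/
theorem IsUpperLimit.exists_touching (hu : IsUpperLimit S v u) (hP : S.EllipticProjection) {C : ℝ}
    (hb : EventuallyBounded S v C) {ψ : ℝ × E d → ℝ} (hψ : ContDiff ℝ 2 ψ) {z₀ : ℝ × E d}
    (hz₀ : z₀ ∈ Ico 0 Q.T ×ˢ closure Q.Ω)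
    (hmax : IsLocalMaxOn (fun z => u z - ψ z) (Ico 0 Q.T ×ˢ closure Q.Ω) z₀) {η : ℝ}
    (hη : 0 < η) : ∃ (p : E d → ℝ) (θ : ℝ → ℝ), ContDiff ℝ (⊤ : ℕ∞) p ∧
      HasStrictDerivAt θ (deriv (fun t => ψ (t, z₀.2)) z₀.1) z₀.1 ∧
      ∇ p z₀.2 = ∇ (fun y => ψ (z₀.1, y)) z₀.2 ∧
      Laplacian.laplacian p z₀.2 =
        Laplacian.laplacian (fun y => ψ (z₀.1, y)) z₀.2 + 6 * η * d ∧
      ∀ ε > 0, ∃ᶠ i in atTop, ∃ k ≤ S.N i, ∃ y ∈ (S.mesh i).vertices,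
        dist (S.time i k, y) z₀ < ε ∧ |v i k y - u z₀| < ε ∧
        ∀ k' ≤ S.N i, ∀ y' ∈ (S.mesh i).vertices,
          v i k' y' - ((S.P i p : E d → ℝ) y' + θ (S.time i k')) ≤
            v i k y - ((S.P i p : E d → ℝ) y + θ (S.time i k)) := by
  obtain ⟨p, θ, hp, hθ, hp0, hθ0, hθ', hg, hΔ, hmaj⟩ :=
    exists_separable_majorant (fun z hz => hu.abs_le hb hz) hψ hz₀ hmax hη
  refine ⟨p, θ, hp, hθ', hg, hΔ, fun ε hε => ?_⟩
  have hpc := hp.continuous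
  refine hu.exists_maximiser (ψ := fun z => p z.2 + θ z.1)
    (ρ := fun z => η * ‖z.2 - z₀.2‖ ^ 2 + (z.1 - z₀.1) ^ 2)
    (Ψ := fun i k y => (S.P i p : E d → ℝ) y + θ (S.time i k))
    ⟨Ico_subset_Icc_self hz₀.1, hz₀.2⟩ (by fun_prop) (by fun_prop) (fun z => by positivity)
    (fun z hz => by simpa [hp0, hθ0] using hmaj z hz)
    (fun ε hε => dist_lt_of_weighted_sq_lt hη z₀ hε) ?_ hε
  intro ε hε
  filter_upwards [projection_smooth hP hp hε] with i hi k hk y hy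
  rw [add_sub_add_right_eq_sub]
  exact hi.1 y (vertices_subset_closure hy)

/-- Obtained by changing the signs of `v`, `u`, `ψ`, `p` and `θ`; linearity of the projection makes
this legitimate. -/
theorem isNegUpperLimit_exists_touching (hu : IsUpperLimit S (fun i k y => - v i k y) fun z => - u z)
    (hP : S.EllipticProjection) {C : ℝ}
    (hb : EventuallyBounded S v C) {ψ : ℝ × E d → ℝ} (hψ : ContDiff ℝ 2 ψ) {z₀ : ℝ × E d}
    (hz₀ : z₀ ∈ Ico 0 Q.T ×ˢ closure Q.Ω)
    (hmin : IsLocalMinOn (fun z => u z - ψ z) (Ico 0 Q.T ×ˢ closure Q.Ω) z₀) {η : ℝ}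
    (hη : 0 < η) : ∃ (p : E d → ℝ) (θ : ℝ → ℝ), ContDiff ℝ (⊤ : ℕ∞) p ∧
      HasStrictDerivAt θ (deriv (fun t => ψ (t, z₀.2)) z₀.1) z₀.1 ∧
      ∇ p z₀.2 = ∇ (fun y => ψ (z₀.1, y)) z₀.2 ∧
      Laplacian.laplacian p z₀.2 =
        Laplacian.laplacian (fun y => ψ (z₀.1, y)) z₀.2 - 6 * η * d ∧
      ∀ ε > 0, ∃ᶠ i in atTop, ∃ k ≤ S.N i, ∃ y ∈ (S.mesh i).vertices,
        dist (S.time i k, y) z₀ < ε ∧ |v i k y - u z₀| < ε ∧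
        ∀ k' ≤ S.N i, ∀ y' ∈ (S.mesh i).vertices,
          v i k y - ((S.P i p : E d → ℝ) y + θ (S.time i k)) ≤
            v i k' y' - ((S.P i p : E d → ℝ) y' + θ (S.time i k')) := by
  have hmax : IsLocalMaxOn (fun z => - u z - (-ψ) z) (Ico 0 Q.T ×ˢ closure Q.Ω) z₀ := by
    have h1 : (fun z => - u z - (-ψ) z) = fun z => - (u z - ψ z) := by
      funext z
      simp only [Pi.neg_apply]
      ring
    rw [h1]
    exact hmin.neg
  obtain ⟨p, θ, hp, hθ, hg, hΔ, htouch⟩ := hu.exists_touching hP hb.neg hψ.neg hz₀ hmax hη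
  refine ⟨-p, -θ, hp.neg, ?_, ?_, ?_, fun ε hε => (htouch ε hε).mono ?_⟩
  · refine hθ.neg.congr_deriv ?_
    have : (fun t => -ψ (t, z₀.2)) = - fun t => ψ (t, z₀.2) := rfl
    rw [this, deriv.neg, neg_neg]
  · have : (fun y => -ψ (z₀.1, y)) = - fun y => ψ (z₀.1, y) := rfl
    rw [this] at hg
    simp only [gradient, fderiv_neg, map_neg] at hg ⊢
    rw [hg, neg_neg]
  · have : (fun y => -ψ (z₀.1, y)) = - fun y => ψ (z₀.1, y) := rfl
    rw [this] at hΔ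
    rw [InnerProductSpace.laplacian_neg] at hΔ ⊢
    simp only [Pi.neg_apply] at hΔ ⊢
    rw [hΔ]
    ring
  · rintro i ⟨k, hk, y, hy, h1, h2, h3⟩
    refine ⟨k, hk, y, hy, h1, ?_, fun k' hk' y' hy' => ?_⟩
    · rw [← abs_neg]
      convert h2 using 2
      ring
    · have := h3 k' hk' y' hy'
      simp only [map_neg, Submodule.coe_neg, Pi.neg_apply]
      linarith

/-- Bounds of the Hamiltonian on bounded sets of arguments. -/
theorem exists_ham_bound [CompactSpace A] [CompactSpace B] (Q : Problem d A B) (R : ℝ) :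
    ∃ C, 0 ≤ C ∧ ∀ x ∈ closure Q.Ω, ∀ q P s, |q| ≤ R → ‖P‖ ≤ R → |s| ≤ R →
      ∀ p, |Q.ham x q P s p| ≤ C := by
  obtain ⟨Ca, _, ha⟩ := uniform_bound Q.isCompact_closure Q.cont_a
  obtain ⟨Cb, _, hb⟩ := uniform_bound Q.isCompact_closure Q.cont_b
  obtain ⟨Cc, _, hc⟩ := uniform_bound Q.isCompact_closure Q.cont_c
  obtain ⟨Cf, _, hf⟩ := uniform_bound Q.isCompact_closure Q.cont_f
  refine ⟨Ca * |R| + Cb * |R| + Cc * |R| + Cf, by positivity, fun x hx q P s hq hP hs p => ?_⟩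
  have hR := le_abs_self R
  have h1 : |Q.a p x * q| ≤ Ca * |R| := by
    rw [abs_mul]
    exact mul_le_mul (ha p x hx) (hq.trans hR) (abs_nonneg _) ‹_›
  have h2 : |inner ℝ (Q.b p x) P| ≤ Cb * |R| :=
    (abs_real_inner_le_norm _ _).trans
      (mul_le_mul (hb p x hx) (hP.trans hR) (norm_nonneg _) ‹_›)
  have h3 : |Q.c p x * s| ≤ Cc * |R| := by
    rw [abs_mul]
    exact mul_le_mul (hc p x hx) (hs.trans hR) (abs_nonneg _) ‹_›
  have h4 : |Q.f p x| ≤ Cf := hf p x hx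
  unfold Problem.ham
  rw [abs_le] at *
  constructor <;> linarith [h1.1, h1.2, h2.1, h2.2, h3.1, h3.2, h4.1, h4.2]

/-- Consistency along separable test functions shifted to pass through given nodal values. -/
theorem consistency_separable [CompactSpace A] [CompactSpace B] (hP : S.EllipticProjection)
    (hcons : S.Consistent) {p : E d → ℝ} (hp : ContDiff ℝ (⊤ : ℕ∞) p) {θ : ℝ → ℝ} {r : ℝ}
    {z₀ : ℝ × E d} (hθ : HasStrictDerivAt θ r z₀.1) (C : ℝ) {δ : ℝ} (hδ : 0 < δ) :
    ∃ ρ > 0, ∀ᶠ i in atTop, ∀ k, ∀ y ∈ S.internalNodes i, dist (S.time i k, y) z₀ < ρ →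
      ∀ V : ℝ, |V| ≤ C →
        |Laplacian.laplacian p y - Laplacian.laplacian p z₀.2| ≤ δ ∧ ‖∇ p y - ∇ p z₀.2‖ ≤ δ ∧
        |(θ (S.time i (k + 1)) - θ (S.time i k)) / S.h i - r| ≤ δ ∧
        ∀ c, |S.discHam i
          (fun x => (S.P i p : E d → ℝ) x +
            (V - (S.P i p : E d → ℝ) y - θ (S.time i k) + θ (S.time i (k + 1))))
          (fun x => (S.P i p : E d → ℝ) x + (V - (S.P i p : E d → ℝ) y)) y c -
          Q.ham y (Laplacian.laplacian p y) (∇ p y) V c| ≤ δ := by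
  obtain ⟨γ, hγ0, hγ⟩ := consistency hP hcons
  have hp2 := contDiff_two_of_smooth hp
  obtain ⟨Cp, hCp⟩ := Q.isCompact_closure.exists_bound_of_continuousOn hp.continuous.continuousOn
  obtain ⟨ρ₁, hρ₁, h₁⟩ := Metric.continuousAt_iff.1 ((continuous_laplacian hp2).continuousAt
    (x := z₀.2)) δ hδ
  obtain ⟨ρ₂, hρ₂, h₂⟩ := Metric.continuousAt_iff.1 ((continuous_gradient hp2).continuousAt
    (x := z₀.2)) δ hδ
  -- Strict differentiability controls difference quotients between two moving times near `z₀.1`, as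
  -- needed for consecutive time steps.
  have hlit := (hθ.hasStrictFDerivAt.isLittleO).def hδ
  obtain ⟨ρ₃, hρ₃, h₃⟩ := Metric.eventually_nhds_iff.1 hlit
  refine ⟨min (min ρ₁ ρ₂) (ρ₃ / 2), by positivity, ?_⟩
  -- The shifts of the explicit and the implicit part differ by one time increment of `θ`, which is
  -- of order `h`, so the reaction error vanishes in the limit.
  have hsmall : ∀ᶠ i in atTop, γ * (S.h i * (|r| + δ)) < δ / 2 := by
    have h1 : Tendsto (fun i => γ * (S.h i * (|r| + δ))) atTop (𝓝 (γ * (0 * (|r| + δ)))) :=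
      ((h_tendsto S).mul_const _).const_mul _
    rw [zero_mul, mul_zero] at h1
    exact h1.eventually (gt_mem_nhds (by positivity))
  filter_upwards [hγ p hp (C + Cp + 1) (δ / 2) (by positivity), hsmall,
    projection_smooth hP hp one_pos, (h_tendsto S).eventually (gt_mem_nhds (half_pos hρ₃))]
    with i hcon hs hproj hh k y hy hdist V hV
  have hpos := S.h_pos i
  obtain ⟨d1, d2⟩ := max_lt_iff.1 (show max (dist (S.time i k) z₀.1) (dist y z₀.2) < _ from hdist)
  have hθδ : |(θ (S.time i (k + 1)) - θ (S.time i k)) / S.h i - r| ≤ δ := by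
    have h4 := h₃ (y := (S.time i (k + 1), S.time i k)) (by
      rw [Prod.dist_eq, max_lt_iff]
      simp only [Real.dist_eq, abs_lt] at d1 ⊢
      rw [time_succ]
      have := min_le_right (min ρ₁ ρ₂) (ρ₃ / 2)
      refine ⟨⟨?_, ?_⟩, ?_, ?_⟩ <;> linarith [d1.1, d1.2])
    simp only [time_succ, add_sub_cancel_left, ContinuousLinearMap.toSpanSingleton_apply,
      smul_eq_mul, Real.norm_eq_abs] at h4
    have h5 : (θ (S.time i (k + 1)) - θ (S.time i k)) / S.h i - r =
        (θ (S.time i k + S.h i) - θ (S.time i k) - S.h i * r) / S.h i := by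
      rw [time_succ, sub_div _ (S.h i * r), mul_div_cancel_left₀ _ hpos.ne']
    rw [h5, abs_div, div_le_iff₀ (abs_pos.2 hpos.ne')]
    exact h4
  refine ⟨(h₁ (d2.trans_le ((min_le_left _ _).trans (min_le_left _ _)))).le, ?_, hθδ, fun c => ?_⟩
  · rw [← dist_eq_norm]
    exact (h₂ (d2.trans_le ((min_le_left _ _).trans (min_le_right _ _)))).le
  have hyc : y ∈ closure Q.Ω := subset_closure hy.2
  have hm : |V - (S.P i p : E d → ℝ) y| ≤ C + Cp + 1 := by
    have h5 := abs_le.1 hV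
    have h6 := abs_le.1 (hproj.1 y hyc)
    have h7 := abs_le.1 (hCp y hyc)
    rw [abs_le]
    constructor <;> linarith
  have h8 := hcon c y hy (V - (S.P i p : E d → ℝ) y - θ (S.time i k) + θ (S.time i (k + 1)))
    (V - (S.P i p : E d → ℝ) y) hm
  rw [add_sub_cancel] at h8
  refine h8.trans ?_
  have h9 : V - (S.P i p : E d → ℝ) y - θ (S.time i k) + θ (S.time i (k + 1)) -
      (V - (S.P i p : E d → ℝ) y) = S.h i * ((θ (S.time i (k + 1)) - θ (S.time i k)) / S.h i) := by
    field_simp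
    ring
  rw [h9, abs_mul, abs_of_pos hpos]
  have h10 : |(θ (S.time i (k + 1)) - θ (S.time i k)) / S.h i| ≤ |r| + δ := by
    have := abs_sub_abs_le_abs_sub ((θ (S.time i (k + 1)) - θ (S.time i k)) / S.h i) r
    linarith
  have h11 : γ * (S.h i * |(θ (S.time i (k + 1)) - θ (S.time i k)) / S.h i|) ≤
      γ * (S.h i * (|r| + δ)) := by gcongr
  linarith

theorem F_of_mem {t : ℝ} {x : E d} (ht : t < Q.T) (hx : x ∈ Q.Ω) (q : ℝ) (P : E d) (r s : ℝ) :
    Q.F (t, x, q, P, r, s) = - r + infSup (Q.ham x q P s) := by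
  simp only [Problem.F, if_pos ht, if_pos hx]
  rfl

theorem F_of_notMem {t : ℝ} {x : E d} (ht : t < Q.T) (hx : x ∉ Q.Ω) (q : ℝ) (P : E d) (r s : ℝ) :
    Q.F (t, x, q, P, r, s) = s - Q.g x := by
  simp only [Problem.F, if_pos ht, if_neg hx]

variable [CompactSpace A] [CompactSpace B] [Nonempty A] [Nonempty B]

theorem infSup_ham_bound (Q : Problem d A B) (R : ℝ) :
    ∃ C, 0 ≤ C ∧ ∀ x ∈ closure Q.Ω, ∀ q P s, |q| ≤ R → ‖P‖ ≤ R → |s| ≤ R →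
      |infSup (Q.ham x q P s)| ≤ C := by
  obtain ⟨C, hC0, hC⟩ := exists_ham_bound Q R
  exact ⟨C, hC0, fun x hx q P s hq hP hs => abs_infSup_le hC0 (hC x hx q P s hq hP hs)⟩

/-- `F` is locally bounded. -/
theorem F_locally_bounded (Q : Problem d A B) (ξ : ℝ × E d × ℝ × E d × ℝ × ℝ) :
    ∃ C, ∀ᶠ ζ in 𝓝[Q.domF] ξ, |Q.F ζ| ≤ C := by
  obtain ⟨C₁, hC₁0, hC₁⟩ := infSup_ham_bound Q (‖ξ‖ + 1)
  obtain ⟨C₂, hC₂⟩ := Q.g_bounded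
  obtain ⟨C₃, hC₃⟩ := Q.isCompact_closure.exists_bound_of_continuousOn Q.cont_vT
  have hC₂0 : 0 ≤ C₂ := (abs_nonneg _).trans (hC₂ 0)
  refine ⟨C₁ + C₂ + |C₃| + (‖ξ‖ + 1), ?_⟩
  filter_upwards [self_mem_nhdsWithin, mem_nhdsWithin_of_mem_nhds (Metric.ball_mem_nhds ξ one_pos)]
    with ζ hζ hball
  obtain ⟨t, x, q, P, r, s⟩ := ζ
  have hn : ‖((t, x, q, P, r, s) : ℝ × E d × ℝ × E d × ℝ × ℝ)‖ ≤ ‖ξ‖ + 1 := by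
    have h1 : ‖((t, x, q, P, r, s) : ℝ × E d × ℝ × E d × ℝ × ℝ) - ξ‖ < 1 := by
      rw [← dist_eq_norm]; exact hball
    have h2 := norm_le_norm_add_norm_sub' ((t, x, q, P, r, s) : ℝ × E d × ℝ × E d × ℝ × ℝ) ξ
    linarith
  simp only [norm_prod_le_iff] at hn
  obtain ⟨-, -, hq, hP, hr, hs⟩ := hn
  rw [Real.norm_eq_abs] at hq hr hs
  have hx : x ∈ closure Q.Ω := hζ.2
  have h1 := hC₁ x hx q P s hq hP hs
  have h2 := abs_le.1 (hC₂ x)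
  have h3 := abs_le.1 ((hC₃ x hx).trans (le_abs_self _))
  have hR : 0 ≤ ‖ξ‖ := norm_nonneg _
  have h0 := abs_nonneg C₃
  by_cases ht : t < Q.T
  · by_cases hxΩ : x ∈ Q.Ω
    · rw [F_of_mem ht hxΩ]
      rw [abs_le] at h1 hr ⊢
      constructor <;> linarith [h1.1, h1.2, hr.1, hr.2]
    · rw [F_of_notMem ht hxΩ]
      rw [abs_le] at hs ⊢
      constructor <;> linarith [hs.1, hs.2, h2.1, h2.2]
  · have : Q.F (t, x, q, P, r, s) = s - Q.vT x := by simp only [Problem.F, if_neg ht]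
    rw [this]
    rw [abs_le] at hs ⊢
    constructor <;> linarith [hs.1, hs.2, h3.1, h3.2]

/-- Local boundedness of `F` is what makes the real `liminf` the genuine one, so nearby points with
almost non-positive values decide its sign. -/
theorem lscEnv_F_nonpos {ξ : ℝ × E d × ℝ × E d × ℝ × ℝ}
    (h : ∀ ε > 0, ∃ ζ ∈ Q.domF, dist ζ ξ < ε ∧ Q.F ζ ≤ ε) : lscEnv Q.domF Q.F ξ ≤ 0 := by
  obtain ⟨C, hC⟩ := F_locally_bounded Q ξ
  by_contra hlt
  obtain ⟨c, hc0, hc⟩ := exists_between (not_le.1 hlt)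
  have h1 : ∀ᶠ ζ in 𝓝[Q.domF] ξ, c < Q.F ζ :=
    eventually_lt_of_lt_liminf hc ⟨-C, hC.mono fun ζ hζ => (abs_le.1 hζ).1⟩
  obtain ⟨ε, hε, h2⟩ := Metric.mem_nhdsWithin_iff.1 h1
  obtain ⟨ζ, hζ, h3, h4⟩ := h (min ε c) (by positivity)
  have h5 : c < Q.F ζ := h2 ⟨h3.trans_le (min_le_left _ _), hζ⟩
  linarith [min_le_right ε c]

theorem uscEnv_F_nonneg {ξ : ℝ × E d × ℝ × E d × ℝ × ℝ}
    (h : ∀ ε > 0, ∃ ζ ∈ Q.domF, dist ζ ξ < ε ∧ - ε ≤ Q.F ζ) : 0 ≤ uscEnv Q.domF Q.F ξ := by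
  obtain ⟨C, hC⟩ := F_locally_bounded Q ξ
  by_contra hlt
  obtain ⟨c, hc, hc0⟩ := exists_between (not_le.1 hlt)
  have h1 : ∀ᶠ ζ in 𝓝[Q.domF] ξ, Q.F ζ < c :=
    eventually_lt_of_limsup_lt hc ⟨C, hC.mono fun ζ hζ => (abs_le.1 hζ).2⟩
  obtain ⟨ε, hε, h2⟩ := Metric.mem_nhdsWithin_iff.1 h1
  obtain ⟨ζ, hζ, h3, h4⟩ := h (min ε (-c)) (by have := neg_pos.2 hc0; positivity)
  have h5 : Q.F ζ < c := h2 ⟨h3.trans_le (min_le_left _ _), hζ⟩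
  linarith [min_le_right ε (-c)]

end Viscosity

/-! ### Passage to the limit at interior and lateral boundary points -/

section Viscosity

variable {d : ℕ} {A B : Type*} [MetricSpace A] [MetricSpace B] {Q : Problem d A B}
  {S : Discretisation Q} {v : ℕ → ℕ → E d → ℝ} {u : ℝ × E d → ℝ}

theorem continuous_g (Q : Problem d A B) : Continuous Q.g := by
  obtain ⟨K, hK⟩ := Q.g_lipschitz
  exact hK.continuous

theorem mem_frontier_of_notMem {x : E d} (hx : x ∈ closure Q.Ω) (h : x ∉ Q.Ω) :
    x ∈ frontier Q.Ω := by
  rw [Q.isOpen_Ω.frontier_eq]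
  exact ⟨hx, h⟩

/-- Nodes whose values are not close to the boundary data are internal. -/
theorem exists_forall_near_internal (hv : S.IsNumericalSolution v) (hP : S.EllipticProjection)
    {z₀ : ℝ × E d} (ht : z₀.1 < Q.T) {s : ℝ} (h : z₀.2 ∈ Q.Ω ∨ s ≠ Q.g z₀.2) :
    ∃ ρ > 0, ∀ᶠ i in atTop, ∀ k ≤ S.N i, ∀ y ∈ (S.mesh i).vertices,
      dist (S.time i k, y) z₀ < ρ → |v i k y - s| < ρ → k < S.N i ∧ y ∈ S.internalNodes i := by
  -- Nodes within distance `T - t₀` are not at the final time, so a step of the scheme exists there.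
  have hk : ∀ {ρ : ℝ}, ρ ≤ Q.T - z₀.1 → ∀ {i k : ℕ} {y : E d}, k ≤ S.N i →
      dist (S.time i k, y) z₀ < ρ → k < S.N i := by
    intro ρ hρ i k y hk hd
    refine lt_of_le_of_ne hk fun hkN => ?_
    have h1 : dist (S.time i k) z₀.1 < ρ := (le_max_left _ _).trans_lt hd
    rw [hkN, time_N, Real.dist_eq] at h1
    linarith [le_abs_self (Q.T - z₀.1)]
  have hT : 0 < Q.T - z₀.1 := sub_pos.2 ht
  by_cases hΩ : z₀.2 ∈ Q.Ω
  · obtain ⟨r, hr, hball⟩ := Metric.isOpen_iff.1 Q.isOpen_Ω _ hΩ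
    refine ⟨min r (Q.T - z₀.1), by positivity, Eventually.of_forall fun i k hkN y hy hd _ =>
      ⟨hk (min_le_right _ _) hkN hd, hy, hball ?_⟩⟩
    exact ((le_max_right _ _).trans_lt hd).trans_le (min_le_left _ _)
  · have hs : s ≠ Q.g z₀.2 := h.resolve_left hΩ
    -- A boundary node would have a value within `2 κ` of `g z₀.2`, through convergence of the
    -- projected data and continuity of `g`, and within `κ` of `s`. This contradicts the separation
    -- `4 κ`.
    set κ := |s - Q.g z₀.2| / 4 with hκ
    have hκ0 : 0 < κ := by
      have := abs_pos.2 (sub_ne_zero.2 hs)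
      positivity
    obtain ⟨r, hr, hg⟩ := Metric.continuousAt_iff.1 ((continuous_g Q).continuousAt (x := z₀.2)) κ hκ0
    refine ⟨min (min r κ) (Q.T - z₀.1), by positivity, ?_⟩
    filter_upwards [Metric.tendstoUniformlyOn_iff.1 hP.convergence_g κ hκ0] with i hi k hkN y hy hd hs
    have hkN' := hk (min_le_right _ _) hkN hd
    refine ⟨hkN', hy, ?_⟩
    by_contra hyΩ
    have hyc := vertices_subset_closure hy
    have h1 := hi y hyc
    rw [← hv.boundary i k hkN' (mem_frontier_of_notMem hyc hyΩ)] at h1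
    have h2 := hg (((le_max_right _ _).trans_lt hd).trans_le
      ((min_le_left _ _).trans (min_le_left _ _)))
    have h3 := hs.trans_le ((min_le_left _ _).trans (min_le_right _ _))
    rw [Real.dist_eq, abs_lt] at h1 h2
    rw [abs_lt] at h3
    have h4 : |s - Q.g z₀.2| < 4 * κ := by
      rw [abs_lt]
      constructor <;> linarith [h1.1, h1.2, h2.1, h2.2, h3.1, h3.2]
    linarith

variable [CompactSpace A] [CompactSpace B] [Nonempty A] [Nonempty B]

/-- The upper limit of the numerical solutions satisfies the viscosity inequality of
subsolutions. -/
theorem IsUpperLimit.lscEnv_F_nonpos (hu : IsUpperLimit S v u) (hv : S.IsNumericalSolution v)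
    (hP : S.EllipticProjection) (hcons : S.Consistent) (hmon : S.Monotone) {C : ℝ}
    (hb : EventuallyBounded S v C) {ψ : ℝ × E d → ℝ} (hψ : ContDiff ℝ 2 ψ) {z₀ : ℝ × E d}
    (hz₀ : z₀ ∈ Ico 0 Q.T ×ˢ closure Q.Ω)
    (hmax : IsLocalMaxOn (fun z => u z - ψ z) (Ico 0 Q.T ×ˢ closure Q.Ω) z₀) :
    lscEnv Q.domF Q.F (Problem.jet ψ z₀ (u z₀)) ≤ 0 := by
  refine Isaacs.lscEnv_F_nonpos fun ε hε => ?_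
  have hz₀c : z₀ ∈ Q.cyl := ⟨Ico_subset_Icc_self hz₀.1, hz₀.2⟩
  by_cases hbd : z₀.2 ∈ Q.Ω ∨ u z₀ ≠ Q.g z₀.2
  swap
  -- At a lateral boundary point with value `g` the point itself competes in the lower envelope, and
  -- `F` vanishes there.
  · push Not at hbd
    refine ⟨Problem.jet ψ z₀ (u z₀), hz₀c, by simpa using hε, ?_⟩
    rw [Problem.jet, F_of_notMem hz₀.1.2 hbd.1, hbd.2, sub_self]
    exact hε.le
  set δ := ε / 4 with hδ
  have hδ0 : 0 < δ := by positivity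
  -- This `η` keeps the perturbation `6 * η * d` of the Laplacian below `δ`, including in the
  -- trivial dimension zero.
  obtain ⟨p, θ, hp, hθ, hg, hΔ, htouch⟩ := hu.exists_touching hP hb hψ hz₀ hmax
    (η := δ / (6 * (d + 1))) (by positivity)
  have hηd : 6 * (δ / (6 * (d + 1))) * d ≤ δ := by
    have h1 : 6 * (δ / (6 * (d + 1))) * (d : ℝ) = δ * (d / (d + 1)) := by
      field_simp
    rw [h1]
    exact mul_le_of_le_one_right hδ0.le (div_le_one_of_le₀ (by linarith) (by positivity))
  have hηd0 : 0 ≤ 6 * (δ / (6 * (d + 1))) * (d : ℝ) := by positivity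
  obtain ⟨ρ₁, hρ₁, h₁⟩ := consistency_separable hP hcons hp hθ C hδ0
  obtain ⟨ρ₂, hρ₂, h₂⟩ := exists_forall_near_internal hv hP hz₀.1.2 hbd
  obtain ⟨i, ⟨k, hk, y, hy, hd, hs, ht⟩, h₁, h₂, hbi⟩ :=
    ((htouch (min (min ρ₁ ρ₂) δ) (by positivity)).and_eventually (h₁.and (h₂.and hb))).exists
  obtain ⟨hkN, hyi⟩ := h₂ k hk y hy (hd.trans_le ((min_le_left _ _).trans (min_le_right _ _)))
    (hs.trans_le ((min_le_left _ _).trans (min_le_right _ _)))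
  obtain ⟨e1, e2, e3, e4⟩ := h₁ k y hyi (hd.trans_le ((min_le_left _ _).trans (min_le_left _ _)))
    (v i k y) (hbi k hk y hy)
  have hW : ∀ m : ℝ, (fun x => (S.P i p : E d → ℝ) x + m) ∈ P1Space (S.mesh i) := fun m =>
    Submodule.add_mem _ (S.P i p).2 (const_mem_P1Space m)
  -- The test function is lifted by a constant so as to equal `v i k y` at the maximiser. Contact
  -- with value zero satisfies the sign condition of the implicit part, and global maximality orders
  -- the functions at step `k + 1`.
  have hscheme := scheme_le_of_touching hv hcons hmon hkN hyi (hW _) (hW _)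
    (W₁ := fun x => (S.P i p : E d → ℝ) x +
      (v i k y - (S.P i p : E d → ℝ) y - θ (S.time i k) + θ (S.time i (k + 1))))
    (W₀ := fun x => (S.P i p : E d → ℝ) x + (v i k y - (S.P i p : E d → ℝ) y))
    (fun z hz => by linarith [ht (k + 1) hkN z hz]) (by simp)
    (fun z hz => by linarith [ht k hk z hz])
  obtain ⟨C₁, hC₁⟩ := exists_discHam_bound hcons (hW (v i k y - (S.P i p : E d → ℝ) y -
    θ (S.time i k) + θ (S.time i (k + 1)))) (hW (v i k y - (S.P i p : E d → ℝ) y)) hyi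
  have hle : infSup (Q.ham y (Laplacian.laplacian p y) (∇ p y) (v i k y)) ≤ _ + δ :=
    infSup_le_add (C := C₁ + δ) (fun c => by
      have h1 := _root_.abs_le.1 (e4 c)
      have h2 := _root_.abs_le.1 (hC₁ c)
      rw [_root_.abs_le]
      constructor <;> linarith) (fun c => (hC₁ c).trans (by linarith))
      (fun c => by linarith [(_root_.abs_le.1 (e4 c)).1])
  -- The nearby argument of `F` uses the derivatives of `p` at the node, but keeps the time
  -- derivative of `ψ` at `z₀` exactly.
  refine ⟨(S.time i k, y, Laplacian.laplacian p y, ∇ p y, deriv (fun t => ψ (t, z₀.2)) z₀.1,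
    v i k y), node_mem_cyl hk hy, ?_, ?_⟩
  · have h1 := hd.trans_le (min_le_right _ _)
    have h2 := hs.trans_le (min_le_right _ _)
    rw [Prod.dist_eq, max_lt_iff] at h1
    rw [hΔ] at e1
    rw [hg] at e2
    rw [_root_.abs_le] at e1
    simp only [Problem.jet, Prod.dist_eq, max_lt_iff, dist_self]
    refine ⟨by linarith [h1.1], by linarith [h1.2], ?_, ?_, hε, ?_⟩
    · rw [Real.dist_eq, abs_lt]
      constructor <;> linarith [e1.1, e1.2]
    · rw [dist_eq_norm]
      linarith
    · rw [Real.dist_eq]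
      linarith
  · rw [F_of_mem ((time_mono S i hkN).trans_eq (time_N S i)) hyi.2]
    have h5 : (S.P i p : E d → ℝ) y + (v i k y - (S.P i p : E d → ℝ) y - θ (S.time i k) +
        θ (S.time i (k + 1))) - v i k y = θ (S.time i (k + 1)) - θ (S.time i k) := by ring
    rw [h5] at hscheme
    linarith [(_root_.abs_le.1 e3).2]

/-- The lower limit of the numerical solutions satisfies the viscosity inequality of
supersolutions. -/
theorem uscEnv_F_nonneg_of_isUpperLimit_neg
    (hu : IsUpperLimit S (fun i k y => - v i k y) fun z => - u z) (hv : S.IsNumericalSolution v)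
    (hP : S.EllipticProjection) (hcons : S.Consistent) (hmon : S.Monotone) {C : ℝ}
    (hb : EventuallyBounded S v C) {ψ : ℝ × E d → ℝ} (hψ : ContDiff ℝ 2 ψ) {z₀ : ℝ × E d}
    (hz₀ : z₀ ∈ Ico 0 Q.T ×ˢ closure Q.Ω)
    (hmin : IsLocalMinOn (fun z => u z - ψ z) (Ico 0 Q.T ×ˢ closure Q.Ω) z₀) :
    0 ≤ uscEnv Q.domF Q.F (Problem.jet ψ z₀ (u z₀)) := by
  refine Isaacs.uscEnv_F_nonneg fun ε hε => ?_
  have hz₀c : z₀ ∈ Q.cyl := ⟨Ico_subset_Icc_self hz₀.1, hz₀.2⟩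
  by_cases hbd : z₀.2 ∈ Q.Ω ∨ u z₀ ≠ Q.g z₀.2
  swap
  · push Not at hbd
    refine ⟨Problem.jet ψ z₀ (u z₀), hz₀c, by simpa using hε, ?_⟩
    rw [Problem.jet, F_of_notMem hz₀.1.2 hbd.1, hbd.2, sub_self]
    linarith
  set δ := ε / 4 with hδ
  have hδ0 : 0 < δ := by positivity
  obtain ⟨p, θ, hp, hθ, hg, hΔ, htouch⟩ := isNegUpperLimit_exists_touching hu hP hb hψ hz₀ hmin
    (η := δ / (6 * (d + 1))) (by positivity)
  have hηd : 6 * (δ / (6 * (d + 1))) * d ≤ δ := by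
    have h1 : 6 * (δ / (6 * (d + 1))) * (d : ℝ) = δ * (d / (d + 1)) := by
      field_simp
    rw [h1]
    exact mul_le_of_le_one_right hδ0.le (div_le_one_of_le₀ (by linarith) (by positivity))
  have hηd0 : 0 ≤ 6 * (δ / (6 * (d + 1))) * (d : ℝ) := by positivity
  obtain ⟨ρ₁, hρ₁, h₁⟩ := consistency_separable hP hcons hp hθ C hδ0
  obtain ⟨ρ₂, hρ₂, h₂⟩ := exists_forall_near_internal hv hP hz₀.1.2 hbd
  obtain ⟨i, ⟨k, hk, y, hy, hd, hs, ht⟩, h₁, h₂, hbi⟩ :=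
    ((htouch (min (min ρ₁ ρ₂) δ) (by positivity)).and_eventually (h₁.and (h₂.and hb))).exists
  obtain ⟨hkN, hyi⟩ := h₂ k hk y hy (hd.trans_le ((min_le_left _ _).trans (min_le_right _ _)))
    (hs.trans_le ((min_le_left _ _).trans (min_le_right _ _)))
  obtain ⟨e1, e2, e3, e4⟩ := h₁ k y hyi (hd.trans_le ((min_le_left _ _).trans (min_le_left _ _)))
    (v i k y) (hbi k hk y hy)
  have hW : ∀ m : ℝ, (fun x => (S.P i p : E d → ℝ) x + m) ∈ P1Space (S.mesh i) := fun m =>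
    Submodule.add_mem _ (S.P i p).2 (const_mem_P1Space m)
  -- As for subsolutions, with all inequalities reversed: the lifted test function touches from
  -- below.
  have hscheme := le_scheme_of_touching hv hcons hmon hkN hyi (hW _) (hW _)
    (W₁ := fun x => (S.P i p : E d → ℝ) x +
      (v i k y - (S.P i p : E d → ℝ) y - θ (S.time i k) + θ (S.time i (k + 1))))
    (W₀ := fun x => (S.P i p : E d → ℝ) x + (v i k y - (S.P i p : E d → ℝ) y))
    (fun z hz => by linarith [ht (k + 1) hkN z hz]) (by simp)
    (fun z hz => by linarith [ht k hk z hz])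
  obtain ⟨C₁, hC₁⟩ := exists_discHam_bound hcons (hW (v i k y - (S.P i p : E d → ℝ) y -
    θ (S.time i k) + θ (S.time i (k + 1)))) (hW (v i k y - (S.P i p : E d → ℝ) y)) hyi
  have hle : infSup _ ≤ infSup (Q.ham y (Laplacian.laplacian p y) (∇ p y) (v i k y)) + δ :=
    infSup_le_add (C := C₁ + δ) (fun c => (hC₁ c).trans (by linarith)) (fun c => by
      have h1 := _root_.abs_le.1 (e4 c)
      have h2 := _root_.abs_le.1 (hC₁ c)
      rw [_root_.abs_le]
      constructor <;> linarith)
      (fun c => by linarith [(_root_.abs_le.1 (e4 c)).2])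
  refine ⟨(S.time i k, y, Laplacian.laplacian p y, ∇ p y, deriv (fun t => ψ (t, z₀.2)) z₀.1,
    v i k y), node_mem_cyl hk hy, ?_, ?_⟩
  · have h1 := hd.trans_le (min_le_right _ _)
    have h2 := hs.trans_le (min_le_right _ _)
    rw [Prod.dist_eq, max_lt_iff] at h1
    rw [hΔ] at e1
    rw [hg] at e2
    rw [_root_.abs_le] at e1
    simp only [Problem.jet, Prod.dist_eq, max_lt_iff, dist_self]
    refine ⟨by linarith [h1.1], by linarith [h1.2], ?_, ?_, hε, ?_⟩
    · rw [Real.dist_eq, abs_lt]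
      constructor <;> linarith [e1.1, e1.2]
    · rw [dist_eq_norm]
      linarith
    · rw [Real.dist_eq]
      linarith
  · rw [F_of_mem ((time_mono S i hkN).trans_eq (time_N S i)) hyi.2]
    have h5 : (S.P i p : E d → ℝ) y + (v i k y - (S.P i p : E d → ℝ) y - θ (S.time i k) +
        θ (S.time i (k + 1))) - v i k y = θ (S.time i (k + 1)) - θ (S.time i k) := by ring
    rw [h5] at hscheme
    linarith [(_root_.abs_le.1 e3).1]

end Viscosity

/-! ### Behaviour at the final time and at the strong part of the boundary -/

section FinalTime

variable {d : ℕ} {A B : Type*} [MetricSpace A] [MetricSpace B] {Q : Problem d A B}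
  {S : Discretisation Q} {v : ℕ → ℕ → E d → ℝ} {u : ℝ × E d → ℝ}

/-- Constants have zero gradient, so only the reaction term acts on them; `κ` is its average and
inherits its sign. -/
theorem exists_discOp_add_const {i : ℕ} {a : E d → ℝ} {b : E d → E d} {c : E d → ℝ}
    (hb : MemLp b ∞ (volume.restrict Q.Ω)) (hc : MemLp c ∞ (volume.restrict Q.Ω))
    (hc0 : ∀ᵐ x ∂(volume.restrict Q.Ω), 0 ≤ c x) {y : E d} (hy : y ∈ S.internalNodes i) :
    ∃ κ, 0 ≤ κ ∧ ∀ w ∈ P1Space (S.mesh i), ∀ m : ℝ,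
      S.discOp i a b c (fun x => w x + m) y = S.discOp i a b c w y + κ * m := by
  refine ⟨∫ x in Q.Ω, c x * hatN Q.Ω (S.mesh i) y x, ?_, fun w hw m => ?_⟩
  · refine integral_nonneg_of_ae (hc0.mono fun x hx => ?_)
    exact mul_nonneg hx ((S.isMeshOf i).hatN_nonneg hy x)
  · have h1 : (fun x => w x + m) = w + fun _ => m := rfl
    rw [h1, discOp_add hb hc hw (const_mem_P1Space m) hy, discOp_const, ← integral_mul_const]
    congr 2
    funext x
    ring

theorem exists_discHam_add_const (hcons : S.Consistent) {i : ℕ} (p : A × B) {y : E d}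
    (hy : y ∈ S.internalNodes i) : ∃ κ₁ κ₂, 0 ≤ κ₁ ∧ 0 ≤ κ₂ ∧ ∀ w ∈ P1Space (S.mesh i),
      ∀ m₁ m₂ : ℝ, S.discHam i (fun x => w x + m₁) (fun x => w x + m₂) y p =
        S.discHam i w w y p + κ₁ * m₁ + κ₂ * m₂ := by
  obtain ⟨κ₁, h1, h2⟩ := exists_discOp_add_const (S := S) (a := S.aE i p) (hcons.memLp_bE i p)
    (hcons.memLp_cE i p) (hcons.cE_nonneg i p) hy
  obtain ⟨κ₂, h3, h4⟩ := exists_discOp_add_const (S := S) (a := S.aI i p) (hcons.memLp_bI i p)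
    (hcons.memLp_cI i p) (hcons.cI_nonneg i p) hy
  refine ⟨κ₁, κ₂, h1, h3, fun w hw m₁ m₂ => ?_⟩
  have h5 : S.opE i p (fun x => w x + m₁) y = _ := h2 w hw m₁
  have h6 : S.opI i p (fun x => w x + m₂) y = _ := h4 w hw m₂
  unfold Discretisation.discHam
  rw [h5, h6]
  unfold Discretisation.opE Discretisation.opI
  ring

/-- The final and the boundary values of the numerical solutions converge. -/
theorem boundary_values_tendsto (hv : S.IsNumericalSolution v) (hP : S.EllipticProjection) {δ : ℝ}
    (hδ : 0 < δ) : ∀ᶠ i in atTop, (∀ y ∈ closure Q.Ω, |v i (S.N i) y - Q.vT y| ≤ δ) ∧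
      ∀ k ≤ S.N i, ∀ y ∈ frontier Q.Ω, |v i k y - Q.g y| ≤ δ := by
  filter_upwards [Metric.tendstoUniformlyOn_iff.1 hP.convergence_g δ hδ,
    Metric.tendstoUniformlyOn_iff.1 hP.convergence_vT δ hδ] with i hg hT
  have hfin : ∀ y ∈ closure Q.Ω, |v i (S.N i) y - Q.vT y| ≤ δ := fun y hy => by
    rw [hv.final i hy, ← Real.dist_eq, dist_comm]
    exact (hT y hy).le
  refine ⟨hfin, fun k hk y hy => ?_⟩
  rcases hk.lt_or_eq with hkN | rfl
  · rw [hv.boundary i k hkN hy, ← Real.dist_eq, dist_comm]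
    exact (hg y (frontier_subset_closure hy)).le
  · rw [← Q.vT_eq_g hy]
    exact hfin y (frontier_subset_closure hy)

/-- Downward induction on the time steps and a minimum principle on the nodes. -/
theorem nodes_nonneg_of_scheme {i : ℕ} {D : ℕ → E d → ℝ}
    (hfinal : ∀ y ∈ (S.mesh i).vertices, 0 ≤ D (S.N i) y)
    (hbd : ∀ k < S.N i, ∀ y ∈ (S.mesh i).vertices, y ∉ Q.Ω → 0 ≤ D k y)
    (hint : ∀ k < S.N i, (∀ z ∈ (S.mesh i).vertices, 0 ≤ D (k + 1) z) → ∀ y ∈ S.internalNodes i,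
      (∀ z ∈ (S.mesh i).vertices, D k y ≤ D k z) → 0 ≤ D k y) :
    ∀ k ≤ S.N i, ∀ y ∈ (S.mesh i).vertices, 0 ≤ D k y := by
  have key : ∀ j k, k + j = S.N i → ∀ y ∈ (S.mesh i).vertices, 0 ≤ D k y := by
    intro j
    induction j with
    | zero =>
      rintro k rfl
      exact hfinal
    | succ j ih =>
      intro k hkj y hy
      have hk : k < S.N i := by omega
      obtain ⟨y₀, hy₀, hmin⟩ := (finite_vertices (S.finite_mesh i)).exists_minimalFor (D k) _ ⟨y, hy⟩
      have hmin' : ∀ z ∈ (S.mesh i).vertices, D k y₀ ≤ D k z := by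
        intro z hz
        by_contra hlt
        exact hlt (hmin hz (not_le.1 hlt).le)
      refine le_trans ?_ (hmin' y hy)
      by_cases hΩ : y₀ ∈ Q.Ω
      · exact hint k hk (ih (k + 1) (by omega)) y₀ ⟨hy₀, hΩ⟩ hmin'
      · exact hbd k hk y₀ hy₀ hΩ
  exact fun k hk => key (S.N i - k) k (by omega)

/-- Tietze's extension theorem followed by smooth approximation of continuous functions. -/
theorem exists_smooth_approx_vT (Q : Problem d A B) {ε : ℝ} (hε : 0 < ε) : ∃ w : E d → ℝ,
    ContDiff ℝ (⊤ : ℕ∞) w ∧ ∀ x ∈ closure Q.Ω, |w x - Q.vT x| ≤ ε := by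
  obtain ⟨f, hf⟩ := ContinuousMap.exists_restrict_eq (isClosed_closure (s := Q.Ω))
    ⟨(closure Q.Ω).domRestrict Q.vT, Q.cont_vT.domRestrict⟩
  obtain ⟨w, hw, hwf, -⟩ := f.continuous.exists_contDiff_approx ⊤ (ε := fun _ => ε)
    continuous_const fun _ => hε
  refine ⟨w, hw, fun x hx => ?_⟩
  have h1 : f x = Q.vT x := DFunLike.congr_fun hf ⟨x, hx⟩
  rw [← h1, ← Real.dist_eq]
  exact (hwf x).le

theorem exists_ham_bound_smooth [CompactSpace A] [CompactSpace B] (Q : Problem d A B)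
    {w : E d → ℝ} (hw : ContDiff ℝ (⊤ : ℕ∞) w) : ∃ K, 0 ≤ K ∧ ∀ y ∈ closure Q.Ω, ∀ s,
      |s - w y| ≤ 1 → ∀ p, |Q.ham y (Laplacian.laplacian w y) (∇ w y) s p| ≤ K := by
  have hw2 := contDiff_two_of_smooth hw
  obtain ⟨C₁, hC₁⟩ := Q.isCompact_closure.exists_bound_of_continuousOn
    (continuous_laplacian hw2).continuousOn
  obtain ⟨C₂, hC₂⟩ := Q.isCompact_closure.exists_bound_of_continuousOn
    (continuous_gradient hw2).continuousOn
  obtain ⟨C₃, hC₃⟩ := Q.isCompact_closure.exists_bound_of_continuousOn hw.continuous.continuousOn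
  obtain ⟨K, hK0, hK⟩ := exists_ham_bound Q (max C₁ (max C₂ (C₃ + 1)))
  refine ⟨K, hK0, fun y hy s hs p => hK y hy _ _ _ ?_ ?_ ?_ p⟩
  · exact (hC₁ y hy).trans (le_max_left _ _)
  · exact (hC₂ y hy).trans ((le_max_left _ _).trans (le_max_right _ _))
  · refine le_trans ?_ ((le_max_right _ _).trans (le_max_right _ _))
    have h1 := abs_sub_abs_le_abs_sub s (w y)
    have h2 : |w y| ≤ C₃ := hC₃ y hy
    linarith

variable [CompactSpace A] [CompactSpace B] [Nonempty A] [Nonempty B]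

omit [Nonempty A] [Nonempty B] in
-- Supplies the slope `K` of the discrete barriers in time. It depends on `w` and may blow up as `w`
-- approaches `v_T`, which is harmless since `w` is fixed before the limit in `i`.
theorem exists_discHam_projection_bound (hP : S.EllipticProjection) (hcons : S.Consistent)
    {w : E d → ℝ} (hw : ContDiff ℝ (⊤ : ℕ∞) w) : ∃ K, 0 ≤ K ∧ ∀ᶠ i in atTop, ∀ p,
      ∀ y ∈ S.internalNodes i, |S.discHam i (S.P i w : E d → ℝ) (S.P i w : E d → ℝ) y p| ≤ K := by
  obtain ⟨K, hK0, hK⟩ := exists_ham_bound_smooth Q hw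
  obtain ⟨γ, -, hγ⟩ := consistency hP hcons
  refine ⟨K + 1, by positivity, ?_⟩
  filter_upwards [hγ w hw 0 1 one_pos, projection_smooth hP hw one_pos] with i hi hproj p y hy
  have hyc : y ∈ closure Q.Ω := subset_closure hy.2
  have h1 := hi p y hy 0 0 (by simp)
  simp only [add_zero, sub_self, abs_zero, mul_zero] at h1
  have h2 := hK y hyc _ (hproj.1 y hyc) p
  have h3 := abs_sub_abs_le_abs_sub (S.discHam i (S.P i w : E d → ℝ) (S.P i w : E d → ℝ) y p)
    (Q.ham y (Laplacian.laplacian w y) (∇ w y) ((S.P i w : E d → ℝ) y) p)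
  have h4 : (fun x => (S.P i w : E d → ℝ) x) = (S.P i w : E d → ℝ) := rfl
  rw [h4] at h1
  linarith

/-- Discrete supersolutions built from smooth approximations of the final data. -/
theorem exists_upper_bound (hv : S.IsNumericalSolution v)
    (hP : S.EllipticProjection) (hcons : S.Consistent) (hmon : S.Monotone) {w : E d → ℝ}
    (hw : ContDiff ℝ (⊤ : ℕ∞) w) {ε : ℝ} (hε : 0 < ε)
    (hwT : ∀ x ∈ closure Q.Ω, |w x - Q.vT x| ≤ ε) : ∃ K, 0 ≤ K ∧ ∀ᶠ i in atTop, ∀ k ≤ S.N i,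
      ∀ y ∈ (S.mesh i).vertices, v i k y ≤ w y + 3 * ε + K * (Q.T - S.time i k) := by
  obtain ⟨K, hK0, hK⟩ := exists_discHam_projection_bound hP hcons hw
  refine ⟨K, hK0, ?_⟩
  filter_upwards [hK, projection_smooth hP hw (half_pos hε),
    boundary_values_tendsto hv hP (half_pos hε)] with i hKi hproj hbd
  have hpos := S.h_pos i
  set W : E d → ℝ := (S.P i w : E d → ℝ) with hW
  have hWm : ∀ m : ℝ, (fun x => W x + m) ∈ P1Space (S.mesh i) := fun m =>
    Submodule.add_mem _ (S.P i w).2 (const_mem_P1Space m)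
  -- The shift `2 * ε` covers the error `ε` of `w`, the error `ε / 2` of the projection and the
  -- error `ε / 2` of the discrete data.
  have hWT : ∀ y ∈ closure Q.Ω, Q.vT y + ε / 2 ≤ W y + 2 * ε := fun y hy => by
    have h1 := abs_le.1 (hproj.1 y hy)
    have h2 := abs_le.1 (hwT y hy)
    linarith
  have hm : ∀ k ≤ S.N i, 0 ≤ K * (Q.T - S.time i k) := fun k hk =>
    mul_nonneg hK0 (sub_nonneg.2 (time_mem_Icc S hk).2)
  have key := nodes_nonneg_of_scheme (S := S) (i := i)
    (D := fun k y => W y + (2 * ε + K * (Q.T - S.time i k)) - v i k y) ?_ ?_ ?_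
  · intro k hk y hy
    have h1 := key k hk y hy
    have h2 := abs_le.1 (hproj.1 y (vertices_subset_closure hy))
    linarith
  · intro y hy
    have hyc := vertices_subset_closure hy
    have h1 := abs_le.1 (hbd.1 y hyc)
    linarith [hWT y hyc, hm _ le_rfl]
  · intro k hk y hy hyΩ
    have hyc := vertices_subset_closure hy
    have hyf := mem_frontier_of_notMem hyc hyΩ
    have h1 := abs_le.1 (hbd.2 k hk.le y hyf)
    rw [← Q.vT_eq_g hyf] at h1
    linarith [hWT y hyc, hm _ hk.le]
  · intro k hk hnext y hy hmin
    -- At a negative minimum the touching inequality applies. There the reaction terms of the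
    -- non-negative shifts only help, so the Hamiltonian is at least `-K`, whereas the time
    -- decrement `K h` makes the negated difference quotient exceed `K`.
    by_contra hneg
    have hs := scheme_le_of_touching hv hcons hmon hk hy (hWm (2 * ε + K * (Q.T - S.time i (k + 1))))
      (hWm (2 * ε + K * (Q.T - S.time i k))) (fun z hz => by linarith [hnext z hz])
      (by linarith) hmin
    have h1 : - K ≤ infSup (S.discHam i (fun x => W x + (2 * ε + K * (Q.T - S.time i (k + 1))))
        (fun x => W x + (2 * ε + K * (Q.T - S.time i k))) y) := by
      obtain ⟨C, hC⟩ := exists_discHam_bound hcons (hWm (2 * ε + K * (Q.T - S.time i (k + 1))))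
        (hWm (2 * ε + K * (Q.T - S.time i k))) hy
      have h2 := infSup_le_add (X := fun _ : A × B => - K) (C := max C K) (ε := 0)
        (fun p => by rw [abs_neg, abs_of_nonneg hK0]; exact le_max_right _ _)
        (fun p => (hC p).trans (le_max_left _ _)) (fun p => by
          obtain ⟨κ₁, κ₂, hκ₁, hκ₂, hκ⟩ := exists_discHam_add_const hcons p hy
          rw [hκ W (S.P i w).2]
          have h3 := (abs_le.1 (hKi p y hy)).1
          have h4 := mul_nonneg hκ₁ (add_nonneg (mul_nonneg zero_le_two hε.le) (hm _ hk))
          have h5 := mul_nonneg hκ₂ (add_nonneg (mul_nonneg zero_le_two hε.le) (hm _ hk.le))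
          linarith)
      rwa [infSup_const, add_zero] at h2
    have h6 : K < - ((W y + (2 * ε + K * (Q.T - S.time i (k + 1))) - v i k y) / S.h i) := by
      rw [← neg_div, lt_div_iff₀ hpos, time_succ]
      linarith
    linarith

/-- Discrete subsolutions built from smooth approximations of the final data. -/
theorem exists_lower_bound (hv : S.IsNumericalSolution v)
    (hP : S.EllipticProjection) (hcons : S.Consistent) (hmon : S.Monotone) {w : E d → ℝ}
    (hw : ContDiff ℝ (⊤ : ℕ∞) w) {ε : ℝ} (hε : 0 < ε)
    (hwT : ∀ x ∈ closure Q.Ω, |w x - Q.vT x| ≤ ε) : ∃ K, 0 ≤ K ∧ ∀ᶠ i in atTop, ∀ k ≤ S.N i,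
      ∀ y ∈ (S.mesh i).vertices, - v i k y ≤ - w y + 3 * ε + K * (Q.T - S.time i k) := by
  obtain ⟨K, hK0, hK⟩ := exists_discHam_projection_bound hP hcons hw
  refine ⟨K, hK0, ?_⟩
  filter_upwards [hK, projection_smooth hP hw (half_pos hε),
    boundary_values_tendsto hv hP (half_pos hε)] with i hKi hproj hbd
  have hpos := S.h_pos i
  set W : E d → ℝ := (S.P i w : E d → ℝ) with hW
  have hWm : ∀ m : ℝ, (fun x => W x + m) ∈ P1Space (S.mesh i) := fun m =>
    Submodule.add_mem _ (S.P i w).2 (const_mem_P1Space m)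
  have hWT : ∀ y ∈ closure Q.Ω, W y - 2 * ε ≤ Q.vT y - ε / 2 := fun y hy => by
    have h1 := abs_le.1 (hproj.1 y hy)
    have h2 := abs_le.1 (hwT y hy)
    linarith
  have hm : ∀ k ≤ S.N i, 0 ≤ K * (Q.T - S.time i k) := fun k hk =>
    mul_nonneg hK0 (sub_nonneg.2 (time_mem_Icc S hk).2)
  have key := nodes_nonneg_of_scheme (S := S) (i := i)
    (D := fun k y => v i k y - (W y + (- (2 * ε) - K * (Q.T - S.time i k)))) ?_ ?_ ?_
  · intro k hk y hy
    have h1 := key k hk y hy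
    have h2 := abs_le.1 (hproj.1 y (vertices_subset_closure hy))
    linarith
  · intro y hy
    have hyc := vertices_subset_closure hy
    have h1 := abs_le.1 (hbd.1 y hyc)
    linarith [hWT y hyc, hm _ le_rfl]
  · intro k hk y hy hyΩ
    have hyc := vertices_subset_closure hy
    have hyf := mem_frontier_of_notMem hyc hyΩ
    have h1 := abs_le.1 (hbd.2 k hk.le y hyf)
    rw [← Q.vT_eq_g hyf] at h1
    linarith [hWT y hyc, hm _ hk.le]
  · intro k hk hnext y hy hmin
    -- Mirror image: the shifts are now non-positive, so the Hamiltonian is at most `K` while the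
    -- negated difference quotient falls below `-K`.
    by_contra hneg
    have hs := le_scheme_of_touching hv hcons hmon hk hy
      (hWm (- (2 * ε) - K * (Q.T - S.time i (k + 1)))) (hWm (- (2 * ε) - K * (Q.T - S.time i k)))
      (fun z hz => by linarith [hnext z hz]) (by linarith) hmin
    have h1 : infSup (S.discHam i (fun x => W x + (- (2 * ε) - K * (Q.T - S.time i (k + 1))))
        (fun x => W x + (- (2 * ε) - K * (Q.T - S.time i k))) y) ≤ K := by
      obtain ⟨C, hC⟩ := exists_discHam_bound hcons (hWm (- (2 * ε) - K * (Q.T - S.time i (k + 1))))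
        (hWm (- (2 * ε) - K * (Q.T - S.time i k))) hy
      have h2 := infSup_le_add (Y := fun _ : A × B => K) (C := max C K) (ε := 0)
        (fun p => (hC p).trans (le_max_left _ _))
        (fun p => by rw [abs_of_nonneg hK0]; exact le_max_right _ _) (fun p => by
          obtain ⟨κ₁, κ₂, hκ₁, hκ₂, hκ⟩ := exists_discHam_add_const hcons p hy
          rw [hκ W (S.P i w).2]
          have h3 := (abs_le.1 (hKi p y hy)).2
          have h4 := mul_nonneg hκ₁ (add_nonneg (mul_nonneg zero_le_two hε.le) (hm _ hk))
          have h5 := mul_nonneg hκ₂ (add_nonneg (mul_nonneg zero_le_two hε.le) (hm _ hk.le))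
          linarith)
      rwa [infSup_const, add_zero] at h2
    have h6 : - ((W y + (- (2 * ε) - K * (Q.T - S.time i (k + 1))) - v i k y) / S.h i) < - K := by
      rw [neg_lt_neg_iff, lt_div_iff₀ hpos, time_succ]
      linarith
    linarith

theorem exists_eventuallyBounded (hv : S.IsNumericalSolution v) (hP : S.EllipticProjection)
    (hcons : S.Consistent) (hmon : S.Monotone) : ∃ C, EventuallyBounded S v C := by
  obtain ⟨w, hw, hwT⟩ := exists_smooth_approx_vT Q one_pos
  obtain ⟨K₁, hK₁, h₁⟩ := exists_upper_bound hv hP hcons hmon hw one_pos hwT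
  obtain ⟨K₂, hK₂, h₂⟩ := exists_lower_bound hv hP hcons hmon hw one_pos hwT
  obtain ⟨Cw, hCw⟩ := Q.isCompact_closure.exists_bound_of_continuousOn hw.continuous.continuousOn
  refine ⟨Cw + 3 + K₁ * Q.T + K₂ * Q.T, ?_⟩
  filter_upwards [h₁, h₂] with i h1 h2 k hk y hy
  have ht := time_mem_Icc S hk
  have h3 := h1 k hk y hy
  have h4 := h2 k hk y hy
  have h5 := abs_le.1 (hCw y (vertices_subset_closure hy))
  have h6 : K₁ * (Q.T - S.time i k) ≤ K₁ * Q.T := mul_le_mul_of_nonneg_left (by linarith [ht.1]) hK₁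
  have h7 : K₂ * (Q.T - S.time i k) ≤ K₂ * Q.T := mul_le_mul_of_nonneg_left (by linarith [ht.1]) hK₂
  have h8 := mul_nonneg hK₁ Q.T_pos.le
  have h9 := mul_nonneg hK₂ Q.T_pos.le
  rw [abs_le]
  constructor <;> linarith

omit [CompactSpace A] [CompactSpace B] [Nonempty A] [Nonempty B] in
-- With `w` and `K` fixed, the term `K (T - t)` disappears as the nodes approach the final time, and
-- only then is `ε` sent to zero.
theorem IsUpperLimit.final_le (hu : IsUpperLimit S v u) {φ : E d → ℝ} {x : E d}
    (hx : x ∈ closure Q.Ω) (h : ∀ ε > 0, ∃ w : E d → ℝ, Continuous w ∧ |w x - φ x| ≤ ε ∧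
      ∃ K, ∀ᶠ i in atTop, ∀ k ≤ S.N i,
        ∀ y ∈ (S.mesh i).vertices, v i k y ≤ w y + 3 * ε + K * (Q.T - S.time i k)) :
    u (Q.T, x) ≤ φ x := by
  refine le_of_forall_pos_le_add fun δ hδ => ?_
  -- Of the five parts, three pay for `3 * ε`, one for `w x` against `φ x`, and one for continuity
  -- near `(T, x)`.
  obtain ⟨w, hw, hwx, K, hK⟩ := h (δ / 5) (by positivity)
  refine hu.le_of_eventually ⟨⟨Q.T_pos.le, le_rfl⟩, hx⟩ ?_
  have hc : Continuous fun z : ℝ × E d => w z.2 + K * (Q.T - z.1) := by fun_prop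
  have hU : ∀ᶠ z in 𝓝 (Q.T, x), w z.2 + K * (Q.T - z.1) < w x + δ / 5 :=
    hc.continuousAt.eventually (gt_mem_nhds (by simp only [sub_self, mul_zero]; linarith))
  refine eventually_nodeFilter.2 ⟨_, hU, hK.mono fun i hi k hk y hy hyU => ?_⟩
  have h1 : w y + K * (Q.T - S.time i k) < w x + δ / 5 := hyU
  have h2 := hi k hk y hy
  have h3 := (_root_.abs_le.1 hwx).2
  simp only
  linarith

end FinalTime

/-! ### Boundary values on `ω` by means of barriers -/

section Barriers

variable {d : ℕ} {A B : Type*} [MetricSpace A] [MetricSpace B] {Q : Problem d A B}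
  {S : Discretisation Q} {v : ℕ → ℕ → E d → ℝ} {u : ℝ × E d → ℝ}

/-- Barriers bound the node functions from below near a boundary point. -/
theorem eventually_le_of_barrier {g : E d → ℝ} (hg : Continuous g)
    (hv : ∀ δ > 0, ∀ᶠ i in atTop, ∀ k ≤ S.N i, ∀ y ∈ frontier Q.Ω, |v i k y - g y| ≤ δ)
    {y : E d} (hy : y ∈ frontier Q.Ω) {ζ : ℝ → ℝ × E d → ℝ}
    (hζ : ∀ ε > 0, S.AdmissibleBarrier (ζ ε) ∧
      ∃ i₀, ∀ i ≥ i₀, ∀ k ≤ S.N i, ∃ z ∈ frontier Q.Ω,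
        IsMinOn (fun x => v i k x - (S.P i (fun x' => ζ ε (S.time i k, x')) : E d → ℝ) x)
          (closure Q.Ω) z)
    {t : ℝ} (ht : t ∈ Icc 0 Q.T) {q : ℝ → E d}
    (hq : ∀ ε > 0, q ε ∈ frontier Q.Ω ∧ IsMinOn (fun x => g x - ζ ε (t, x)) (frontier Q.Ω) (q ε))
    (hqy : Tendsto q (𝓝[>] 0) (𝓝 y))
    (hlim : ∀ η > 0, ∀ᶠ ε in 𝓝[>] (0 : ℝ), - η ≤ ζ ε (t, y) - ζ ε (t, q ε)) {η : ℝ} (hη : 0 < η) :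
    ∀ᶠ r in S.nodeFilter (t, y), g y - 8 * η ≤ v r.1 r.2.1 r.2.2 := by
  have hgq : ∀ᶠ ε in 𝓝[>] (0 : ℝ), g y - η < g (q ε) :=
    ((hg.tendsto y).comp hqy).eventually (lt_mem_nhds (by linarith))
  -- The barrier is fixed before the level `i` is taken large; its Lipschitz constant may depend on
  -- `ε`.
  obtain ⟨ε, h1, h2, hε⟩ := (hgq.and ((hlim η hη).and self_mem_nhdsWithin)).exists
  have hε : 0 < ε := hε
  obtain ⟨⟨⟨K, hK⟩, hconv⟩, i₀, hi₀⟩ := hζ ε hε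
  have hyc : y ∈ closure Q.Ω := frontier_subset_closure hy
  have hrK : 0 < η / (K + 1) := by positivity
  refine eventually_nodeFilter.2 ⟨_, Metric.ball_mem_nhds (t, y) hrK, ?_⟩
  filter_upwards [hv η hη, Metric.tendstoUniformlyOn_iff.1 hconv η hη, eventually_ge_atTop i₀]
    with i hvi hci hi k hk y' hy' hball
  obtain ⟨z, hz, hmin⟩ := hi₀ i hi k hk
  have hzc : z ∈ closure Q.Ω := frontier_subset_closure hz
  have hyc' := vertices_subset_closure hy'
  have hsk := time_mem_Icc S hk
  have hlip : ∀ a ∈ Q.cyl, ∀ b ∈ Q.cyl, dist a b < η / (K + 1) → |ζ ε a - ζ ε b| ≤ η := by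
    intro a ha b hb hab
    rw [← Real.dist_eq]
    calc dist (ζ ε a) (ζ ε b) ≤ K * dist a b := hK.dist_le_mul a ha b hb
      _ ≤ (K + 1) * (η / (K + 1)) := by gcongr; linarith
      _ = η := by field_simp
  have hd : dist (S.time i k, y') (t, y) < η / (K + 1) := hball
  have e1 := hmin hyc'
  simp only [mem_ofPred_eq] at e1
  have e2 := abs_le.1 (hvi k hk z hz)
  have e3 := hci (S.time i k, y') ⟨hsk, hyc'⟩
  have e4 := hci (S.time i k, z) ⟨hsk, hzc⟩
  rw [Real.dist_eq, abs_lt] at e3 e4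
  have e5 := abs_le.1 (hlip (S.time i k, y') ⟨hsk, hyc'⟩ (t, y) ⟨ht, hyc⟩ hd)
  have e6 := abs_le.1 (hlip (S.time i k, z) ⟨hsk, hzc⟩ (t, z) ⟨ht, hzc⟩ (by
    refine lt_of_le_of_lt ?_ hd
    rw [Prod.dist_eq, Prod.dist_eq, dist_self]
    exact max_le (le_max_left _ _) (dist_nonneg.trans (le_max_left _ _))))
  have e7 := (hq ε hε).2 hz
  simp only [mem_ofPred_eq] at e7
  simp only at e3 e4 ⊢
  -- The discrete minimiser `z` varies with `i` and `k`. Minimality of `q ε` for `g - ζ` at the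
  -- fixed time `t` eliminates it. The errors add up to `7 η`: boundary data one, projection two,
  -- Lipschitz bounds two, `g` at `q ε` one, barrier one.
  linarith [e2.1, e3.1, e3.2, e4.1, e4.2, e5.1, e6.2]

theorem admissibleBarrier_neg {ζ : ℝ × E d → ℝ} (h : S.AdmissibleBarrier ζ) :
    S.AdmissibleBarrier fun z => - ζ z := by
  obtain ⟨⟨K, hK⟩, hconv⟩ := h
  refine ⟨⟨K, hK.neg⟩, ?_⟩
  rw [Metric.tendstoUniformlyOn_iff] at hconv ⊢
  refine fun ε hε => (hconv ε hε).mono fun i hi z hz => ?_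
  have h1 : (fun x => - ζ (z.1, x)) = - fun x => ζ (z.1, x) := rfl
  simp only [h1, map_neg, Submodule.coe_neg, Pi.neg_apply, dist_neg_neg]
  exact hi z hz

theorem neg_le_of_upperBarriers (hP : S.EllipticProjection) (hv : S.IsNumericalSolution v)
    (hu : IsUpperLimit S (fun i k y => - v i k y) u) {ω : Set (E d)} (hω : ω ⊆ frontier Q.Ω)
    (h : S.UpperBarriers ω v) {y : E d} (hy : y ∈ ω) {t : ℝ} (ht : t ∈ Icc 0 Q.T) :
    u (t, y) ≤ - Q.g y := by
  obtain ⟨ζ, hζ, hq⟩ := h y hy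
  obtain ⟨q, hq, hqy, hlim⟩ := hq t ht
  refine le_of_forall_pos_le_add fun δ hδ => ?_
  refine hu.le_of_eventually ⟨ht, frontier_subset_closure (hω hy)⟩ ?_
  have := eventually_le_of_barrier (continuous_g Q)
    (fun δ hδ => (boundary_values_tendsto hv hP hδ).mono fun i hi => hi.2) (hω hy) hζ ht hq hqy hlim
    (show 0 < δ / 8 by positivity)
  exact this.mono fun r hr => by linarith

theorem le_of_lowerBarriers (hP : S.EllipticProjection) (hv : S.IsNumericalSolution v)
    (hu : IsUpperLimit S v u) {ω : Set (E d)} (hω : ω ⊆ frontier Q.Ω)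
    (h : S.LowerBarriers ω v) {y : E d} (hy : y ∈ ω) {t : ℝ} (ht : t ∈ Icc 0 Q.T) :
    u (t, y) ≤ Q.g y := by
  obtain ⟨ξ, hξ, hr⟩ := h y hy
  obtain ⟨r, hr, hry, hlim⟩ := hr t ht
  refine le_of_forall_pos_le_add fun δ hδ => ?_
  refine hu.le_of_eventually ⟨ht, frontier_subset_closure (hω hy)⟩ ?_
  -- Reflection turns maximisers of `v - P ξ` into minimisers for `-v`, `-g` and `-ξ`.
  have := eventually_le_of_barrier (S := S) (v := fun i k y => - v i k y) (g := fun x => - Q.g x)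
    (continuous_g Q).neg (fun δ hδ => (boundary_values_tendsto hv hP hδ).mono fun i hi k hk y hy => by
      rw [← abs_neg]
      convert hi.2 k hk y hy using 2
      ring) (hω hy) (ζ := fun ε z => - ξ ε z) (fun ε hε => by
      obtain ⟨h1, i₀, h2⟩ := hξ ε hε
      refine ⟨admissibleBarrier_neg h1, i₀, fun i hi k hk => ?_⟩
      obtain ⟨z, hz, hzm⟩ := h2 i hi k hk
      refine ⟨z, hz, ?_⟩
      have h3 : (fun x' => - ξ ε (S.time i k, x')) = - fun x' => ξ ε (S.time i k, x') := rfl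
      rw [h3]
      simp only [map_neg, Submodule.coe_neg, Pi.neg_apply]
      intro x hx
      have h4 := hzm hx
      simp only [mem_ofPred_eq] at h4 ⊢
      linarith) ht (q := r)
    (fun ε hε => ⟨(hr ε hε).1, by
      intro x hx
      have h4 := (hr ε hε).2 hx
      simp only [mem_ofPred_eq] at h4 ⊢
      linarith⟩) hry
    (fun η hη => (hlim η hη).mono fun ε hε => by linarith) (show 0 < δ / 8 by positivity)
  exact this.mono fun r hr => by linarith

end Barriers

/-! ### Semicontinuous envelopes of bounded functions -/

section SemicontinuousEnvelopes

variable {X : Type*} [TopologicalSpace X] {D : Set X} {u w : X → ℝ} {z : X}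

theorem uscEnv_congr (h : EqOn u w D) : uscEnv D u = uscEnv D w := by
  funext z
  exact limsup_congr (eventually_mem_nhdsWithin.mono fun x hx => h hx)

theorem lscEnv_congr (h : EqOn u w D) : lscEnv D u = lscEnv D w := by
  funext z
  exact liminf_congr (eventually_mem_nhdsWithin.mono fun x hx => h hx)

/-- One inequality is upper semicontinuity; the other holds because `z` itself lies in every
relative neighbourhood. Boundedness is needed for the real `limsup` to be meaningful. -/
theorem uscEnv_eq (hz : z ∈ D) {C : ℝ} (hC : ∀ x ∈ D, |u x| ≤ C)
    (h : ∀ c, u z < c → ∀ᶠ x in 𝓝[D] z, u x < c) : uscEnv D u z = u z := by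
  have : (𝓝[D] z).NeBot := mem_closure_iff_nhdsWithin_neBot.1 (subset_closure hz)
  have hup : ∀ᶠ x in 𝓝[D] z, u x ≤ C :=
    eventually_mem_nhdsWithin.mono fun x hx => (abs_le.1 (hC x hx)).2
  have hlo : ∀ᶠ x in 𝓝[D] z, - C ≤ u x :=
    eventually_mem_nhdsWithin.mono fun x hx => (abs_le.1 (hC x hx)).1
  have hb : IsBoundedUnder (· ≤ ·) (𝓝[D] z) u := ⟨C, hup⟩
  have hb' : IsBoundedUnder (· ≥ ·) (𝓝[D] z) u := ⟨-C, hlo⟩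
  refine le_antisymm (le_of_forall_gt_imp_ge_of_dense fun c hc => ?_) ?_
  · exact limsup_le_of_le hb'.isCoboundedUnder_flip ((h c hc).mono fun x hx => hx.le)
  · refine le_limsup_of_frequently_le ?_ hb
    intro hn
    exact (mem_of_mem_nhdsWithin hz hn) le_rfl

theorem lscEnv_eq (hz : z ∈ D) {C : ℝ} (hC : ∀ x ∈ D, |u x| ≤ C)
    (h : ∀ c, c < u z → ∀ᶠ x in 𝓝[D] z, c < u x) : lscEnv D u z = u z := by
  have : (𝓝[D] z).NeBot := mem_closure_iff_nhdsWithin_neBot.1 (subset_closure hz)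
  have hup : ∀ᶠ x in 𝓝[D] z, u x ≤ C :=
    eventually_mem_nhdsWithin.mono fun x hx => (abs_le.1 (hC x hx)).2
  have hlo : ∀ᶠ x in 𝓝[D] z, - C ≤ u x :=
    eventually_mem_nhdsWithin.mono fun x hx => (abs_le.1 (hC x hx)).1
  have hb : IsBoundedUnder (· ≤ ·) (𝓝[D] z) u := ⟨C, hup⟩
  have hb' : IsBoundedUnder (· ≥ ·) (𝓝[D] z) u := ⟨-C, hlo⟩
  refine le_antisymm ?_ (le_of_forall_lt_imp_le_of_dense fun c hc => ?_)
  · refine liminf_le_of_frequently_le ?_ hb'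
    intro hn
    exact (mem_of_mem_nhdsWithin hz hn) le_rfl
  · exact le_liminf_of_le hb.isCoboundedUnder_flip ((h c hc).mono fun x hx => hx.le)

end SemicontinuousEnvelopes

/-! ### Envelopes as sub- and supersolutions, and uniform convergence -/

section Convergence

variable {d : ℕ} {A B : Type*} [MetricSpace A] [MetricSpace B] {Q : Problem d A B}
  {S : Discretisation Q} {v : ℕ → ℕ → E d → ℝ} {U L : ℝ × E d → ℝ}

theorem lower_le_upper (hU : IsUpperLimit S v U)
    (hL : IsUpperLimit S (fun i k y => - v i k y) fun z => - L z) {z : ℝ × E d} (hz : z ∈ Q.cyl) :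
    L z ≤ U z := by
  by_contra hlt
  obtain ⟨c, hc1, hc2⟩ := exists_between (not_le.1 hlt)
  have := nodeFilter_neBot (S := S) hz
  obtain ⟨q, h1, h2⟩ := ((hU.eventually_lt z hz c hc1).and
    (hL.eventually_lt z hz (-c) (neg_lt_neg hc2))).exists
  linarith

theorem lower_semicontinuous (hL : IsUpperLimit S (fun i k y => - v i k y) fun z => - L z)
    {z : ℝ × E d} (hz : z ∈ Q.cyl) {c : ℝ} (hc : c < L z) : ∀ᶠ z' in 𝓝[Q.cyl] z, c < L z' :=
  (hL.upperSemicontinuous hz (neg_lt_neg hc)).mono fun _ h => neg_lt_neg_iff.1 h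

/-- Where `U ≤ φ ≤ L`, the opposite order `L ≤ U` forces equality. Squeezed between the lower
semicontinuous `L` and the upper semicontinuous `U`, both functions are then continuous at that
point, so all four envelopes equal `φ`. -/
theorem strongConditions_upper {ω : Set (E d)} (hω : ω ⊆ frontier Q.Ω) {C : ℝ}
    (hb : EventuallyBounded S v C) (hU : IsUpperLimit S v U)
    (hL : IsUpperLimit S (fun i k y => - v i k y) fun z => - L z)
    (hg : ∀ x ∈ ω, ∀ t ∈ Icc 0 Q.T, U (t, x) ≤ Q.g x ∧ Q.g x ≤ L (t, x))
    (hT : ∀ x ∈ closure Q.Ω, U (Q.T, x) ≤ Q.vT x ∧ Q.vT x ≤ L (Q.T, x)) :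
    Q.StrongConditions ω U ∧ Q.StrongConditions ω L := by
  have key : ∀ z ∈ Q.cyl, ∀ φ, U z ≤ φ ∧ φ ≤ L z →
      (uscEnv Q.cyl U z = φ ∧ lscEnv Q.cyl U z = φ) ∧
      uscEnv Q.cyl L z = φ ∧ lscEnv Q.cyl L z = φ := by
    rintro z hz φ ⟨h1, h2⟩
    have h3 := lower_le_upper hU hL hz
    have hUφ : U z = φ := by linarith
    have hLφ : L z = φ := by linarith
    have hCU : ∀ z ∈ Q.cyl, |U z| ≤ C := fun z hz => hU.abs_le hb hz
    have hCL : ∀ z ∈ Q.cyl, |L z| ≤ C := fun z hz => by simpa using hL.abs_le hb.neg hz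
    refine ⟨⟨?_, ?_⟩, ?_, ?_⟩
    · rw [uscEnv_eq hz hCU fun c hc => hU.upperSemicontinuous hz hc, hUφ]
    · rw [lscEnv_eq hz hCU fun c hc => ?_, hUφ]
      filter_upwards [lower_semicontinuous hL hz (c := c) (by linarith), self_mem_nhdsWithin]
        with z' h4 h5
      exact h4.trans_le (lower_le_upper hU hL h5)
    · rw [uscEnv_eq hz hCL fun c hc => ?_, hLφ]
      filter_upwards [hU.upperSemicontinuous hz (c := c) (by linarith), self_mem_nhdsWithin]
        with z' h4 h5
      exact (lower_le_upper hU hL h5).trans_lt h4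
    · rw [lscEnv_eq hz hCL fun c hc => lower_semicontinuous hL hz hc, hLφ]
  have hTm : Q.T ∈ Icc 0 Q.T := ⟨Q.T_pos.le, le_rfl⟩
  exact ⟨⟨fun x hx t ht => (key (t, x) ⟨ht, frontier_subset_closure (hω hx)⟩ _ (hg x hx t ht)).1,
      fun x hx => (key (Q.T, x) ⟨hTm, hx⟩ _ (hT x hx)).1⟩,
    ⟨fun x hx t ht => (key (t, x) ⟨ht, frontier_subset_closure (hω hx)⟩ _ (hg x hx t ht)).2,
      fun x hx => (key (Q.T, x) ⟨hTm, hx⟩ _ (hT x hx)).2⟩⟩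

theorem Problem.IsSupersolution.congr {ω : Set (E d)} (h : Q.IsSupersolution ω U)
    (heq : EqOn U L Q.cyl) : Q.IsSupersolution ω L := by
  unfold Problem.IsSupersolution at h ⊢
  rw [← lscEnv_congr heq]
  obtain ⟨⟨C, hC⟩, h⟩ := h
  exact ⟨⟨C, fun z hz => heq hz ▸ hC z hz⟩, h⟩

theorem strongConditions_congr {ω : Set (E d)} (h : Q.StrongConditions ω U)
    (heq : EqOn U L Q.cyl) : Q.StrongConditions ω L := by
  unfold Problem.StrongConditions at h ⊢
  rwa [← uscEnv_congr heq, ← lscEnv_congr heq]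

theorem openCyl_subset (Q : Problem d A B) : Ico 0 Q.T ×ˢ closure Q.Ω ⊆ Q.cyl :=
  prod_mono Ico_subset_Icc_self Subset.rfl

section Solutions

variable [CompactSpace A] [CompactSpace B] [Nonempty A] [Nonempty B]

/-- An upper limit coincides with its own upper envelope on the cylinder, so the inequality already
proved for `U` is the one in the definition. -/
theorem IsUpperLimit.isSubsolution (hU : IsUpperLimit S v U) (hv : S.IsNumericalSolution v)
    (hP : S.EllipticProjection) (hcons : S.Consistent) (hmon : S.Monotone) {C : ℝ}
    (hb : EventuallyBounded S v C) {ω : Set (E d)} (hstrong : Q.StrongConditions ω U) :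
    Q.IsSubsolution ω U := by
  have hC : ∀ z ∈ Q.cyl, |U z| ≤ C := fun z hz => hU.abs_le hb hz
  have heq : EqOn U (uscEnv Q.cyl U) Q.cyl := fun z hz =>
    (uscEnv_eq hz hC fun c hc => hU.upperSemicontinuous hz hc).symm
  refine ⟨⟨C, hC⟩, fun ψ hψ z hz hmax => ?_, strongConditions_congr hstrong heq⟩
  rw [← heq (openCyl_subset Q hz)]
  refine hU.lscEnv_F_nonpos hv hP hcons hmon hb hψ hz ?_
  refine hmax.congr (eventually_mem_nhdsWithin.mono fun z' hz' => ?_) ?_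
  · exact congrArg (· - ψ z') (heq (openCyl_subset Q hz')).symm
  · exact hz

theorem isSupersolution_of_isUpperLimit_neg
    (hL : IsUpperLimit S (fun i k y => - v i k y) fun z => - L z) (hv : S.IsNumericalSolution v)
    (hP : S.EllipticProjection) (hcons : S.Consistent) (hmon : S.Monotone) {C : ℝ}
    (hb : EventuallyBounded S v C) {ω : Set (E d)} (hstrong : Q.StrongConditions ω L) :
    Q.IsSupersolution ω L := by
  have hC : ∀ z ∈ Q.cyl, |L z| ≤ C := fun z hz => by simpa using hL.abs_le hb.neg hz
  have heq : EqOn L (lscEnv Q.cyl L) Q.cyl := fun z hz =>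
    (lscEnv_eq hz hC fun c hc => lower_semicontinuous hL hz hc).symm
  refine ⟨⟨C, hC⟩, fun ψ hψ z hz hmin => ?_, strongConditions_congr hstrong heq⟩
  rw [← heq (openCyl_subset Q hz)]
  refine uscEnv_F_nonneg_of_isUpperLimit_neg hL hv hP hcons hmon hb hψ hz ?_
  refine hmin.congr (eventually_mem_nhdsWithin.mono fun z' hz' => ?_) ?_
  · exact congrArg (· - ψ z') (heq (openCyl_subset Q hz')).symm
  · exact hz

end Solutions

/-- If upper and lower limits agree, then the time extensions of the numerical solutions converge
uniformly. -/
theorem tendstoUniformlyOn_of_limits (hv : ∀ i, ∀ k ≤ S.N i, v i k ∈ P1Space (S.mesh i))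
    (hU : IsUpperLimit S v U) (hL : IsUpperLimit S (fun i k y => - v i k y) fun z => - U z)
    {V : ℕ → ℝ × E d → ℝ} (hV : S.IsTimeExtension v V) :
    TendstoUniformlyOn V U atTop Q.cyl := by
  -- A function that is both an upper and a lower limit is semicontinuous from both sides.
  have hcont : ContinuousOn U Q.cyl := fun z hz => by
    refine tendsto_order.2 ⟨fun c hc => lower_semicontinuous hL hz hc,
      fun c hc => hU.upperSemicontinuous hz hc⟩
  rw [Metric.tendstoUniformlyOn_iff]
  intro ε hε
  have hε3 : 0 < ε / 3 := by positivity
  obtain ⟨ρ, hρ, hunif⟩ := Metric.uniformContinuousOn_iff.1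
    ((isCompact_cyl Q).uniformContinuousOn_of_continuous hcont) (ε / 3) hε3
  filter_upwards [hU.eventually_le hcont (fun _ _ => le_rfl) hε3,
    hL.eventually_le hcont.neg (fun _ _ => le_rfl) hε3,
    S.meshSize_tendsto.eventually (gt_mem_nhds hρ), (h_tendsto S).eventually (gt_mem_nhds hρ)]
    with i h1 h2 hm hh
  rintro ⟨t, x⟩ ⟨ht, hx⟩
  obtain ⟨k, hk, hkt⟩ := exists_time_between S i ht
  -- Nodal convergence is uniform by compactness. Between nodes, the value is a convex combination
  -- of values at vertices within one mesh size, and in time it lies between two adjacent steps.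
  have key : ∀ κ ≤ S.N i, dist t (S.time i κ) < ρ →
      v i κ x ∈ Icc (U (t, x) - 2 * (ε / 3)) (U (t, x) + 2 * (ε / 3)) := by
    intro κ hκ hd
    have hxs := hx
    simp only at hxs
    rw [← S.space_mesh i] at hxs
    obtain ⟨s, hs, hxs⟩ := Geometry.SimplicialComplex.mem_space_iff.1 hxs
    have hnode : ∀ y ∈ s, |v i κ y - U (t, x)| ≤ 2 * (ε / 3) := by
      intro y hy
      have hyv := mem_vertices_of_mem hs hy
      have h3 := h1 κ hκ y hyv
      have h4 : - v i κ y ≤ - U (S.time i κ, y) + ε / 3 := h2 κ hκ y hyv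
      have h5 := hunif (S.time i κ, y) (node_mem_cyl hκ hyv) (t, x) ⟨ht, hx⟩ (by
        rw [Prod.dist_eq, max_lt_iff]
        refine ⟨by rwa [dist_comm], ?_⟩
        exact (le_meshSize (S.finite_mesh i) hs (subset_convexHull ℝ _ hy) hxs).trans_lt hm)
      rw [Real.dist_eq, abs_lt] at h5
      rw [abs_le]
      constructor <;> linarith
    constructor
    · exact P1Space.le_of_forall_mem (hv i κ hκ) hs
        (fun y hy => by linarith [(abs_le.1 (hnode y hy)).1]) hxs
    · have h6 := P1Space.le_of_forall_mem (Submodule.neg_mem _ (hv i κ hκ)) hs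
        (c := - (U (t, x) + 2 * (ε / 3)))
        (fun y hy => by
          have := (abs_le.1 (hnode y hy)).2
          simp only [Pi.neg_apply]
          linarith) hxs
      simp only [Pi.neg_apply] at h6
      linarith
  have hh' := time_succ S i k
  have hVx := uIcc_subset_Icc (key k hk.le (by
      rw [Real.dist_eq, abs_lt]
      constructor <;> linarith [hkt.1, hkt.2])) (key (k + 1) hk (by
      rw [Real.dist_eq, abs_lt]
      constructor <;> linarith [hkt.1, hkt.2])) (hV i k hk t hkt x hx)
  rw [Real.dist_eq, abs_lt]
  constructor <;> linarith [hVx.1, hVx.2]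

theorem tendsto_eLpNorm_top_of_tendstoUniformlyOn {X : Type*} [MeasurableSpace X] {μ : Measure X}
    {s : Set X} (hs : MeasurableSet s) {F : ℕ → X → ℝ} {f : X → ℝ}
    (h : TendstoUniformlyOn F f atTop s) :
    Tendsto (fun i => eLpNorm (F i - f) ⊤ (μ.restrict s)) atTop (𝓝 0) := by
  rw [ENNReal.tendsto_nhds_zero]
  intro ε hε
  obtain ⟨r, hr0, hr⟩ := ENNReal.lt_iff_exists_nnreal_btwn.1 hε
  filter_upwards [Metric.tendstoUniformlyOn_iff.1 h r (by exact_mod_cast hr0)] with i hi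
  rw [eLpNorm_exponent_top]
  refine (eLpNormEssSup_le_of_ae_bound (C := r) ?_).trans (by simpa using hr.le)
  filter_upwards [ae_restrict_mem hs] with x hx
  have := hi x hx
  rw [dist_comm, dist_eq_norm] at this
  exact this.le

end Convergence

end Isaacs

theorem theorem8p1 {d : ℕ} (hd : 2 ≤ d) {A B : Type*}
    [MetricSpace A] [CompactSpace A] [Nonempty A] [MetricSpace B] [CompactSpace B] [Nonempty B]
    (Q : Isaacs.Problem d A B) (S : Isaacs.Discretisation Q)
    (ω : Set (Isaacs.E d)) (hω : ω ⊆ frontier Q.Ω)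
    (v : ℕ → ℕ → Isaacs.E d → ℝ) (hv : S.IsNumericalSolution v)
    (hP : S.EllipticProjection) (hcons : S.Consistent) (hmon : S.Monotone)
    (hupper : S.UpperBarriers ω v) (hlower : S.LowerBarriers ω v)
    (hcomp : Q.ComparisonPrinciple ω) :
    ∃ u : ℝ × Isaacs.E d → ℝ,
      Q.IsViscositySolution ω u ∧
      (∀ u' : ℝ × Isaacs.E d → ℝ, Q.IsViscositySolution ω u' → EqOn u' u Q.cyl) ∧
      (∀ z ∈ Q.cyl, S.lowerEnvelope v z = (u z : EReal) ∧ S.upperEnvelope v z = (u z : EReal)) ∧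
      ∀ V : ℕ → ℝ × Isaacs.E d → ℝ, S.IsTimeExtension v V →
        TendstoUniformlyOn V u atTop (Ioo 0 Q.T ×ˢ Q.Ω) ∧
        Tendsto (fun i => eLpNorm (V i - u) ⊤ (volume.restrict (Ioo 0 Q.T ×ˢ Q.Ω))) atTop
          (𝓝 0) := by
  open Isaacs in
  obtain ⟨C, hb⟩ := exists_eventuallyBounded hv hP hcons hmon
  set U : ℝ × E d → ℝ := fun z => (S.upperEnvelope v z).toReal with hUdef
  set L : ℝ × E d → ℝ := fun z => - (S.upperEnvelope (fun i k y => - v i k y) z).toReal with hLdef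
  have hU : IsUpperLimit S v U := isUpperLimit_upperEnvelope hb
  have hL : IsUpperLimit S (fun i k y => - v i k y) fun z => - L z := by
    simp only [hLdef, neg_neg]
    exact isUpperLimit_upperEnvelope hb.neg
  have hg : ∀ x ∈ ω, ∀ t ∈ Icc 0 Q.T, U (t, x) ≤ Q.g x ∧ Q.g x ≤ L (t, x) := fun x hx t ht =>
    ⟨le_of_lowerBarriers hP hv hU hω hlower hx ht,
      neg_le_neg_iff.1 (neg_le_of_upperBarriers hP hv hL hω hupper hx ht)⟩
  have hT : ∀ x ∈ closure Q.Ω, U (Q.T, x) ≤ Q.vT x ∧ Q.vT x ≤ L (Q.T, x) := by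
    refine fun x hx => ⟨hU.final_le hx fun ε hε => ?_,
      neg_le_neg_iff.1 (hL.final_le (φ := fun x => - Q.vT x) hx fun ε hε => ?_)⟩
    · obtain ⟨w, hw, hwT⟩ := exists_smooth_approx_vT Q hε
      obtain ⟨K, -, hK⟩ := exists_upper_bound hv hP hcons hmon hw hε hwT
      exact ⟨w, hw.continuous, hwT x hx, K, hK⟩
    · obtain ⟨w, hw, hwT⟩ := exists_smooth_approx_vT Q hε
      obtain ⟨K, -, hK⟩ := exists_lower_bound hv hP hcons hmon hw hε hwT
      refine ⟨fun x => - w x, hw.continuous.neg, ?_, K, hK⟩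
      rw [← neg_sub', abs_neg]
      exact hwT x hx
  obtain ⟨hSU, hSL⟩ := strongConditions_upper hω hb hU hL hg hT
  have hsub := hU.isSubsolution hv hP hcons hmon hb hSU
  have hsup := isSupersolution_of_isUpperLimit_neg hL hv hP hcons hmon hb hSL
  -- Here comparison enters: the ordering of subsolution and supersolution is opposite to the
  -- trivial ordering of the two limits.
  have heq : EqOn L U Q.cyl := fun z hz =>
    le_antisymm (lower_le_upper hU hL hz) (hcomp U L hsub hsup z hz)
  -- The supersolution property depends only on values on the cylinder, so it passes from `L` to
  -- `U`, and `U` is a solution.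
  have hsup' := hsup.congr heq
  have hL' : IsUpperLimit S (fun i k y => - v i k y) fun z => - U z :=
    ⟨fun z hz => heq hz ▸ hL.eventually_lt z hz, fun z hz => heq hz ▸ hL.frequently_lt z hz⟩
  refine ⟨U, ⟨hsub, hsup'⟩, fun u' hu' z hz => le_antisymm (hcomp u' U hu'.1 hsup' z hz)
    (hcomp U u' hsub hu'.2 z hz), fun z hz => ⟨?_, (coe_toReal_upperEnvelope hb hz).symm⟩,
    fun V hV => ?_⟩
  · rw [lowerEnvelope_eq_neg, ← coe_toReal_upperEnvelope hb.neg hz, ← heq hz, ← EReal.coe_neg]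
  · have hsubset : Ioo 0 Q.T ×ˢ Q.Ω ⊆ Q.cyl := prod_mono Ioo_subset_Icc_self subset_closure
    have hunif := (tendstoUniformlyOn_of_limits hv.mem hU hL' hV).mono hsubset
    exact ⟨hunif, tendsto_eLpNorm_top_of_tendstoUniformlyOn
      (isOpen_Ioo.prod Q.isOpen_Ω).measurableSet hunif⟩
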